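/- **Lemma 2.1.** Let $K>0$, $T>0$ and $g(t)=K/\sqrt{T-t}$ for $t\in[0,T)$. The problem $$\partial_\rho^2u(\rho,t)+g(t)\,\partial_\rho u(\rho,t)-\partial_t u(\rho,t)=0,\qquad (\rho,t)\in\big([0,\infty)\times[0,T)\big)\setminus\{(0,0)\},$$ $$u(0,t)=0\quad(0\le t<T),\qquad u(\rho,0)=\rho\quad(\rho\ge0),$$ has a nonnegative solution $u$ on $[0,\infty)\times[0,T)$ that is $C^\infty$ (up to the boundary) on $\big([0,\infty)\times[0,T)\big)\setminus\{(0,0)\}$, with $u$ and $\partial_\rho u$ continuous on all of $[0,\infty)\times[0,T)$, and with the following properties. (Derivatives at $\rho=0$ and at $t=0$ are one-sided.) (a) There are constants $C_0\ge1$ and $\alpha\in(0,1)$, depending only on $K$ and $T$, such that $$0\le u(\rho,t)\le C_0(\rho^\alpha+\rho)\qquad\text{for all }\rho\ge0,\ t\in[0,T).$$ (b) There are constants $\rho_1>1$ and $C_1>0$, depending only on $K$ and $T$, such that $$|\partial_\rho u(\rho,t)|\le C_1\qquad\text{for all }\rho\ge\rho_1,\ t\in[0,T).$$ (c) For every $\varepsilon>0$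 there is a constant $\rho_0>1$, depending only on $\varepsilon$, $K$ and $T$, such that $$u(\rho,t)\ge(1-\varepsilon)\rho\qquad\text{for all }\rho\ge\rho_0,\ t\in[0,T).$$ -/

import Mathlib

open Set
open scoped ContDiff

noncomputable section

namespace HalfLine

/-- The drift `g(t) = K / √(T - t)`, used only for `0 ≤ t < T`. -/
def drift (K T : ℝ) (t : ℝ) : ℝ := K / Real.sqrt (T - t)

/-- The space-time region `[0, ∞) × [0, T)`; points are pairs `(ρ, t)`. -/
def region (T : ℝ) : Set (ℝ × ℝ) := Ici 0 ×ˢ Ico 0 T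

/-- The region without its corner `(0, 0)`. It contains the rest of the lateral boundary `ρ = 0`
and the rest of the initial line `t = 0`. -/
def regionOffCorner (T : ℝ) : Set (ℝ × ℝ) := region T \ {((0 : ℝ), (0 : ℝ))}

/-- The space derivative `∂_ρ u (ρ, t)` on the half line `ρ ≥ 0` (one-sided at `ρ = 0`). -/
def dSpace (u : ℝ → ℝ → ℝ) (ρ t : ℝ) : ℝ := derivWithin (fun r => u r t) (Ici 0) ρ

/-- The time derivative `∂_t u (ρ, t)` for times `t ≥ 0` (one-sided at `t = 0`). -/
def dTime (u : ℝ → ℝ → ℝ) (ρ t : ℝ) : ℝ := derivWithin (fun s => u ρ s) (Ici 0) t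

/-- `u` is a smooth solution on `[0, ∞) × [0, T)` of
`∂_ρ² u + g(t) ∂_ρ u - ∂_t u = 0`, `u(0, t) = 0`, `u(ρ, 0) = u₀(ρ)`.

It is `C^∞` up to the boundary and solves the equation there, except at the corner `(0, 0)`,
where the initial and the boundary values need not satisfy the first-order compatibility
condition `u₀''(0) + g(0) u₀'(0) = 0`. At the corner, `u` and `∂_ρ u` are still continuous. -/
structure IsSmoothSolution (T : ℝ) (g u₀ : ℝ → ℝ) (u : ℝ → ℝ → ℝ) : Prop where
  continuousOn : ContinuousOn (fun p : ℝ × ℝ => u p.1 p.2) (region T)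
  continuousOn_dSpace : ContinuousOn (fun p : ℝ × ℝ => dSpace u p.1 p.2) (region T)
  smooth : ContDiffOn ℝ ∞ (fun p : ℝ × ℝ => u p.1 p.2) (regionOffCorner T)
  equation : ∀ ρ t : ℝ, (ρ, t) ∈ regionOffCorner T →
    dSpace (dSpace u) ρ t + g t * dSpace u ρ t - dTime u ρ t = 0
  boundary : ∀ t ∈ Ico 0 T, u 0 t = 0
  initial : ∀ ρ ∈ Ici (0 : ℝ), u ρ 0 = u₀ ρ

end HalfLine

end

/-!
The drift is removed by the moving coordinate `x = ρ + s(t)`, where `s(t) = ∫₀ᵗ g` is `shift`: it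
turns the equation into the heat equation and the boundary `ρ = 0` into the curve `x = s(t)`. The
function `ρ + s(t)` solves the equation with the right initial value but has the boundary value
`s(t)`. The solution is `ρ + s(t)` plus the double layer potential of a density `φ` on the moving
boundary, chosen to cancel this boundary value.

*The density.* By the jump relation `doubleLayer_boundary`, the boundary condition is an
Abel-Volterra equation of the second kind for `φ`. In the variable `z = √t` its coefficients are
holomorphic in the disc `|z| < √T`, and Picard iteration (`exists_volterra_solution`) converges
locally uniformly there. Hence `φ t = t * X (√t)` with `X` smooth (`exists_density`).

*Regularity.* After one integration by parts along the boundary (`layer_dt`), the derivatives of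
single and double layer potentials are again such potentials, and these are continuous up to the
boundary. For densities that vanish near `t = 0` this can be iterated (`contDiffOn_layers_nat`);
the remaining part of `φ` has its sources strictly in the past and produces a smooth potential
near the boundary point in question. For `ρ > 0` the potential is smooth across `t = 0`, because
the kernels are flat there. Once integrated by parts, the potential of `φ` also has a space
derivative that is continuous up to the corner.

*Estimates.* All of them come from the maximum principle (`nonneg_of_supersolution_box` on boxes
and `nonneg_of_supersolution_strip` on strips). Comparison with `ρ` gives `u ≥ ρ`, hence the lower
bounds. Comparison with a self-similar supersolution `(T - t) ^ β * f (ρ / √(T - t))`, where `f y`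
is comparable to `y ^ (2 * β)` for large `y`, gives the bound by `ρ ^ (2 * β)` near the boundary,
uniformly up to the singular time `T`. For the slope, `u` is monotone in `ρ` and `u - ρ u_ρ` is a
supersolution for the drift `g - 2 / ρ`, so that `0 ≤ u_ρ ≤ u / ρ`.
-/

open Filter Topology MeasureTheory

noncomputable section

namespace HalfLine

/-! ### Weak maximum principles -/

theorem secondDeriv_nonneg_of_isLocalMin {f f' : ℝ → ℝ} {x c : ℝ} (hmin : IsLocalMin f x)
    (hf : ∀ᶠ y in 𝓝 x, HasDerivAt f (f' y) y) (hf' : HasDerivAt f' c x) : 0 ≤ c := by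
  by_contra! hc
  have hd : deriv f =ᶠ[𝓝 x] f' := hf.mono fun y hy => hy.deriv
  have h2 : deriv (deriv f) x = c := by rw [hd.deriv_eq, hf'.deriv]
  have hmax : IsLocalMax f x :=
    isLocalMax_of_deriv_deriv_neg (by rw [h2]; exact hc) hmin.deriv_eq_zero
      hf.self_of_nhds.continuousAt
  -- a point that is both a local minimum and a local maximum is a point of local constancy
  have hconst : f =ᶠ[𝓝 x] fun _ => f x := by
    filter_upwards [hmin, hmax] with y h1 h2 using le_antisymm h2 h1
  have h0 : deriv f =ᶠ[𝓝 x] fun _ => 0 := by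
    filter_upwards [hconst.eventuallyEq_nhds] with y hy
    rw [hy.deriv_eq]; simp
  have : deriv (deriv f) x = 0 := by rw [h0.deriv_eq]; simp
  linarith

/-- One-sided version of Fermat's rule, needed because the minimum over a space-time box may lie on
the final time `t = S`. -/
theorem deriv_nonpos_of_le_left {f : ℝ → ℝ} {c t a : ℝ} (ha : a < t) (hf : HasDerivAt f c t)
    (hle : ∀ s ∈ Icc a t, f t ≤ f s) : c ≤ 0 := by
  have h := hasDerivWithinAt_iff_tendsto_slope' (s := Iio t) (by simp) |>.1 hf.hasDerivWithinAt
  refine le_of_tendsto h ?_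
  filter_upwards [Ioo_mem_nhdsLT ha] with s hs
  rw [slope_def_field]
  exact div_nonpos_of_nonneg_of_nonpos (by linarith [hle s ⟨hs.1.le, hs.2.le⟩])
    (by linarith [hs.2])

/-- Weak maximum principle on a bounded space-time box. The drift `b` is arbitrary, since only
points with vanishing space derivative matter. -/
theorem nonneg_of_supersolution_box {R S : ℝ} {w p q d b : ℝ → ℝ → ℝ}
    (hc : ContinuousOn (fun z : ℝ × ℝ => w z.1 z.2) (Icc 0 R ×ˢ Icc 0 S))
    (hleft : ∀ t ∈ Icc 0 S, 0 ≤ w 0 t) (hright : ∀ t ∈ Icc 0 S, 0 ≤ w R t)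
    (hinit : ∀ ρ ∈ Icc 0 R, 0 ≤ w ρ 0)
    (hp : ∀ ρ ∈ Ioo 0 R, ∀ t ∈ Ioc 0 S, HasDerivAt (fun r => w r t) (p ρ t) ρ)
    (hq : ∀ ρ ∈ Ioo 0 R, ∀ t ∈ Ioc 0 S, HasDerivAt (fun r => p r t) (q ρ t) ρ)
    (hd : ∀ ρ ∈ Ioo 0 R, ∀ t ∈ Ioc 0 S, HasDerivAt (fun s => w ρ s) (d ρ t) t)
    (hle : ∀ ρ ∈ Ioo 0 R, ∀ t ∈ Ioc 0 S, q ρ t + b ρ t * p ρ t ≤ d ρ t) :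
    ∀ ρ ∈ Icc 0 R, ∀ t ∈ Icc 0 S, 0 ≤ w ρ t := by
  intro ρ₁ hρ₁ t₁ ht₁
  by_contra! hneg
  have hS : 0 ≤ S := ht₁.1.trans ht₁.2
  -- adding `ε t` makes the differential inequality strict and keeps a negative value
  set ε : ℝ := -w ρ₁ t₁ / (2 * (S + 1)) with hε
  have hε0 : 0 < ε := div_pos (by linarith) (by linarith)
  have hv1 : w ρ₁ t₁ + ε * t₁ < 0 := by
    have h1 : ε * (2 * (S + 1)) = -w ρ₁ t₁ := by rw [hε]; field_simp
    nlinarith [mul_le_mul_of_nonneg_left ht₁.2 hε0.le]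
  have hvc : ContinuousOn (fun z : ℝ × ℝ => w z.1 z.2 + ε * z.2) (Icc 0 R ×ˢ Icc 0 S) :=
    hc.add (by fun_prop)
  obtain ⟨⟨ρ, t⟩, ⟨hρ, ht⟩, hmin⟩ :=
    (isCompact_Icc.prod isCompact_Icc).exists_isMinOn ⟨(ρ₁, t₁), hρ₁, ht₁⟩ hvc
  simp only at hρ ht
  have hmin' : ∀ r ∈ Icc 0 R, ∀ s ∈ Icc 0 S, w ρ t + ε * t ≤ w r s + ε * s :=
    fun r hr s hs => hmin (show (r, s) ∈ Icc 0 R ×ˢ Icc 0 S from ⟨hr, hs⟩)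
  have hv : w ρ t + ε * t < 0 := (hmin' _ hρ₁ _ ht₁).trans_lt hv1
  have hεt : 0 ≤ ε * t := mul_nonneg hε0.le ht.1
  have ht0 : 0 < t := by
    rcases ht.1.eq_or_lt with h | h
    · subst h; linarith [hinit ρ hρ]
    · exact h
  have hρ0 : 0 < ρ := by
    rcases hρ.1.eq_or_lt with h | h
    · subst h; linarith [hleft t ht]
    · exact h
  have hρR : ρ < R := by
    rcases hρ.2.eq_or_lt with h | h
    · subst h; linarith [hright t ht]
    · exact h
  have hρ' : ρ ∈ Ioo 0 R := ⟨hρ0, hρR⟩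
  have ht' : t ∈ Ioc 0 S := ⟨ht0, ht.2⟩
  have hloc : IsLocalMin (fun r => w r t) ρ := by
    filter_upwards [Ioo_mem_nhds hρ0 hρR] with r hr
    have := hmin' r ⟨hr.1.le, hr.2.le⟩ t ht
    linarith
  have hp0 : p ρ t = 0 := hloc.hasDerivAt_eq_zero (hp ρ hρ' t ht')
  have hq0 : 0 ≤ q ρ t := secondDeriv_nonneg_of_isLocalMin hloc
    (by filter_upwards [Ioo_mem_nhds hρ0 hρR] with r hr using hp r hr t ht') (hq ρ hρ' t ht')
  have hd0 : d ρ t + ε * 1 ≤ 0 := by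
    refine deriv_nonpos_of_le_left ht0 ((hd ρ hρ' t ht').add ((hasDerivAt_id t).const_mul ε)) ?_
    intro s hs
    exact hmin' ρ hρ s ⟨hs.1, hs.2.trans ht.2⟩
  have := hle ρ hρ' t ht'
  rw [hp0] at this
  linarith

/-- Weak maximum principle on a strip `[0, ∞) × [0, S]` for supersolutions bounded below by a
function of linear growth; the drift is bounded above but may be very negative. -/
theorem nonneg_of_supersolution_strip {S M C : ℝ} {w p q d b : ℝ → ℝ → ℝ}
    (hc : ContinuousOn (fun z : ℝ × ℝ => w z.1 z.2) (Ici 0 ×ˢ Icc 0 S))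
    (hleft : ∀ t ∈ Icc 0 S, 0 ≤ w 0 t)
    (hinit : ∀ ρ ∈ Ici (0 : ℝ), 0 ≤ w ρ 0)
    (hgrow : ∀ ρ ∈ Ici (0 : ℝ), ∀ t ∈ Icc 0 S, -(C * (1 + ρ)) ≤ w ρ t)
    (hp : ∀ ρ ∈ Ioi (0 : ℝ), ∀ t ∈ Ioc 0 S, HasDerivAt (fun r => w r t) (p ρ t) ρ)
    (hq : ∀ ρ ∈ Ioi (0 : ℝ), ∀ t ∈ Ioc 0 S, HasDerivAt (fun r => p r t) (q ρ t) ρ)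
    (hd : ∀ ρ ∈ Ioi (0 : ℝ), ∀ t ∈ Ioc 0 S, HasDerivAt (fun s => w ρ s) (d ρ t) t)
    (hb : ∀ ρ ∈ Ioi (0 : ℝ), ∀ t ∈ Ioc 0 S, b ρ t ≤ M)
    (hle : ∀ ρ ∈ Ioi (0 : ℝ), ∀ t ∈ Ioc 0 S, q ρ t + b ρ t * p ρ t ≤ d ρ t) :
    ∀ ρ ∈ Ici (0 : ℝ), ∀ t ∈ Icc 0 S, 0 ≤ w ρ t := by
  intro ρ₁ hρ₁ t₁ ht₁
  wlog hC : 0 ≤ C generalizing C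
  · exact this (C := |C|) (fun ρ hρ t ht => (neg_le_neg (mul_le_mul_of_nonneg_right (le_abs_self C)
      (by linarith [mem_Ici.1 hρ]))).trans (hgrow ρ hρ t ht)) (abs_nonneg C)
  wlog hM : 0 ≤ M generalizing M
  · exact this (M := |M|) (fun ρ hρ t ht => (hb ρ hρ t ht).trans (le_abs_self M)) (abs_nonneg M)
  -- the penalty `ε e^{lt} (ρ² + 1)` is a supersolution and beats linear growth
  set l : ℝ := 2 + M with hl
  have key : ∀ ε > 0, 0 ≤ w ρ₁ t₁ + ε * (Real.exp (l * t₁) * (ρ₁ ^ 2 + 1)) := by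
    intro ε hε
    obtain ⟨R, hR1, hR⟩ : ∃ R, ρ₁ ≤ R ∧ C * (1 + R) ≤ ε * (R ^ 2 + 1) := by
      refine ⟨max ρ₁ (1 + 2 * C / ε), le_max_left _ _, ?_⟩
      set R := max ρ₁ (1 + 2 * C / ε)
      have h1 : 1 + 2 * C / ε ≤ R := le_max_right _ _
      have h2 : 0 ≤ 2 * C / ε := by positivity
      have h3 : 2 * C / ε ≤ R := by linarith
      have h4 : 2 * C ≤ ε * R := by rwa [div_le_iff₀' hε] at h3
      nlinarith [mul_le_mul_of_nonneg_right h4 (by linarith : 0 ≤ R)]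
    have hsub : Icc 0 R ×ˢ Icc 0 S ⊆ Ici (0 : ℝ) ×ˢ Icc 0 S :=
      prod_mono (fun x hx => hx.1) subset_rfl
    have hexp : ∀ t ∈ Icc 0 S, 1 ≤ Real.exp (l * t) := fun t ht =>
      Real.one_le_exp (mul_nonneg (by linarith) ht.1)
    refine nonneg_of_supersolution_box (R := R) (S := S) (b := b)
      (w := fun ρ t => w ρ t + ε * (Real.exp (l * t) * (ρ ^ 2 + 1)))
      (p := fun ρ t => p ρ t + ε * (Real.exp (l * t) * (2 * ρ)))
      (q := fun ρ t => q ρ t + ε * (Real.exp (l * t) * 2))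
      (d := fun ρ t => d ρ t + ε * (Real.exp (l * t) * l * (ρ ^ 2 + 1)))
      ((hc.mono hsub).add (by fun_prop)) ?_ ?_ ?_ ?_ ?_ ?_ ?_ ρ₁ ⟨hρ₁, hR1⟩ t₁ ht₁
    · intro t ht
      have := hleft t ht
      positivity
    · intro t ht
      have h1 := hgrow R (le_trans (mem_Ici.1 hρ₁) hR1) t ht
      have h2 := mul_le_mul_of_nonneg_left (mul_le_mul_of_nonneg_right (hexp t ht)
        (by positivity : 0 ≤ R ^ 2 + 1)) hε.le
      linarith
    · intro ρ hρ
      have := hinit ρ hρ.1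
      positivity
    · intro ρ hρ t ht
      refine (hp ρ hρ.1 t ht).add (((HasDerivAt.const_mul _ ?_)).const_mul _)
      simpa using ((hasDerivAt_id ρ).pow 2).add_const 1
    · intro ρ hρ t ht
      refine (hq ρ hρ.1 t ht).add (((HasDerivAt.const_mul _ ?_)).const_mul _)
      simpa using (hasDerivAt_id ρ).const_mul 2
    · intro ρ hρ t ht
      refine (hd ρ hρ.1 t ht).add (((HasDerivAt.mul_const ?_ _)).const_mul _)
      simpa using ((hasDerivAt_id t).const_mul l).exp
    · intro ρ hρ t ht
      have h1 := hle ρ hρ.1 t ht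
      have hE := Real.exp_pos (l * t)
      have h2 : 2 + b ρ t * (2 * ρ) ≤ l * (ρ ^ 2 + 1) := by
        have h3 := mul_le_mul_of_nonneg_right (hb ρ hρ.1 t ht) (by linarith [hρ.1] : 0 ≤ 2 * ρ)
        nlinarith [mul_nonneg hM (sq_nonneg (ρ - 1)), sq_nonneg ρ]
      have h4 := mul_le_mul_of_nonneg_left h2 (mul_pos hε hE).le
      nlinarith
  refine le_of_forall_pos_lt_add fun δ hδ => ?_
  have hpos : 0 < Real.exp (l * t₁) * (ρ₁ ^ 2 + 1) := by positivity
  have := key (δ / 2 / (Real.exp (l * t₁) * (ρ₁ ^ 2 + 1))) (by positivity)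
  rw [div_mul_cancel₀ _ hpos.ne'] at this
  linarith

/-! ### A self-similar barrier -/

/-- Profile of the self-similar barrier `(T - t) ^ β * f (ρ / √(T - t))`. -/
def profile (K β y : ℝ) : ℝ :=
  ((y - 2 * K) ^ 2 + 1) ^ β - (4 * K ^ 2 + 1) ^ β * Real.exp (-((K + 1) * y))

/-- The first derivative of `profile`, see `hasDerivAt_profile`. -/
def profileDeriv (K β y : ℝ) : ℝ :=
  2 * β * (y - 2 * K) * ((y - 2 * K) ^ 2 + 1) ^ (β - 1) +
    (4 * K ^ 2 + 1) ^ β * (K + 1) * Real.exp (-((K + 1) * y))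

/-- The second derivative of `profile`, see `hasDerivAt_profileDeriv`. -/
def profileDeriv₂ (K β y : ℝ) : ℝ :=
  2 * β * ((y - 2 * K) ^ 2 + 1) ^ (β - 1) +
    4 * β * (β - 1) * (y - 2 * K) ^ 2 * ((y - 2 * K) ^ 2 + 1) ^ (β - 2) -
    (4 * K ^ 2 + 1) ^ β * (K + 1) ^ 2 * Real.exp (-((K + 1) * y))

theorem hasDerivAt_sq_add_one_rpow (K γ y : ℝ) :
    HasDerivAt (fun y : ℝ => ((y - 2 * K) ^ 2 + 1) ^ γ)
      (2 * γ * (y - 2 * K) * ((y - 2 * K) ^ 2 + 1) ^ (γ - 1)) y := by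
  have h : HasDerivAt (fun y : ℝ => (y - 2 * K) ^ 2 + 1) (2 * (y - 2 * K)) y := by
    simpa using (((hasDerivAt_id y).sub_const (2 * K)).pow 2).add_const 1
  refine (h.rpow_const (p := γ) (Or.inl (by positivity))).congr_deriv ?_
  ring

theorem hasDerivAt_exp_neg_mul (μ y : ℝ) :
    HasDerivAt (fun y : ℝ => Real.exp (-(μ * y))) (-μ * Real.exp (-(μ * y))) y := by
  refine ((hasDerivAt_id y).const_mul μ).neg.exp.congr_deriv ?_
  simp only [id, mul_one, Pi.neg_apply]
  ring

theorem hasDerivAt_profile (K β y : ℝ) :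
    HasDerivAt (profile K β) (profileDeriv K β y) y := by
  refine ((hasDerivAt_sq_add_one_rpow K β y).sub
    ((hasDerivAt_exp_neg_mul (K + 1) y).const_mul ((4 * K ^ 2 + 1) ^ β))).congr_deriv ?_
  simp only [profileDeriv]; ring

theorem hasDerivAt_profileDeriv (K β y : ℝ) :
    HasDerivAt (profileDeriv K β) (profileDeriv₂ K β y) y := by
  have h1 : HasDerivAt (fun y : ℝ => 2 * β * (y - 2 * K)) (2 * β) y := by
    simpa using ((hasDerivAt_id y).sub_const (2 * K)).const_mul (2 * β)
  refine ((h1.mul (hasDerivAt_sq_add_one_rpow K (β - 1) y)).add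
    ((hasDerivAt_exp_neg_mul (K + 1) y).const_mul
      ((4 * K ^ 2 + 1) ^ β * (K + 1)))).congr_deriv ?_
  simp only [profileDeriv₂]
  rw [show β - 1 - 1 = β - 2 by ring]
  ring

theorem profile_zero (K β : ℝ) : profile K β 0 = 0 := by
  simp [profile, mul_pow]; norm_num

/-- For a small exponent `β` the self-similar barrier is a supersolution: the exponential term
compensates the region `|y - 2K| ≤ 2` where `((y - 2K)² + 1) ^ β` alone fails. -/
theorem profile_supersolution {K β y : ℝ} (hK : 0 < K) (hβ : 0 < β) (hβ' : β ≤ 1 / 16)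
    (hβK : 3 * β ≤ Real.exp (-((K + 1) * (2 * K + 2)))) (hy : 0 ≤ y) :
    profileDeriv₂ K β y + (K - y / 2) * profileDeriv K β y + β * profile K β y ≤ 0 := by
  set z := y - 2 * K with hz
  set N := z ^ 2 + 1 with hN
  have hN1 : 1 ≤ N := by rw [hN]; nlinarith [sq_nonneg z]
  have hN0 : 0 < N := by linarith
  have e1 : N ^ (β - 1) = N * N ^ (β - 2) := by
    rw [show β - 1 = 1 + (β - 2) by ring, Real.rpow_add hN0, Real.rpow_one]
  have e0 : N ^ β = N ^ 2 * N ^ (β - 2) := by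
    rw [show N ^ 2 = N ^ (2 : ℝ) by norm_cast, ← Real.rpow_add hN0]; ring_nf
  set n := N ^ (β - 2) with hn
  have hn0 : 0 < n := Real.rpow_pos_of_pos hN0 _
  have hn1 : n ≤ 1 := Real.rpow_le_one_of_one_le_of_nonpos hN1 (by linarith)
  set A : ℝ := (4 * K ^ 2 + 1) ^ β with hA
  have hA1 : 1 ≤ A := Real.one_le_rpow (by nlinarith [sq_nonneg K]) hβ.le
  set E := Real.exp (-((K + 1) * y)) with hE
  have hE0 : 0 < E := Real.exp_pos _
  -- `K - y / 2 = -z / 2`, so the terms of order `N ^ β` cancel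
  have key : profileDeriv₂ K β y + (K - y / 2) * profileDeriv K β y + β * profile K β y
      = β * n * (3 - (1 - 4 * β) * z ^ 2) - A * E * ((K + 1) * (1 + y / 2) + β) := by
    simp only [profile, profileDeriv, profileDeriv₂, ← hz, ← hN, ← hA, ← hE, e1, e0, ← hn]
    rw [show y = z + 2 * K by rw [hz]; ring, hN]
    ring
  rw [key]
  have hAE : 0 < A * E := by positivity
  have h2 : E ≤ A * E := by nlinarith
  have h3 : A * E * 1 ≤ A * E * ((K + 1) * (1 + y / 2) + β) :=
    mul_le_mul_of_nonneg_left (by nlinarith [mul_nonneg hK.le hy]) hAE.le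
  have h4 : 0 < β * n := by positivity
  rcases le_total (2 * K + 2) y with h | h
  · have hz2 : 4 ≤ z ^ 2 := by nlinarith
    have h5 : 3 - (1 - 4 * β) * z ^ 2 ≤ 0 := by nlinarith
    linarith [mul_nonneg h4.le (neg_nonneg.2 h5)]
  · have h5 : Real.exp (-((K + 1) * (2 * K + 2))) ≤ E := by
      apply Real.exp_le_exp.2
      have := mul_le_mul_of_nonneg_left h (by linarith : 0 ≤ K + 1)
      linarith
    have h6 : β * n * (3 - (1 - 4 * β) * z ^ 2) ≤ β * n * 3 :=
      mul_le_mul_of_nonneg_left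
        (by linarith [mul_nonneg (by linarith : 0 ≤ 1 - 4 * β) (sq_nonneg z)]) h4.le
    have h7 : β * n ≤ β := mul_le_of_le_one_right hβ.le hn1
    linarith

/-- Linear lower bound near `y = 0`; at time `0` it lets a multiple of the barrier dominate the
initial value `ρ` for `ρ ≤ √T`. -/
theorem quarter_le_profile {K β y : ℝ} (hK : 0 < K) (hβ : 0 < β) (hβK : 16 * K * β ≤ 1)
    (hy : 0 ≤ y) (hy1 : y ≤ 1) : y / 4 ≤ profile K β y := by
  set a : ℝ := 4 * K ^ 2 + 1 with ha
  set N := (y - 2 * K) ^ 2 + 1 with hN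
  have ha1 : 1 ≤ a := by rw [ha]; nlinarith [sq_nonneg K]
  have hN1 : 1 ≤ N := by rw [hN]; nlinarith [sq_nonneg (y - 2 * K)]
  have hNa : a - 4 * K * y ≤ N := by rw [hN, ha]; nlinarith [sq_nonneg y]
  have hA1 : 1 ≤ a ^ β := Real.one_le_rpow ha1 hβ.le
  have hv : 0 < N / a := by positivity
  have h1 : 1 - 4 * K * β * y ≤ (N / a) ^ β := by
    have h2 : 1 - (N / a)⁻¹ ≤ Real.log (N / a) := Real.one_sub_inv_le_log_of_pos hv
    have h3 : -(4 * K * y) ≤ 1 - (N / a)⁻¹ := by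
      rw [inv_div]
      have : a / N ≤ 1 + 4 * K * y := by
        rw [div_le_iff₀ (by linarith)]
        nlinarith [mul_nonneg (mul_nonneg (by linarith : 0 ≤ 4 * K) hy) (by linarith : 0 ≤ N - 1)]
      linarith
    have h4 : Real.log (N / a) * β + 1 ≤ (N / a) ^ β := by
      rw [Real.rpow_def_of_pos hv]; exact Real.add_one_le_exp _
    nlinarith [mul_le_mul_of_nonneg_right (h3.trans h2) hβ.le]
  have h5 : N ^ β = a ^ β * (N / a) ^ β := by
    rw [← Real.mul_rpow (by linarith) hv.le]; congr 1; field_simp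
  have h6 : Real.exp (-((K + 1) * y)) ≤ 1 - y / 2 := by
    have h7 : Real.exp (-((K + 1) * y)) ≤ Real.exp (-y) :=
      Real.exp_le_exp.2 (by nlinarith [mul_nonneg hK.le hy])
    have h8 : Real.exp (-y) * (1 + y) ≤ 1 := by
      calc Real.exp (-y) * (1 + y) ≤ Real.exp (-y) * Real.exp y :=
            mul_le_mul_of_nonneg_left (by linarith [Real.add_one_le_exp y]) (Real.exp_pos _).le
        _ = 1 := by rw [← Real.exp_add]; simp
    have h9 : 1 ≤ (1 - y / 2) * (1 + y) := by nlinarith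
    have h10 := h8.trans h9
    exact h7.trans (le_of_mul_le_mul_right h10 (by linarith))
  have h11 : y / 4 ≤ (N / a) ^ β - Real.exp (-((K + 1) * y)) := by
    nlinarith [mul_le_mul_of_nonneg_right hβK hy]
  calc y / 4 ≤ 1 * ((N / a) ^ β - Real.exp (-((K + 1) * y))) := by linarith
    _ ≤ a ^ β * ((N / a) ^ β - Real.exp (-((K + 1) * y))) :=
        mul_le_mul_of_nonneg_right hA1 (by linarith)
    _ = profile K β y := by simp only [profile, ← hN, ← ha, h5]; ring

/-- Lower bound away from `y = 0`; it lets a multiple of the barrier dominate the solution on the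
line `ρ = √T`, where `ρ / √(T - t) ≥ 1` at all times. -/
theorem exists_rpow_le_profile {K β : ℝ} (hβ : 0 < β) (hK : 0 < K)
    (hβK : 8 * K ^ 2 * β ≤ 1) :
    ∃ c > 0, ∀ y, 1 ≤ y → c * y ^ (2 * β) ≤ profile K β y := by
  set a : ℝ := 4 * K ^ 2 + 1 with ha
  have ha0 : 0 < a := by positivity
  have hθ : Real.exp (-(1 / 2)) < 1 := Real.exp_lt_one_iff.2 (by norm_num)
  refine ⟨(1 / a) ^ β * (1 - Real.exp (-(1 / 2))),
    mul_pos (by positivity) (by linarith), fun y hy => ?_⟩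
  set N := (y - 2 * K) ^ 2 + 1 with hN
  have hN1 : 1 ≤ N := by rw [hN]; nlinarith [sq_nonneg (y - 2 * K)]
  have hNy : 1 / a * y ^ 2 ≤ N := by
    -- `(4K² + 1) ((y - 2K)² + 1) - y² = (2K (y - 2K) - 1)²`
    rw [div_mul_eq_mul_div, one_mul, div_le_iff₀ ha0, hN, ha]
    nlinarith [sq_nonneg (2 * K * (y - 2 * K) - 1)]
  have h1 : (1 / a) ^ β * y ^ (2 * β) ≤ N ^ β := by
    rw [Real.rpow_mul (by linarith), ← Real.mul_rpow (by positivity) (by positivity)]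
    exact Real.rpow_le_rpow (by positivity) (by exact_mod_cast hNy) hβ.le
  have h2 : a ^ β * Real.exp (-((K + 1) * y)) ≤ Real.exp (-(1 / 2)) := by
    have h3 : a ^ β ≤ Real.exp (4 * K ^ 2 * β) := by
      rw [Real.exp_mul]
      exact Real.rpow_le_rpow ha0.le (Real.add_one_le_exp _) hβ.le
    calc a ^ β * Real.exp (-((K + 1) * y))
        ≤ Real.exp (4 * K ^ 2 * β) * Real.exp (-((K + 1) * y)) :=
          mul_le_mul_of_nonneg_right h3 (Real.exp_pos _).le
      _ ≤ Real.exp (-(1 / 2)) := by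
          rw [← Real.exp_add]
          apply Real.exp_le_exp.2
          nlinarith [mul_nonneg hK.le (by linarith : 0 ≤ y)]
  have hNβ : 1 ≤ N ^ β := Real.one_le_rpow hN1 hβ.le
  calc (1 / a) ^ β * (1 - Real.exp (-(1 / 2))) * y ^ (2 * β)
      = (1 / a) ^ β * y ^ (2 * β) * (1 - Real.exp (-(1 / 2))) := by ring
    _ ≤ N ^ β * (1 - Real.exp (-(1 / 2))) := mul_le_mul_of_nonneg_right h1 (by linarith)
    _ ≤ N ^ β - a ^ β * Real.exp (-((K + 1) * y)) := by
        nlinarith [mul_le_mul_of_nonneg_right hNβ (Real.exp_pos (-(1 / 2))).le]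

/-- Upper bound; after rescaling it bounds the barrier by a multiple of `ρ ^ (2 * β)`, uniformly in
time. -/
theorem exists_profile_le_rpow {K β : ℝ} (hβ : 0 < β) (hβ1 : 2 * β ≤ 1) (hK : 0 < K) :
    ∃ C > 0, ∀ y, 0 ≤ y → profile K β y ≤ C * y ^ (2 * β) := by
  set a : ℝ := 4 * K ^ 2 + 1 with ha
  have ha0 : 0 < a := by positivity
  refine ⟨a ^ β * (K + 2) + (1 + a) ^ β, by positivity, fun y hy => ?_⟩
  have hy0 : 0 ≤ y ^ (2 * β) := Real.rpow_nonneg hy _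
  set N := (y - 2 * K) ^ 2 + 1 with hN
  have hN1 : 1 ≤ N := by rw [hN]; nlinarith [sq_nonneg (y - 2 * K)]
  have hE := Real.exp_pos (-((K + 1) * y))
  have hA : 0 < a ^ β := by positivity
  rcases le_total y 1 with h | h
  · have h1 : N / a ≤ 1 + y := by
      rw [div_le_iff₀ ha0, hN, ha]
      nlinarith [mul_nonneg hK.le hy, mul_nonneg (mul_nonneg hK.le hK.le) hy]
    have h2 : (N / a) ^ β ≤ 1 + y := by
      calc (N / a) ^ β ≤ (1 + y) ^ β := Real.rpow_le_rpow (by positivity) h1 hβ.le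
        _ ≤ (1 + y) ^ (1 : ℝ) := Real.rpow_le_rpow_of_exponent_le (by linarith) (by linarith)
        _ = 1 + y := Real.rpow_one _
    have h5 : N ^ β = a ^ β * (N / a) ^ β := by
      rw [← Real.mul_rpow (by linarith) (by positivity)]; congr 1; field_simp
    have h6 : 1 - (K + 1) * y ≤ Real.exp (-((K + 1) * y)) := by
      linarith [Real.add_one_le_exp (-((K + 1) * y))]
    have h7 : y ≤ y ^ (2 * β) := by
      rcases hy.eq_or_lt with h0 | h0
      · rw [← h0]; exact Real.rpow_nonneg le_rfl _
      · conv_lhs => rw [← Real.rpow_one y]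
        exact Real.rpow_le_rpow_of_exponent_ge h0 h hβ1
    calc profile K β y = a ^ β * ((N / a) ^ β - Real.exp (-((K + 1) * y))) := by
          simp only [profile, ← hN, ← ha, h5]; ring
      _ ≤ a ^ β * ((K + 2) * y) := mul_le_mul_of_nonneg_left (by linarith) hA.le
      _ ≤ a ^ β * ((K + 2) * y ^ (2 * β)) := by gcongr
      _ ≤ _ := by nlinarith [mul_nonneg (by positivity : 0 ≤ (1 + a) ^ β) hy0]
  · have h1 : N ≤ (1 + a) * y ^ 2 := by
      rw [hN, ha]
      nlinarith [mul_nonneg hK.le hy, mul_nonneg (mul_nonneg hK.le hK.le)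
        (by nlinarith : 0 ≤ y ^ 2 - 1)]
    have h2 : N ^ β ≤ (1 + a) ^ β * y ^ (2 * β) := by
      rw [Real.rpow_mul hy, ← Real.mul_rpow (by positivity) (by positivity)]
      exact Real.rpow_le_rpow (by linarith) (by exact_mod_cast h1) hβ.le
    calc profile K β y ≤ N ^ β := by
          simp only [profile, ← hN, ← ha]; nlinarith [mul_pos hA hE]
      _ ≤ _ := h2
      _ ≤ _ := by nlinarith [mul_nonneg (by positivity : 0 ≤ a ^ β * (K + 2)) hy0]

/-- The barrier `(T - t) ^ β * f (ρ / √(T - t))`. -/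
def barrier (K T β ρ t : ℝ) : ℝ := (T - t) ^ β * profile K β (ρ / Real.sqrt (T - t))

theorem hasDerivAt_barrier_space {K T β ρ t : ℝ} :
    HasDerivAt (fun r => barrier K T β r t)
      ((T - t) ^ β * (profileDeriv K β (ρ / Real.sqrt (T - t)) / Real.sqrt (T - t))) ρ := by
  have h : HasDerivAt (fun r : ℝ => r / Real.sqrt (T - t)) (1 / Real.sqrt (T - t)) ρ :=
    (hasDerivAt_id ρ).div_const _
  refine (((hasDerivAt_profile K β _).comp ρ h).const_mul ((T - t) ^ β)).congr_deriv ?_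
  ring

theorem hasDerivAt_barrier_space₂ {K T β ρ t : ℝ} (ht : t < T) :
    HasDerivAt (fun r => (T - t) ^ β *
        (profileDeriv K β (r / Real.sqrt (T - t)) / Real.sqrt (T - t)))
      ((T - t) ^ β * (profileDeriv₂ K β (ρ / Real.sqrt (T - t)) / (T - t))) ρ := by
  have h : HasDerivAt (fun r : ℝ => r / Real.sqrt (T - t)) (1 / Real.sqrt (T - t)) ρ :=
    (hasDerivAt_id ρ).div_const _
  have hs : 0 < Real.sqrt (T - t) := Real.sqrt_pos.2 (by linarith)
  have hss : Real.sqrt (T - t) * Real.sqrt (T - t) = T - t := Real.mul_self_sqrt (by linarith)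
  refine ((((hasDerivAt_profileDeriv K β _).comp ρ h).div_const
    (Real.sqrt (T - t))).const_mul ((T - t) ^ β)).congr_deriv ?_
  rw [mul_one_div, div_div, hss]

theorem hasDerivAt_barrier_time {K T β ρ t : ℝ} (ht : t < T) :
    HasDerivAt (fun s => barrier K T β ρ s)
      ((T - t) ^ β * ((ρ / Real.sqrt (T - t) / 2 * profileDeriv K β (ρ / Real.sqrt (T - t)) -
        β * profile K β (ρ / Real.sqrt (T - t))) / (T - t))) t := by
  have hτ : 0 < T - t := by linarith
  have hs : 0 < Real.sqrt (T - t) := Real.sqrt_pos.2 hτ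
  have hss : Real.sqrt (T - t) * Real.sqrt (T - t) = T - t := Real.mul_self_sqrt hτ.le
  have h1 : HasDerivAt (fun s : ℝ => T - s) (-1) t := by
    simpa using (hasDerivAt_id t).const_sub T
  have h2 := h1.sqrt hτ.ne'
  have h3 := (hasDerivAt_const t ρ).div h2 hs.ne'
  have h4 := (hasDerivAt_profile K β (ρ / Real.sqrt (T - t))).comp t h3
  refine ((h1.rpow_const (p := β) (Or.inl hτ.ne')).mul h4).congr_deriv ?_
  rw [Real.rpow_sub_one hτ.ne']
  simp only [Function.comp_apply, Pi.div_apply]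
  rw [Real.sq_sqrt hτ.le]
  field_simp
  ring

/-- `b_ρρ + g b_ρ ≤ b_t` for the barrier `b`, written with the derivatives computed above. The
self-similar variable `ρ / √(T - t)` turns `g` into the constant `K`. -/
theorem barrier_supersolution {K T β ρ t : ℝ} (hK : 0 < K) (hβ : 0 < β) (hβ' : β ≤ 1 / 16)
    (hβK : 3 * β ≤ Real.exp (-((K + 1) * (2 * K + 2)))) (hρ : 0 ≤ ρ) (ht : t < T) :
    (T - t) ^ β * (profileDeriv₂ K β (ρ / Real.sqrt (T - t)) / (T - t)) +
      drift K T t * ((T - t) ^ β *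
        (profileDeriv K β (ρ / Real.sqrt (T - t)) / Real.sqrt (T - t))) ≤
      (T - t) ^ β * ((ρ / Real.sqrt (T - t) / 2 * profileDeriv K β (ρ / Real.sqrt (T - t)) -
        β * profile K β (ρ / Real.sqrt (T - t))) / (T - t)) := by
  have hτ : 0 < T - t := by linarith
  have hs : 0 < Real.sqrt (T - t) := Real.sqrt_pos.2 hτ
  have hss : Real.sqrt (T - t) * Real.sqrt (T - t) = T - t := Real.mul_self_sqrt hτ.le
  have h := profile_supersolution hK hβ hβ' hβK (div_nonneg hρ hs.le)
  have h' := mul_le_mul_of_nonneg_left h (div_nonneg (Real.rpow_nonneg hτ.le β) hτ.le)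
  have e : drift K T t * ((T - t) ^ β *
        (profileDeriv K β (ρ / Real.sqrt (T - t)) / Real.sqrt (T - t)))
      = (T - t) ^ β / (T - t) * (K * profileDeriv K β (ρ / Real.sqrt (T - t))) := by
    rw [drift]
    set P := profileDeriv K β (ρ / Real.sqrt (T - t))
    calc K / √(T - t) * ((T - t) ^ β * (P / √(T - t)))
        = (T - t) ^ β / (√(T - t) * √(T - t)) * (K * P) := by field_simp
      _ = _ := by rw [hss]
  rw [e]
  have e2 : ∀ X : ℝ, (T - t) ^ β * (X / (T - t)) = (T - t) ^ β / (T - t) * X := fun X => by ring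
  rw [e2, e2]
  linarith

/-! ### A priori estimates for solutions with initial value `ρ` -/

section Estimates

/-- The accumulated drift `∫₀ᵗ K / √(T - s) ds = 2 K (√T - √(T - t))`. -/
def shift (K T t : ℝ) : ℝ := 2 * K * (Real.sqrt T - Real.sqrt (T - t))

theorem shift_zero (K T : ℝ) : shift K T 0 = 0 := by simp [shift]

theorem hasDerivAt_shift {K T t : ℝ} (ht : t < T) : HasDerivAt (shift K T) (drift K T t) t := by
  have hτ : 0 < T - t := by linarith
  have h1 : HasDerivAt (fun s : ℝ => T - s) (-1) t := by
    simpa using (hasDerivAt_id t).const_sub T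
  refine (((h1.sqrt hτ.ne').const_sub (Real.sqrt T)).const_mul (2 * K)).congr_deriv ?_
  rw [drift]
  have hs : 0 < Real.sqrt (T - t) := Real.sqrt_pos.2 hτ
  field_simp

theorem continuous_shift (K T : ℝ) : Continuous (shift K T) := by
  unfold shift; fun_prop

theorem shift_nonneg {K T t : ℝ} (hK : 0 < K) (ht : 0 ≤ t) : 0 ≤ shift K T t :=
  mul_nonneg (by linarith) (sub_nonneg.2 (Real.sqrt_le_sqrt (by linarith)))

theorem shift_le {K T t : ℝ} (hK : 0 < K) : shift K T t ≤ 2 * K * Real.sqrt T :=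
  mul_le_mul_of_nonneg_left (by linarith [Real.sqrt_nonneg (T - t)]) (by linarith)

theorem drift_pos {K T t : ℝ} (hK : 0 < K) (ht : t < T) : 0 < drift K T t :=
  div_pos hK (Real.sqrt_pos.2 (by linarith))

theorem drift_mono {K T s t : ℝ} (hK : 0 < K) (hst : s ≤ t) (ht : t < T) :
    drift K T s ≤ drift K T t :=
  div_le_div_of_nonneg_left hK.le (Real.sqrt_pos.2 (by linarith))
    (Real.sqrt_le_sqrt (by linarith))

/-- A solution `u` of the problem with initial value `ρ`, together with its first three space
derivatives `p`, `q`, `r`, such that `p` is bounded on each strip `0 ≤ t ≤ S < T`. The equation is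
built into the time derivatives of `u` and `p`, which are two-sided and hence only required at
positive times. -/
structure IsLinearDataSolution (K T : ℝ) (u p q r : ℝ → ℝ → ℝ) : Prop where
  continuousOn : ContinuousOn (fun z : ℝ × ℝ => u z.1 z.2) (region T)
  continuousOn_p : ContinuousOn (fun z : ℝ × ℝ => p z.1 z.2) (region T)
  boundary : ∀ t ∈ Ico 0 T, u 0 t = 0
  initial : ∀ ρ ∈ Ici (0 : ℝ), u ρ 0 = ρ
  initial_p : ∀ ρ ∈ Ici (0 : ℝ), p ρ 0 = 1
  bounded_p : ∀ S ∈ Ico 0 T, ∃ M, ∀ ρ ∈ Ici (0 : ℝ), ∀ t ∈ Icc 0 S, |p ρ t| ≤ M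
  deriv_u : ∀ ρ ∈ Ioi (0 : ℝ), ∀ t ∈ Ico 0 T, HasDerivAt (fun x => u x t) (p ρ t) ρ
  deriv_p : ∀ ρ ∈ Ioi (0 : ℝ), ∀ t ∈ Ico 0 T, HasDerivAt (fun x => p x t) (q ρ t) ρ
  deriv_q : ∀ ρ ∈ Ioi (0 : ℝ), ∀ t ∈ Ico 0 T, HasDerivAt (fun x => q x t) (r ρ t) ρ
  time_u : ∀ ρ ∈ Ioi (0 : ℝ), ∀ t ∈ Ioo 0 T,
    HasDerivAt (fun s => u ρ s) (q ρ t + drift K T t * p ρ t) t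
  time_p : ∀ ρ ∈ Ioi (0 : ℝ), ∀ t ∈ Ioo 0 T,
    HasDerivAt (fun s => p ρ s) (r ρ t + drift K T t * q ρ t) t

namespace IsLinearDataSolution

variable {K T : ℝ} {u p q r : ℝ → ℝ → ℝ}

theorem strip_subset {S : ℝ} (hS : S < T) : Ici (0 : ℝ) ×ˢ Icc 0 S ⊆ region T :=
  prod_mono subset_rfl fun _ hx => ⟨hx.1, hx.2.trans_lt hS⟩

theorem continuousOn_slice (h : IsLinearDataSolution K T u p q r) {t : ℝ} (ht : t ∈ Ico 0 T) :
    ContinuousOn (fun x => u x t) (Ici 0) :=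
  h.continuousOn.comp (f := fun x : ℝ => (x, t)) (by fun_prop) fun _ hx => ⟨hx, ht⟩

/-- Linear growth, needed for the maximum principle on the unbounded strip. -/
theorem abs_apply_le (h : IsLinearDataSolution K T u p q r) {S M : ℝ} (hS : S < T)
    (hM : ∀ ρ ∈ Ici (0 : ℝ), ∀ t ∈ Icc 0 S, |p ρ t| ≤ M) :
    ∀ ρ ∈ Ici (0 : ℝ), ∀ t ∈ Icc 0 S, |u ρ t| ≤ M * ρ := by
  intro ρ hρ t ht
  have htT : t ∈ Ico 0 T := ⟨ht.1, ht.2.trans_lt hS⟩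
  rcases (mem_Ici.1 hρ).eq_or_lt with h0 | h0
  · rw [← h0, h.boundary t htT]; simp
  obtain ⟨x, hx, hxe⟩ := exists_hasDerivAt_eq_slope (fun x => u x t) (fun x => p x t) h0
    ((h.continuousOn_slice htT).mono fun y hy => hy.1) fun y hy => h.deriv_u y hy.1 t htT
  rw [h.boundary t htT, sub_zero, sub_zero, eq_div_iff h0.ne'] at hxe
  rw [← hxe, abs_mul, abs_of_pos h0]
  exact mul_le_mul_of_nonneg_right (hM x hx.1.le t ht) h0.le

/-- The function `ρ` is a subsolution, because the drift is nonnegative. -/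
theorem le_apply (h : IsLinearDataSolution K T u p q r) (hK : 0 < K) {ρ t : ℝ} (hρ : 0 ≤ ρ)
    (ht : t ∈ Ico 0 T) : ρ ≤ u ρ t := by
  obtain ⟨M, hM⟩ := h.bounded_p t ht
  have hsub : ∀ s ∈ Icc 0 t, s ∈ Ico 0 T := fun s hs => ⟨hs.1, hs.2.trans_lt ht.2⟩
  have hsub' : ∀ s ∈ Ioc 0 t, s ∈ Ico 0 T := fun s hs => hsub s ⟨hs.1.le, hs.2⟩
  refine sub_nonneg.1 (nonneg_of_supersolution_strip (S := t) (M := drift K T t) (C := |M| + 1)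
    (w := fun x s => u x s - x) (p := fun x s => p x s - 1) (q := q)
    (d := fun x s => q x s + drift K T s * p x s) (b := fun _ s => drift K T s)
    ?_ ?_ ?_ ?_ ?_ ?_ ?_ ?_ ?_ ρ hρ t ⟨ht.1, le_rfl⟩)
  · exact (h.continuousOn.mono (strip_subset ht.2)).sub (by fun_prop)
  · intro s hs; simp [h.boundary s (hsub s hs)]
  · intro x hx; simp [h.initial x hx]
  · intro x hx s hs
    have h1 := (abs_le.1 (h.abs_apply_le ht.2 hM x hx s hs)).1
    have hx0 : 0 ≤ x := hx
    nlinarith [mul_le_mul_of_nonneg_right (le_abs_self M) hx0, abs_nonneg M]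
  · intro x hx s hs
    exact (h.deriv_u x hx s (hsub' s hs)).sub (hasDerivAt_id x)
  · intro x hx s hs
    exact (h.deriv_p x hx s (hsub' s hs)).sub_const 1
  · intro x hx s hs
    exact (h.time_u x hx s ⟨hs.1, (hsub' s hs).2⟩).sub_const x
  · intro x hx s hs
    exact drift_mono hK hs.2 ht.2
  · intro x hx s hs
    have := drift_pos hK (hsub' s hs).2
    linarith

/-- The function `ρ + shift K T t` solves the equation and is nonnegative on the boundary. -/
theorem apply_le (h : IsLinearDataSolution K T u p q r) (hK : 0 < K) {ρ t : ℝ} (hρ : 0 ≤ ρ)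
    (ht : t ∈ Ico 0 T) : u ρ t ≤ ρ + shift K T t := by
  obtain ⟨M, hM⟩ := h.bounded_p t ht
  have hsub : ∀ s ∈ Icc 0 t, s ∈ Ico 0 T := fun s hs => ⟨hs.1, hs.2.trans_lt ht.2⟩
  have hsub' : ∀ s ∈ Ioc 0 t, s ∈ Ico 0 T := fun s hs => hsub s ⟨hs.1.le, hs.2⟩
  refine sub_nonneg.1 (nonneg_of_supersolution_strip (S := t) (M := drift K T t) (C := |M| + 1)
    (w := fun x s => x + shift K T s - u x s) (p := fun x s => 1 - p x s) (q := fun x s => -q x s)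
    (d := fun x s => drift K T s - (q x s + drift K T s * p x s)) (b := fun _ s => drift K T s)
    ?_ ?_ ?_ ?_ ?_ ?_ ?_ ?_ ?_ ρ hρ t ⟨ht.1, le_rfl⟩)
  · exact (continuous_fst.add ((continuous_shift K T).comp continuous_snd)).continuousOn.sub
      (h.continuousOn.mono (strip_subset ht.2))
  · intro s hs; simp [h.boundary s (hsub s hs), shift_nonneg hK hs.1]
  · intro x hx; simp [h.initial x hx, shift_zero]
  · intro x hx s hs
    have h1 := (abs_le.1 (h.abs_apply_le ht.2 hM x hx s hs)).2
    have hx0 : 0 ≤ x := hx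
    have h2 : 0 ≤ shift K T s := shift_nonneg hK hs.1
    nlinarith [mul_le_mul_of_nonneg_right (le_abs_self M) hx0, abs_nonneg M]
  · intro x hx s hs
    exact ((hasDerivAt_id x).add_const (shift K T s)).sub (h.deriv_u x hx s (hsub' s hs))
  · intro x hx s hs
    exact (h.deriv_p x hx s (hsub' s hs)).const_sub 1
  · intro x hx s hs
    exact ((hasDerivAt_shift (hsub' s hs).2).const_add x).sub
      (h.time_u x hx s ⟨hs.1, (hsub' s hs).2⟩)
  · intro x hx s hs
    exact drift_mono hK hs.2 ht.2
  · intro x hx s hs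
    linarith

/-- Comparison of `u` with its translate `u (· + δ)`, which is positive on the boundary. -/
theorem monotone_space (h : IsLinearDataSolution K T u p q r) (hK : 0 < K) {ρ t δ : ℝ}
    (hρ : 0 ≤ ρ) (hδ : 0 < δ) (ht : t ∈ Ico 0 T) : u ρ t ≤ u (ρ + δ) t := by
  obtain ⟨M, hM⟩ := h.bounded_p t ht
  have hsub : ∀ s ∈ Icc 0 t, s ∈ Ico 0 T := fun s hs => ⟨hs.1, hs.2.trans_lt ht.2⟩
  have hsub' : ∀ s ∈ Ioc 0 t, s ∈ Ico 0 T := fun s hs => hsub s ⟨hs.1.le, hs.2⟩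
  have hpos : ∀ x ∈ Ioi (0 : ℝ), x + δ ∈ Ioi (0 : ℝ) := fun x hx => by
    have : 0 < x := hx
    exact mem_Ioi.2 (by linarith)
  refine sub_nonneg.1 (nonneg_of_supersolution_strip (S := t) (M := drift K T t) (C := |M|)
    (w := fun x s => u (x + δ) s - u x s) (p := fun x s => p (x + δ) s - p x s)
    (q := fun x s => q (x + δ) s - q x s)
    (d := fun x s => (q (x + δ) s + drift K T s * p (x + δ) s) -
      (q x s + drift K T s * p x s)) (b := fun _ s => drift K T s)
    ?_ ?_ ?_ ?_ ?_ ?_ ?_ ?_ ?_ ρ hρ t ⟨ht.1, le_rfl⟩)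
  · refine ContinuousOn.sub ?_ (h.continuousOn.mono (strip_subset ht.2))
    refine (h.continuousOn.mono (strip_subset ht.2)).comp
      (f := fun z : ℝ × ℝ => (z.1 + δ, z.2)) (by fun_prop) fun z hz => ⟨?_, hz.2⟩
    have : 0 ≤ z.1 := hz.1
    exact mem_Ici.2 (by simp only; linarith)
  · intro s hs
    have := h.le_apply hK hδ.le (hsub s hs)
    simp only [zero_add, h.boundary s (hsub s hs)]
    linarith
  · intro x hx
    have hx0 : 0 ≤ x := hx
    simp only [h.initial x hx, h.initial (x + δ) (mem_Ici.2 (by linarith))]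
    linarith
  · intro x hx s hs
    have hx0 : 0 ≤ x := hx
    have h1 := (abs_le.1 (h.abs_apply_le ht.2 hM x hx s hs)).2
    have h2 := h.le_apply hK (by linarith : 0 ≤ x + δ) (hsub s hs)
    nlinarith [mul_le_mul_of_nonneg_right (le_abs_self M) hx0, abs_nonneg M]
  · intro x hx s hs
    exact ((h.deriv_u (x + δ) (hpos x hx) s (hsub' s hs)).comp_add_const x δ).sub
      (h.deriv_u x hx s (hsub' s hs))
  · intro x hx s hs
    exact ((h.deriv_p (x + δ) (hpos x hx) s (hsub' s hs)).comp_add_const x δ).sub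
      (h.deriv_p x hx s (hsub' s hs))
  · intro x hx s hs
    exact (h.time_u (x + δ) (hpos x hx) s ⟨hs.1, (hsub' s hs).2⟩).sub
      (h.time_u x hx s ⟨hs.1, (hsub' s hs).2⟩)
  · intro x hx s hs
    exact drift_mono hK hs.2 ht.2
  · intro x hx s hs
    linarith

theorem deriv_nonneg (h : IsLinearDataSolution K T u p q r) (hK : 0 < K) {ρ t : ℝ}
    (hρ : 0 < ρ) (ht : t ∈ Ico 0 T) : 0 ≤ p ρ t := by
  have hd := hasDerivWithinAt_iff_tendsto_slope' (s := Ioi ρ) (by simp) |>.1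
    (h.deriv_u ρ hρ t ht).hasDerivWithinAt
  refine ge_of_tendsto hd ?_
  filter_upwards [self_mem_nhdsWithin] with x hx
  have hx' : ρ < x := hx
  rw [slope_def_field]
  have := h.monotone_space hK hρ.le (sub_pos.2 hx') ht
  rw [add_sub_cancel] at this
  exact div_nonneg (by linarith) (by linarith)

/-- A substitute for concavity in `ρ`: the function `u - ρ u_ρ` vanishes initially and on the
boundary, and is a supersolution for the drift `g - 2 / ρ`. -/
theorem mul_deriv_le (h : IsLinearDataSolution K T u p q r) (hK : 0 < K) {ρ t : ℝ} (hρ : 0 ≤ ρ)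
    (ht : t ∈ Ico 0 T) : ρ * p ρ t ≤ u ρ t := by
  obtain ⟨M, hM⟩ := h.bounded_p t ht
  have hsub : ∀ s ∈ Icc 0 t, s ∈ Ico 0 T := fun s hs => ⟨hs.1, hs.2.trans_lt ht.2⟩
  have hsub' : ∀ s ∈ Ioc 0 t, s ∈ Ico 0 T := fun s hs => hsub s ⟨hs.1.le, hs.2⟩
  refine sub_nonneg.1 (nonneg_of_supersolution_strip (S := t) (M := drift K T t) (C := |M|)
    (w := fun x s => u x s - x * p x s) (p := fun x s => p x s - (1 * p x s + x * q x s))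
    (q := fun x s => q x s - (1 * q x s + (1 * q x s + x * r x s)))
    (d := fun x s => (q x s + drift K T s * p x s) - x * (r x s + drift K T s * q x s))
    (b := fun x s => drift K T s - 2 / x)
    ?_ ?_ ?_ ?_ ?_ ?_ ?_ ?_ ?_ ρ hρ t ⟨ht.1, le_rfl⟩)
  · exact (h.continuousOn.mono (strip_subset ht.2)).sub
      (continuous_fst.continuousOn.mul (h.continuousOn_p.mono (strip_subset ht.2)))
  · intro s hs; simp [h.boundary s (hsub s hs)]
  · intro x hx; simp [h.initial x hx, h.initial_p x hx]
  · intro x hx s hs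
    have hx0 : 0 ≤ x := hx
    have h1 := (abs_le.1 (hM x hx s hs)).2
    have h2 := h.le_apply hK hx0 (hsub s hs)
    nlinarith [mul_le_mul_of_nonneg_left (h1.trans (le_abs_self M)) hx0, abs_nonneg M]
  · intro x hx s hs
    exact (h.deriv_u x hx s (hsub' s hs)).sub
      ((hasDerivAt_id x).mul (h.deriv_p x hx s (hsub' s hs)))
  · intro x hx s hs
    exact (h.deriv_p x hx s (hsub' s hs)).sub
      (((h.deriv_p x hx s (hsub' s hs)).const_mul 1).add
        ((hasDerivAt_id x).mul (h.deriv_q x hx s (hsub' s hs))))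
  · intro x hx s hs
    exact (h.time_u x hx s ⟨hs.1, (hsub' s hs).2⟩).sub
      ((h.time_p x hx s ⟨hs.1, (hsub' s hs).2⟩).const_mul x)
  · intro x hx s hs
    have h1 := drift_mono hK hs.2 ht.2
    have h2 : 0 < 2 / x := div_pos two_pos hx
    linarith
  · intro x hx s hs
    have hx0 : 0 < x := hx
    have h1 := mul_nonneg (drift_pos hK (hsub' s hs).2).le (h.deriv_nonneg hK hx0 (hsub' s hs))
    have h2 : 2 / x * (x * q x s) = 2 * q x s := by field_simp
    linarith

/-- Near the boundary, `u` lies below a multiple of the self-similar barrier. -/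
theorem exists_le_rpow (h : IsLinearDataSolution K T u p q r) (hK : 0 < K) (hT : 0 < T) :
    ∃ α C : ℝ, 0 < α ∧ α < 1 ∧ 0 < C ∧
      ∀ ρ t, 0 ≤ ρ → ρ ≤ Real.sqrt T → t ∈ Ico 0 T → u ρ t ≤ C * ρ ^ α := by
  -- the smallness conditions on `β` that the barrier and the bounds of its profile require
  obtain ⟨β, hβ, h16, hE, h16K, h8K⟩ : ∃ β : ℝ, 0 < β ∧ β ≤ 1 / 16 ∧
      3 * β ≤ Real.exp (-((K + 1) * (2 * K + 2))) ∧ 16 * K * β ≤ 1 ∧ 8 * K ^ 2 * β ≤ 1 := by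
    refine ⟨min (1 / 16) (min (Real.exp (-((K + 1) * (2 * K + 2))) / 3)
      (min (1 / (16 * K)) (1 / (8 * K ^ 2)))), by positivity, min_le_left _ _, ?_, ?_, ?_⟩
    · rw [← le_div_iff₀' (by norm_num)]
      exact (min_le_right _ _).trans (min_le_left _ _)
    · rw [← le_div_iff₀' (by positivity)]
      exact (min_le_right _ _).trans ((min_le_right _ _).trans (min_le_left _ _))
    · rw [← le_div_iff₀' (by positivity)]
      exact (min_le_right _ _).trans ((min_le_right _ _).trans (min_le_right _ _))
  obtain ⟨c, hc, hlow⟩ := exists_rpow_le_profile hβ hK h8K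
  obtain ⟨C, hC, hup⟩ := exists_profile_le_rpow hβ (by linarith) hK
  have hsT : 0 < Real.sqrt T := Real.sqrt_pos.2 hT
  have hTβ : 0 < T ^ β := Real.rpow_pos_of_pos hT β
  -- the barrier is self-similar: it is comparable to `ρ ^ (2 β)` for all times
  have hscale : ∀ ρ t : ℝ, 0 ≤ ρ → t < T →
      (T - t) ^ β * (ρ / Real.sqrt (T - t)) ^ (2 * β) = ρ ^ (2 * β) := by
    intro ρ t hρ ht
    have hτ : 0 < T - t := by linarith
    rw [Real.div_rpow hρ (Real.sqrt_nonneg _), Real.sqrt_eq_rpow, ← Real.rpow_mul hτ.le,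
      show (1 / 2 : ℝ) * (2 * β) = β by ring]
    have := (Real.rpow_pos_of_pos hτ β).ne'
    field_simp
  -- the constant is dictated by the initial line and by the line `ρ = √T`
  set D : ℝ := 4 * Real.sqrt T / T ^ β + (1 + 2 * K) * Real.sqrt T / (c * Real.sqrt T ^ (2 * β))
    with hD
  have hD0 : 0 < D := by positivity
  refine ⟨2 * β, D * C, by linarith, by linarith, by positivity, fun ρ t hρ hρT ht => ?_⟩
  have hsub : ∀ s ∈ Icc 0 t, s ∈ Ico 0 T := fun s hs => ⟨hs.1, hs.2.trans_lt ht.2⟩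
  have hsub' : ∀ s ∈ Ioc 0 t, s ∈ Ico 0 T := fun s hs => hsub s ⟨hs.1.le, hs.2⟩
  have key : 0 ≤ D * barrier K T β ρ t - u ρ t := by
    refine nonneg_of_supersolution_box (R := Real.sqrt T) (S := t)
      (w := fun x s => D * barrier K T β x s - u x s)
      (p := fun x s => D * ((T - s) ^ β *
        (profileDeriv K β (x / Real.sqrt (T - s)) / Real.sqrt (T - s))) - p x s)
      (q := fun x s => D * ((T - s) ^ β *
        (profileDeriv₂ K β (x / Real.sqrt (T - s)) / (T - s))) - q x s)
      (d := fun x s => D * ((T - s) ^ β *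
        ((x / Real.sqrt (T - s) / 2 * profileDeriv K β (x / Real.sqrt (T - s)) -
        β * profile K β (x / Real.sqrt (T - s))) / (T - s))) - (q x s + drift K T s * p x s))
      (b := fun _ s => drift K T s) ?_ ?_ ?_ ?_ ?_ ?_ ?_ ?_ ρ ⟨hρ, hρT⟩ t ⟨ht.1, le_rfl⟩
    · refine ContinuousOn.sub (ContinuousOn.mul continuousOn_const ?_) (h.continuousOn.mono
        ((prod_mono (fun x hx => hx.1) subset_rfl).trans (strip_subset ht.2)))
      have hcp : Continuous (profile K β) :=
        continuous_iff_continuousAt.2 fun y => (hasDerivAt_profile K β y).continuousAt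
      refine ContinuousOn.mul ?_ (hcp.comp_continuousOn (ContinuousOn.div (by fun_prop)
        (by fun_prop) fun z hz => ?_))
      · exact ContinuousOn.rpow_const (by fun_prop) fun z hz => Or.inr hβ.le
      · exact (Real.sqrt_pos.2 (by linarith [(hsub _ hz.2).2])).ne'
    · intro s hs
      simp [barrier, profile_zero, h.boundary s (hsub s hs)]
    · intro s hs
      have hs' := hsub s hs
      have hτ : 0 < T - s := by linarith [hs'.2]
      have h1 := h.apply_le hK hsT.le hs'
      have h2 : shift K T s ≤ 2 * K * Real.sqrt T := shift_le hK
      have h3 : 1 ≤ Real.sqrt T / Real.sqrt (T - s) := by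
        rw [one_le_div (Real.sqrt_pos.2 hτ)]
        exact Real.sqrt_le_sqrt (by linarith [hs'.1])
      have h4 : c * Real.sqrt T ^ (2 * β) ≤ barrier K T β (Real.sqrt T) s := by
        rw [← hscale _ s hsT.le hs'.2, barrier, ← mul_assoc, mul_comm c, mul_assoc]
        exact mul_le_mul_of_nonneg_left (hlow _ h3) (Real.rpow_nonneg hτ.le _)
      have h5 : (1 + 2 * K) * Real.sqrt T / (c * Real.sqrt T ^ (2 * β)) ≤ D := by
        rw [hD]; linarith [show 0 < 4 * Real.sqrt T / T ^ β by positivity]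
      have h6 : 0 < c * Real.sqrt T ^ (2 * β) := by positivity
      rw [div_le_iff₀ h6] at h5
      have h7 := mul_le_mul_of_nonneg_left h4 hD0.le
      linarith
    · intro x hx
      simp only [h.initial x hx.1, barrier, sub_zero]
      have h1 : x / Real.sqrt T ≤ 1 := (div_le_one hsT).2 hx.2
      have h2 := quarter_le_profile hK hβ h16K (div_nonneg hx.1 hsT.le) h1
      have h3 : 4 * Real.sqrt T / T ^ β ≤ D := by
        rw [hD]
        linarith [show 0 < (1 + 2 * K) * Real.sqrt T / (c * Real.sqrt T ^ (2 * β)) by positivity]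
      have h4 : 4 * Real.sqrt T ≤ D * T ^ β := by rwa [div_le_iff₀ hTβ] at h3
      have h5 : 0 ≤ x / Real.sqrt T / 4 := by have := hx.1; positivity
      have h6 : D * T ^ β * (x / Real.sqrt T / 4) ≤ D * T ^ β * profile K β (x / Real.sqrt T) :=
        mul_le_mul_of_nonneg_left h2 (by positivity)
      have h7 := mul_le_mul_of_nonneg_right h4 h5
      have h8 : 4 * Real.sqrt T * (x / Real.sqrt T / 4) = x := by field_simp
      linarith
    · intro x hx s hs
      exact (hasDerivAt_barrier_space.const_mul D).sub (h.deriv_u x hx.1 s (hsub' s hs))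
    · intro x hx s hs
      exact ((hasDerivAt_barrier_space₂ (hsub' s hs).2).const_mul D).sub
        (h.deriv_p x hx.1 s (hsub' s hs))
    · intro x hx s hs
      exact ((hasDerivAt_barrier_time (hsub' s hs).2).const_mul D).sub
        (h.time_u x hx.1 s ⟨hs.1, (hsub' s hs).2⟩)
    · intro x hx s hs
      have := mul_le_mul_of_nonneg_left
        (barrier_supersolution hK hβ h16 hE hx.1.le (hsub' s hs).2) hD0.le
      linarith
  have hτ : 0 < T - t := by linarith [ht.2]
  have h1 : barrier K T β ρ t ≤ C * ρ ^ (2 * β) := by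
    rw [← hscale ρ t hρ ht.2, barrier, ← mul_assoc, mul_comm C, mul_assoc]
    exact mul_le_mul_of_nonneg_left (hup _ (div_nonneg hρ (Real.sqrt_nonneg _)))
      (Real.rpow_nonneg hτ.le _)
  have h2 := mul_le_mul_of_nonneg_left h1 hD0.le
  linarith

theorem exists_le_rpow_add (h : IsLinearDataSolution K T u p q r) (hK : 0 < K) (hT : 0 < T) :
    ∃ C α : ℝ, 1 ≤ C ∧ 0 < α ∧ α < 1 ∧ ∀ ρ t, 0 ≤ ρ → t ∈ Ico 0 T →
      u ρ t ≤ C * (ρ ^ α + ρ) := by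
  obtain ⟨α, C, hα, hα1, hC, hle⟩ := h.exists_le_rpow hK hT
  refine ⟨C + (1 + 2 * K), α, by linarith, hα, hα1, fun ρ t hρ ht => ?_⟩
  have h0 : 0 ≤ ρ ^ α := Real.rpow_nonneg hρ α
  have e1 := mul_nonneg hC.le hρ
  have e2 := mul_nonneg hK.le hρ
  have e3 := mul_nonneg hK.le h0
  have e4 := mul_nonneg hC.le h0
  rcases le_total ρ (Real.sqrt T) with hρT | hρT
  · have := hle ρ t hρ hρT ht
    nlinarith
  · have h1 := h.apply_le hK hρ ht
    have h2 : shift K T t ≤ 2 * K * Real.sqrt T := shift_le hK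
    have h3 := mul_le_mul_of_nonneg_left hρT hK.le
    nlinarith

end IsLinearDataSolution

end Estimates

/-! ### The heat kernel and its derivatives -/

/-- The kernel `τ ^ (-c) * exp (-x² / (4 τ))`, extended by zero to `τ ≤ 0`. -/
def gaussPow (c : ℝ) (z : ℝ × ℝ) : ℝ :=
  if 0 < z.2 then z.2 ^ (-c) * Real.exp (-(z.1 ^ 2 / (4 * z.2))) else 0

theorem gaussPow_of_pos {c : ℝ} {z : ℝ × ℝ} (h : 0 < z.2) :
    gaussPow c z = z.2 ^ (-c) * Real.exp (-(z.1 ^ 2 / (4 * z.2))) := if_pos h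

theorem gaussPow_of_nonpos {c : ℝ} {z : ℝ × ℝ} (h : z.2 ≤ 0) : gaussPow c z = 0 :=
  if_neg h.not_gt

theorem gaussPow_nonneg (c : ℝ) (z : ℝ × ℝ) : 0 ≤ gaussPow c z := by
  unfold gaussPow
  split_ifs with h
  · exact mul_nonneg (Real.rpow_nonneg h.le _) (Real.exp_pos _).le
  · exact le_rfl

theorem gaussPow_le {c τ a x : ℝ} (hτ : 0 < τ) (ha : a ≤ x ^ 2) :
    gaussPow c (x, τ) ≤ τ ^ (-c) * Real.exp (-(a / (4 * τ))) := by
  rw [gaussPow_of_pos hτ]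
  refine mul_le_mul_of_nonneg_left (Real.exp_le_exp.2 (neg_le_neg ?_)) (Real.rpow_nonneg hτ.le _)
  exact div_le_div_of_nonneg_right ha (by linarith)

theorem tendsto_rpow_mul_exp_neg_div_nhdsGT (c : ℝ) {a : ℝ} (ha : 0 < a) :
    Tendsto (fun τ : ℝ => τ ^ (-c) * Real.exp (-(a / (4 * τ)))) (𝓝[>] 0) (𝓝 0) := by
  have h := (tendsto_rpow_mul_exp_neg_mul_atTop_nhds_zero c (a / 4) (by positivity)).comp
    tendsto_inv_nhdsGT_zero
  refine h.congr' ?_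
  filter_upwards [self_mem_nhdsWithin] with τ hτ
  have hτ' : 0 < τ := hτ
  simp only [Function.comp_apply]
  rw [Real.inv_rpow hτ'.le, Real.rpow_neg hτ'.le]
  congr 2
  field_simp

/-- The kernels are flat on the initial line away from the origin. -/
theorem isLittleO_gaussPow (c : ℝ) {x : ℝ} (hx : x ≠ 0) :
    (gaussPow c) =o[𝓝 (x, 0)] fun z => z - (x, 0) := by
  have hx2 : 0 < x ^ 2 / 4 := by positivity
  rw [Asymptotics.isLittleO_iff]
  intro ε hε
  have h1 : ∀ᶠ τ : ℝ in 𝓝[>] 0, τ ^ (-(c + 1)) * Real.exp (-(x ^ 2 / 4 / (4 * τ))) < ε :=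
    (tendsto_rpow_mul_exp_neg_div_nhdsGT (c + 1) hx2).eventually_lt_const hε
  have h2 : ∀ᶠ z : ℝ × ℝ in 𝓝 (x, 0), x ^ 2 / 4 ≤ z.1 ^ 2 := by
    have : Tendsto (fun z : ℝ × ℝ => z.1 ^ 2) (𝓝 (x, 0)) (𝓝 (x ^ 2)) :=
      (by fun_prop : Continuous fun z : ℝ × ℝ => z.1 ^ 2).tendsto' _ _ rfl
    exact this.eventually_const_le (by nlinarith)
  have h3 : ∀ᶠ z : ℝ × ℝ in 𝓝 (x, 0), 0 < z.2 →
      z.2 ^ (-(c + 1)) * Real.exp (-(x ^ 2 / 4 / (4 * z.2))) < ε := by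
    rw [eventually_nhdsWithin_iff] at h1
    exact (continuous_snd.tendsto (x, (0 : ℝ))).eventually h1
  filter_upwards [h2, h3] with z hz2 hz3
  rcases le_or_gt z.2 0 with h | h
  · rw [gaussPow_of_nonpos h, norm_zero]; positivity
  · rw [Real.norm_of_nonneg (gaussPow_nonneg _ _)]
    have e1 : gaussPow c z ≤ z.2 ^ (-c) * Real.exp (-(x ^ 2 / 4 / (4 * z.2))) :=
      gaussPow_le h hz2
    have e2 : z.2 ^ (-c) = z.2 ^ (-(c + 1)) * z.2 := by
      rw [show -c = -(c + 1) + 1 by ring, Real.rpow_add_one h.ne']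
    have e3 : z.2 ≤ ‖z - (x, 0)‖ := by
      refine le_trans ?_ (norm_snd_le _)
      simpa using le_abs_self z.2
    calc gaussPow c z ≤ _ := e1
      _ = z.2 ^ (-(c + 1)) * Real.exp (-(x ^ 2 / 4 / (4 * z.2))) * z.2 := by rw [e2]; ring
      _ ≤ ε * z.2 := mul_le_mul_of_nonneg_right (hz3 h).le h.le
      _ ≤ ε * ‖z - (x, 0)‖ := mul_le_mul_of_nonneg_left e3 hε.le

/-- The kernels `gaussPow c` form a class closed under differentiation, up to polynomial factors;
this gives smoothness off the origin, across the initial line `τ = 0` included. -/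
theorem hasFDerivAt_gaussPow (c : ℝ) {z : ℝ × ℝ} (hz : z ≠ 0) :
    HasFDerivAt (gaussPow c)
      ((-(z.1 / 2) * gaussPow (c + 1) z) • ContinuousLinearMap.fst ℝ ℝ ℝ +
        (-c * gaussPow (c + 1) z + z.1 ^ 2 / 4 * gaussPow (c + 2) z) •
          ContinuousLinearMap.snd ℝ ℝ ℝ) z := by
  rcases lt_trichotomy z.2 0 with h | h | h
  · have hev : gaussPow c =ᶠ[𝓝 z] fun _ => 0 := by
      filter_upwards [continuous_snd.continuousAt.eventually_lt continuousAt_const h] with w hw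
      exact gaussPow_of_nonpos hw.le
    rw [gaussPow_of_nonpos h.le, gaussPow_of_nonpos h.le]
    simpa using (hasFDerivAt_const (0 : ℝ) z).congr_of_eventuallyEq hev
  · obtain ⟨x, τ⟩ := z
    simp only at h
    subst h
    have hx : x ≠ 0 := fun hx => hz (by rw [hx]; rfl)
    rw [gaussPow_of_nonpos le_rfl, gaussPow_of_nonpos le_rfl]
    rw [hasFDerivAt_iff_isLittleO]
    refine (isLittleO_gaussPow c hx).congr_left fun w => ?_
    simp [gaussPow_of_nonpos (show ((x, 0) : ℝ × ℝ).2 ≤ 0 from le_rfl)]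
  · have hev : gaussPow c =ᶠ[𝓝 z]
        fun w => w.2 ^ (-c) * Real.exp (-(w.1 ^ 2 / (4 * w.2))) := by
      filter_upwards [continuousAt_const.eventually_lt continuous_snd.continuousAt h] with w hw
      exact gaussPow_of_pos hw
    have h1 : HasFDerivAt (fun w : ℝ × ℝ => w.1) (ContinuousLinearMap.fst ℝ ℝ ℝ) z :=
      hasFDerivAt_fst
    have h2 : HasFDerivAt (fun w : ℝ × ℝ => w.2) (ContinuousLinearMap.snd ℝ ℝ ℝ) z :=
      hasFDerivAt_snd
    have h3 := (h2.rpow_const (p := -c) (Or.inl h.ne')).mul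
      (((h1.pow 2).mul ((hasDerivAt_inv (mul_pos four_pos h).ne').comp_hasFDerivAt z
        (h2.const_mul 4))).neg.exp)
    refine (h3.congr_of_eventuallyEq (hev.trans (.of_eq ?_))).congr_fderiv ?_
    · ext w
      simp [div_eq_mul_inv]
    have e1 : z.2 ^ (-c - 1) = z.2 ^ (-c) / z.2 := Real.rpow_sub_one h.ne' _
    have e2 : z.2 ^ (-(c + 1)) = z.2 ^ (-c) / z.2 := by
      rw [← e1]; congr 1; ring
    have e3 : z.2 ^ (-(c + 2)) = z.2 ^ (-c) / z.2 ^ 2 := by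
      rw [show -(c + 2) = -c - (2 : ℕ) by push_cast; ring, Real.rpow_sub_natCast h.ne']
    rw [gaussPow_of_pos h, gaussPow_of_pos h, e2, e3]
    ext <;> simp [e1, div_eq_mul_inv] <;> field_simp <;> ring

theorem contDiffOn_gaussPow (n : ℕ) : ∀ c : ℝ, ContDiffOn ℝ n (gaussPow c) {0}ᶜ := by
  induction n with
  | zero =>
    intro c
    exact contDiffOn_zero.2 fun z hz =>
      (hasFDerivAt_gaussPow c hz).continuousAt.continuousWithinAt
  | succ n ih =>
    intro c
    have hs : UniqueDiffOn ℝ ({0}ᶜ : Set (ℝ × ℝ)) := isOpen_compl_singleton.uniqueDiffOn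
    push_cast
    rw [contDiffOn_succ_iff_hasFDerivWithinAt_of_uniqueDiffOn hs]
    refine ⟨by simp, _, ?_, fun z hz => (hasFDerivAt_gaussPow c hz).hasFDerivWithinAt⟩
    have h1 := ih (c + 1)
    have h2 := ih (c + 2)
    have hf : ContDiffOn ℝ n (fun z : ℝ × ℝ => z.1) {0}ᶜ := contDiff_fst.contDiffOn
    exact (((hf.div_const 2).neg.mul h1).smul contDiffOn_const).add
      (((contDiffOn_const.mul h1).add (((hf.pow 2).div_const 4).mul h2)).smul contDiffOn_const)

/-- The space derivative of a kernel on space-time. -/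
def dx (κ : ℝ × ℝ → ℝ) (z : ℝ × ℝ) : ℝ := fderiv ℝ κ z (1, 0)

/-- The time derivative of a kernel on space-time. -/
def dt (κ : ℝ × ℝ → ℝ) (z : ℝ × ℝ) : ℝ := fderiv ℝ κ z (0, 1)

/-- Kernels on space-time that are smooth away from the origin and solve the heat equation
there. -/
structure IsHeatKernel (κ : ℝ × ℝ → ℝ) : Prop where
  smooth : ContDiffOn ℝ ∞ κ {0}ᶜ
  heat : ∀ z ≠ 0, dt κ z = dx (dx κ) z

theorem contDiffOn_fderiv_apply {κ : ℝ × ℝ → ℝ} (h : ContDiffOn ℝ ∞ κ {0}ᶜ) (v : ℝ × ℝ) :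
    ContDiffOn ℝ ∞ (fun z => fderiv ℝ κ z v) {0}ᶜ :=
  (h.fderiv_of_isOpen isOpen_compl_singleton (by simp)).clm_apply contDiffOn_const

theorem hasFDerivAt_kernel {κ : ℝ × ℝ → ℝ} (h : ContDiffOn ℝ ∞ κ {0}ᶜ) {z : ℝ × ℝ}
    (hz : z ≠ 0) : HasFDerivAt κ (dx κ z • ContinuousLinearMap.fst ℝ ℝ ℝ +
      dt κ z • ContinuousLinearMap.snd ℝ ℝ ℝ) z := by
  have hd : DifferentiableAt ℝ κ z :=
    (h.contDiffAt (isOpen_compl_singleton.mem_nhds hz)).differentiableAt (by simp)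
  refine hd.hasFDerivAt.congr_fderiv ?_
  ext <;> simp [dx, dt]

theorem dx_dt_comm {κ : ℝ × ℝ → ℝ} (h : ContDiffOn ℝ ∞ κ {0}ᶜ) {z : ℝ × ℝ} (hz : z ≠ 0) :
    dt (dx κ) z = dx (dt κ) z := by
  have hc : ContDiffAt ℝ ∞ κ z := h.contDiffAt (isOpen_compl_singleton.mem_nhds hz)
  have hd : DifferentiableAt ℝ (fderiv ℝ κ) z :=
    (hc.fderiv_right (m := 1) (by norm_cast)).differentiableAt (by simp)
  have hsymm : IsSymmSndFDerivAt ℝ κ z :=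
    hc.isSymmSndFDerivAt (by simpa using (by norm_cast : (2 : ℕ∞ω) ≤ ∞))
  have e : ∀ v w : ℝ × ℝ, fderiv ℝ (fun y => fderiv ℝ κ y v) z w = fderiv ℝ (fderiv ℝ κ) z w v :=
    fun v w => by
      have := (hd.hasFDerivAt.clm_apply (hasFDerivAt_const v z)).fderiv
      rw [this]; simp
  change fderiv ℝ (fun y => fderiv ℝ κ y (1, 0)) z (0, 1) =
    fderiv ℝ (fun y => fderiv ℝ κ y (0, 1)) z (1, 0)
  rw [e, e]
  exact hsymm _ _

theorem fderiv_congr_off_zero {κ κ' : ℝ × ℝ → ℝ} (h : ∀ z ≠ 0, κ z = κ' z) {z : ℝ × ℝ}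
    (hz : z ≠ 0) : fderiv ℝ κ z = fderiv ℝ κ' z := by
  apply Filter.EventuallyEq.fderiv_eq
  filter_upwards [isOpen_compl_singleton.mem_nhds hz] with w hw using h w hw

theorem IsHeatKernel.dx {κ : ℝ × ℝ → ℝ} (h : IsHeatKernel κ) : IsHeatKernel (dx κ) where
  smooth := contDiffOn_fderiv_apply h.smooth _
  heat z hz := by
    rw [dx_dt_comm h.smooth hz]
    exact congrArg (fun L => L (1, 0)) (fderiv_congr_off_zero h.heat hz)

theorem dx_eq_of_hasFDerivAt {κ : ℝ × ℝ → ℝ} {z : ℝ × ℝ} {a b : ℝ}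
    (h : HasFDerivAt κ (a • ContinuousLinearMap.fst ℝ ℝ ℝ +
      b • ContinuousLinearMap.snd ℝ ℝ ℝ) z) : dx κ z = a ∧ dt κ z = b := by
  simp [dx, dt, h.fderiv]

theorem dx_gaussPow (c : ℝ) {z : ℝ × ℝ} (hz : z ≠ 0) :
    dx (gaussPow c) z = -(z.1 / 2) * gaussPow (c + 1) z :=
  (dx_eq_of_hasFDerivAt (hasFDerivAt_gaussPow c hz)).1

theorem dt_gaussPow (c : ℝ) {z : ℝ × ℝ} (hz : z ≠ 0) :
    dt (gaussPow c) z = -c * gaussPow (c + 1) z + z.1 ^ 2 / 4 * gaussPow (c + 2) z :=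
  (dx_eq_of_hasFDerivAt (hasFDerivAt_gaussPow c hz)).2

theorem isHeatKernel_gaussPow : IsHeatKernel (gaussPow (1 / 2)) where
  smooth := contDiffOn_infty.2 fun n => contDiffOn_gaussPow n _
  heat z hz := by
    have h1 : ∀ w ≠ 0, dx (gaussPow (1 / 2)) w = -(w.1 / 2) * gaussPow (1 / 2 + 1) w :=
      fun w hw => dx_gaussPow _ hw
    have e : dx (dx (gaussPow (1 / 2))) z =
        fderiv ℝ (fun w : ℝ × ℝ => -(w.1 / 2) * gaussPow (1 / 2 + 1) w) z (1, 0) :=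
      congrArg (fun L => L (1, 0)) (fderiv_congr_off_zero h1 hz)
    have h2 : HasFDerivAt (fun w : ℝ × ℝ => -(w.1 / 2)) (-((2 : ℝ)⁻¹ •
        ContinuousLinearMap.fst ℝ ℝ ℝ)) z := by
      refine HasFDerivAt.neg ?_
      simpa [div_eq_inv_mul] using
        (hasFDerivAt_fst (𝕜 := ℝ) (E := ℝ) (F := ℝ) (p := z)).const_mul (2 : ℝ)⁻¹
    have h3 : fderiv ℝ (fun w : ℝ × ℝ => -(w.1 / 2) * gaussPow (1 / 2 + 1) w) z = _ :=
      (h2.mul (hasFDerivAt_gaussPow (1 / 2 + 1) hz)).fderiv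
    rw [e, h3, dt_gaussPow _ hz]
    simp
    ring_nf

/-- The heat kernel on the line, extended by zero to nonpositive times. -/
def heatKernel (z : ℝ × ℝ) : ℝ := (Real.sqrt (4 * Real.pi))⁻¹ * gaussPow (1 / 2) z

theorem fderiv_const_mul_off_zero {κ : ℝ × ℝ → ℝ} (h : ContDiffOn ℝ ∞ κ {0}ᶜ) (a : ℝ)
    {z : ℝ × ℝ} (hz : z ≠ 0) : fderiv ℝ (fun w => a * κ w) z = a • fderiv ℝ κ z :=
  ((hasFDerivAt_kernel h hz).differentiableAt.hasFDerivAt.const_mul a).fderiv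

theorem IsHeatKernel.const_mul {κ : ℝ × ℝ → ℝ} (h : IsHeatKernel κ) (a : ℝ) :
    IsHeatKernel (fun z => a * κ z) where
  smooth := contDiffOn_const.mul h.smooth
  heat z hz := by
    have h1 : ∀ w ≠ 0, HalfLine.dx (fun w => a * κ w) w = a * HalfLine.dx κ w := fun w hw => by
      simp [HalfLine.dx, fderiv_const_mul_off_zero h.smooth a hw]
    have h2 : HalfLine.dx (HalfLine.dx fun w => a * κ w) z = a * HalfLine.dx (HalfLine.dx κ) z := by
      rw [HalfLine.dx, fderiv_congr_off_zero h1 hz, fderiv_const_mul_off_zero h.dx.smooth a hz]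
      simp [HalfLine.dx]
    rw [h2, ← h.heat z hz]
    simp [dt, fderiv_const_mul_off_zero h.smooth a hz]

theorem isHeatKernel_heatKernel : IsHeatKernel heatKernel :=
  isHeatKernel_gaussPow.const_mul _

/-- The dipole kernel `-∂ₓ` of the heat kernel, that is `x / (2 τ)` times the heat kernel. -/
def dipoleKernel (z : ℝ × ℝ) : ℝ :=
  (Real.sqrt (4 * Real.pi))⁻¹ * (z.1 / 2 * gaussPow (3 / 2) z)

theorem dx_heatKernel {z : ℝ × ℝ} (hz : z ≠ 0) : dx heatKernel z = -dipoleKernel z := by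
  have : dx heatKernel z = (Real.sqrt (4 * Real.pi))⁻¹ * dx (gaussPow (1 / 2)) z := by
    have e : fderiv ℝ heatKernel z = _ :=
      fderiv_const_mul_off_zero isHeatKernel_gaussPow.smooth (Real.sqrt (4 * Real.pi))⁻¹ hz
    rw [dx, dx, e]; rfl
  rw [this, dx_gaussPow _ hz, dipoleKernel]
  norm_num

theorem heatKernel_of_nonpos {z : ℝ × ℝ} (h : z.2 ≤ 0) : heatKernel z = 0 := by
  simp [heatKernel, gaussPow_of_nonpos h]

theorem dipoleKernel_of_nonpos {z : ℝ × ℝ} (h : z.2 ≤ 0) : dipoleKernel z = 0 := by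
  simp [dipoleKernel, gaussPow_of_nonpos h]

theorem isHeatKernel_dipoleKernel : IsHeatKernel dipoleKernel := by
  have h := isHeatKernel_heatKernel.dx.const_mul (-1)
  have e : ∀ z ≠ 0, -1 * dx heatKernel z = dipoleKernel z := fun z hz => by
    rw [dx_heatKernel hz]; ring
  have e' : ∀ z ≠ 0, dx (fun z => -1 * dx heatKernel z) z = dx dipoleKernel z := fun z hz =>
    congrArg (fun L => L (1, 0)) (fderiv_congr_off_zero e hz)
  refine ⟨h.smooth.congr fun z hz => (e z hz).symm, fun z hz => ?_⟩
  have h1 := h.heat z hz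
  rw [dt, fderiv_congr_off_zero e hz, dx, fderiv_congr_off_zero e' hz] at h1
  exact h1

theorem dx_dipoleKernel {z : ℝ × ℝ} (hz : z ≠ 0) : dx dipoleKernel z = -dt heatKernel z := by
  have e : ∀ z ≠ 0, -1 * dx heatKernel z = dipoleKernel z := fun z hz => by
    rw [dx_heatKernel hz]; ring
  rw [isHeatKernel_heatKernel.heat z hz, dx, ← fderiv_congr_off_zero e hz,
    fderiv_const_mul_off_zero isHeatKernel_heatKernel.dx.smooth _ hz]
  simp [dx]

/-! ### Layer potentials off their sources -/

section Layers

/-- Position of the space-time point `p` relative to the source at time `s`, which sits on the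
boundary `ρ = 0`. The coordinate `ρ + shift t` removes the drift. -/
def sep (K T : ℝ) (p : ℝ × ℝ) (s : ℝ) : ℝ × ℝ :=
  (p.1 + shift K T p.2 - shift K T s, p.2 - s)

/-- The layer potential with kernel `κ` and density `q` on the boundary times `0 ≤ s ≤ b`. -/
def layer (K T b : ℝ) (κ : ℝ × ℝ → ℝ) (q : ℝ → ℝ) (p : ℝ × ℝ) : ℝ :=
  ∫ s in (0)..b, κ (sep K T p s) * q s

/-- The points before time `T` that do not lie on the sources of times `0 ≤ s ≤ b`. -/
def offSource (K T b : ℝ) : Set (ℝ × ℝ) := {p | p.2 < T ∧ ∀ s ∈ Icc 0 b, sep K T p s ≠ 0}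

variable {K T b : ℝ} {κ : ℝ × ℝ → ℝ} {q : ℝ → ℝ} {p : ℝ × ℝ}

theorem continuous_sep (K T : ℝ) : Continuous fun x : (ℝ × ℝ) × ℝ => sep K T x.1 x.2 := by
  have := continuous_shift K T
  unfold sep
  fun_prop

theorem isOpen_offSource (K T b : ℝ) : IsOpen (offSource K T b) := by
  rw [isOpen_iff_eventually]
  rintro p ⟨hp, hs⟩
  refine (continuous_snd.continuousAt.eventually_lt continuousAt_const hp).and ?_
  exact isCompact_Icc.eventually_forall_of_forall_eventually fun s hs' =>
    (continuous_sep K T).continuousAt.eventually_ne (hs s hs')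

/-- Points with `ρ > 0` are off the sources of all times: for `s = t` they are at distance `ρ`,
and for `s ≠ t` they differ in time. -/
theorem mem_offSource_of_pos (hp : 0 < p.1) (hpT : p.2 < T) : p ∈ offSource K T b := by
  refine ⟨hpT, fun s _ h => ?_⟩
  simp only [sep, Prod.mk_eq_zero] at h
  have e : p.2 = s := by linarith [h.2]
  rw [e] at h
  linarith [h.1]

theorem mem_offSource_of_lt (hp : b < p.2) (hpT : p.2 < T) : p ∈ offSource K T b := by
  refine ⟨hpT, fun s hs h => ?_⟩
  simp only [sep, Prod.mk_eq_zero] at h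
  linarith [h.2, hs.2]

theorem continuousAt_kernel_sep (h : ContinuousOn κ {0}ᶜ) {s : ℝ} (hs : sep K T p s ≠ 0) :
    ContinuousAt (fun x : (ℝ × ℝ) × ℝ => κ (sep K T x.1 x.2)) (p, s) :=
  ContinuousAt.comp (f := fun x : (ℝ × ℝ) × ℝ => sep K T x.1 x.2) (g := κ)
    (h.continuousAt (isOpen_compl_singleton.mem_nhds hs)) (continuous_sep K T).continuousAt

theorem continuousOn_kernel_sep (h : ContinuousOn κ {0}ᶜ) (hp : p ∈ offSource K T b) :
    ContinuousOn (fun s => κ (sep K T p s)) (Icc 0 b) := fun s hs =>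
  (ContinuousAt.comp (f := fun s : ℝ => (p, s)) (continuousAt_kernel_sep h (hp.2 s hs))
    (by fun_prop)).continuousWithinAt

theorem intervalIntegrable_layer (hb : 0 ≤ b) (h : ContinuousOn κ {0}ᶜ)
    (hq : ContinuousOn q (Icc 0 b)) (hp : p ∈ offSource K T b) :
    IntervalIntegrable (fun s => κ (sep K T p s) * q s) MeasureTheory.volume 0 b :=
  ((continuousOn_kernel_sep h hp).mul hq).intervalIntegrable_of_Icc hb

theorem hasFDerivAt_sep {s : ℝ} (hp : p.2 < T) :
    HasFDerivAt (fun p => sep K T p s)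
      ((ContinuousLinearMap.fst ℝ ℝ ℝ + drift K T p.2 • ContinuousLinearMap.snd ℝ ℝ ℝ).prod
        (ContinuousLinearMap.snd ℝ ℝ ℝ)) p := by
  have h1 : HasFDerivAt (fun w : ℝ × ℝ => w.1) (ContinuousLinearMap.fst ℝ ℝ ℝ) p :=
    hasFDerivAt_fst
  have h2 : HasFDerivAt (fun w : ℝ × ℝ => w.2) (ContinuousLinearMap.snd ℝ ℝ ℝ) p :=
    hasFDerivAt_snd
  exact ((h1.add ((hasDerivAt_shift hp).comp_hasFDerivAt p h2)).sub_const _).prodMk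
    (h2.sub_const s)

theorem hasFDerivAt_kernel_sep (h : ContDiffOn ℝ ∞ κ {0}ᶜ) {s : ℝ} (hp : p.2 < T)
    (hs : sep K T p s ≠ 0) :
    HasFDerivAt (fun p => κ (sep K T p s))
      (dx κ (sep K T p s) • ContinuousLinearMap.fst ℝ ℝ ℝ +
        (drift K T p.2 * dx κ (sep K T p s) + dt κ (sep K T p s)) •
          ContinuousLinearMap.snd ℝ ℝ ℝ) p := by
  refine ((hasFDerivAt_kernel h hs).comp p (hasFDerivAt_sep hp)).congr_fderiv ?_
  ext <;> simp
  ring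

/-- Layer potentials are differentiated under the integral sign. -/
theorem hasFDerivAt_layer (hb : 0 ≤ b) (h : ContDiffOn ℝ ∞ κ {0}ᶜ)
    (hq : ContinuousOn q (Icc 0 b)) (hp : p ∈ offSource K T b) :
    HasFDerivAt (layer K T b κ q)
      (layer K T b (dx κ) q p • ContinuousLinearMap.fst ℝ ℝ ℝ +
        (drift K T p.2 * layer K T b (dx κ) q p + layer K T b (dt κ) q p) •
          ContinuousLinearMap.snd ℝ ℝ ℝ) p := by
  have hx : ContinuousOn (dx κ) {0}ᶜ := (contDiffOn_fderiv_apply h _).continuousOn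
  have ht : ContinuousOn (dt κ) {0}ᶜ := (contDiffOn_fderiv_apply h _).continuousOn
  obtain ⟨Q, hQ⟩ := isCompact_Icc.exists_bound_of_continuousOn hq
  set A : ℝ × ℝ → ℝ → ℝ := fun p s => dx κ (sep K T p s) with hA
  set B : ℝ × ℝ → ℝ → ℝ := fun p s => drift K T p.2 * dx κ (sep K T p s) + dt κ (sep K T p s)
    with hB
  have hgc : ContinuousAt (fun x : (ℝ × ℝ) × ℝ => drift K T x.1.2) (p, (0 : ℝ)) := by
    have : ContinuousAt (drift K T) p.2 := by
      unfold drift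
      exact continuousAt_const.div (by fun_prop) (Real.sqrt_pos.2 (by linarith [hp.1])).ne'
    exact this.comp (f := fun x : (ℝ × ℝ) × ℝ => x.1.2) (x := (p, (0 : ℝ))) (by fun_prop)
  have hNc : ∀ s ∈ Icc 0 b,
      ContinuousAt (fun x : (ℝ × ℝ) × ℝ => |A x.1 x.2| + |B x.1 x.2|) (p, s) := by
    intro s hs
    have hgc' : ContinuousAt (fun x : (ℝ × ℝ) × ℝ => drift K T x.1.2) (p, s) :=
      hgc.comp (f := fun x : (ℝ × ℝ) × ℝ => (x.1, (0 : ℝ))) (x := (p, s)) (by fun_prop)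
    exact (continuousAt_kernel_sep hx (hp.2 s hs)).abs.add
      ((hgc'.mul (continuousAt_kernel_sep hx (hp.2 s hs))).add
        (continuousAt_kernel_sep ht (hp.2 s hs))).abs
  obtain ⟨M, hM⟩ : ∃ M, ∀ s ∈ Icc 0 b, |A p s| + |B p s| ≤ M := by
    have : ContinuousOn (fun s => |A p s| + |B p s|) (Icc 0 b) := fun s hs =>
      (ContinuousAt.comp (f := fun s : ℝ => (p, s)) (hNc s hs) (by fun_prop)).continuousWithinAt
    obtain ⟨M, hM⟩ := isCompact_Icc.bddAbove_image this
    exact ⟨M, fun s hs => hM (mem_image_of_mem _ hs)⟩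
  have hnear : ∀ᶠ w in 𝓝 p, ∀ s ∈ Icc 0 b, |A w s| + |B w s| < M + 1 :=
    isCompact_Icc.eventually_forall_of_forall_eventually fun s hs =>
      (hNc s hs).eventually_lt_const ((hM s hs).trans_lt (by linarith))
  have hoff : ∀ᶠ w in 𝓝 p, w ∈ offSource K T b := (isOpen_offSource K T b).mem_nhds hp
  have hIoc : Set.uIoc 0 b ⊆ Icc 0 b := by rw [uIoc_of_le hb]; exact Ioc_subset_Icc_self
  have main := intervalIntegral.hasFDerivAt_integral_of_dominated_of_fderiv_le
    (𝕜 := ℝ) (μ := MeasureTheory.volume) (a := 0) (b := b)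
    (F := fun w s => κ (sep K T w s) * q s)
    (F' := fun w s => (A w s * q s) • ContinuousLinearMap.fst ℝ ℝ ℝ +
      (B w s * q s) • ContinuousLinearMap.snd ℝ ℝ ℝ)
    (x₀ := p) (bound := fun _ => (M + 1) * Q) (hoff.and hnear) ?_ ?_ ?_ ?_ ?_ ?_
  · have hcA : ContinuousOn (fun s => A p s * q s) (Icc 0 b) :=
      (continuousOn_kernel_sep hx hp).mul hq
    have hcD : ContinuousOn (fun s => dt κ (sep K T p s) * q s) (Icc 0 b) :=
      (continuousOn_kernel_sep ht hp).mul hq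
    have hcB : ContinuousOn (fun s => B p s * q s) (Icc 0 b) :=
      (((continuousOn_const (c := drift K T p.2)).mul
        (continuousOn_kernel_sep hx hp)).add (continuousOn_kernel_sep ht hp)).mul hq
    refine main.congr_fderiv ?_
    have e1 := intervalIntegral.integral_add (μ := MeasureTheory.volume) (a := 0) (b := b)
      (f := fun s => (A p s * q s) • ContinuousLinearMap.fst ℝ ℝ ℝ)
      (g := fun s => (B p s * q s) • ContinuousLinearMap.snd ℝ ℝ ℝ)
      ((hcA.smul continuousOn_const).intervalIntegrable_of_Icc hb)
      ((hcB.smul continuousOn_const).intervalIntegrable_of_Icc hb)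
    rw [e1, intervalIntegral.integral_smul_const, intervalIntegral.integral_smul_const]
    congr 2
    simp only [layer]
    rw [← intervalIntegral.integral_const_mul,
      ← intervalIntegral.integral_add
        ((hcA.intervalIntegrable_of_Icc hb).const_mul _) (hcD.intervalIntegrable_of_Icc hb)]
    congr 1
    ext s
    simp only [hB]
    ring
  · filter_upwards [hoff] with w hw
    exact (((continuousOn_kernel_sep h.continuousOn hw).mul hq).mono hIoc).aestronglyMeasurable
      measurableSet_uIoc
  · exact intervalIntegrable_layer hb h.continuousOn hq hp
  · refine ContinuousOn.aestronglyMeasurable ?_ measurableSet_uIoc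
    refine ContinuousOn.mono ?_ hIoc
    exact (((continuousOn_kernel_sep hx hp).mul hq).smul continuousOn_const).add
      (((((continuousOn_const (c := drift K T p.2)).mul (continuousOn_kernel_sep hx hp)).add
        (continuousOn_kernel_sep ht hp)).mul hq).smul continuousOn_const)
  · refine Eventually.of_forall fun s hs w hw => ?_
    have h1 := (hw.2 s (hIoc hs)).le
    have h2 := hQ s (hIoc hs)
    rw [Real.norm_eq_abs] at h2
    calc ‖(A w s * q s) • ContinuousLinearMap.fst ℝ ℝ ℝ +
          (B w s * q s) • ContinuousLinearMap.snd ℝ ℝ ℝ‖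
        ≤ ‖(A w s * q s) • ContinuousLinearMap.fst ℝ ℝ ℝ‖ +
          ‖(B w s * q s) • ContinuousLinearMap.snd ℝ ℝ ℝ‖ := norm_add_le _ _
      _ ≤ |A w s * q s| * 1 + |B w s * q s| * 1 := by
          rw [norm_smul, norm_smul, Real.norm_eq_abs, Real.norm_eq_abs]
          gcongr
          · exact ContinuousLinearMap.norm_fst_le ..
          · exact ContinuousLinearMap.norm_snd_le ..
      _ = (|A w s| + |B w s|) * |q s| := by rw [abs_mul, abs_mul]; ring
      _ ≤ (M + 1) * Q := mul_le_mul h1 h2 (abs_nonneg _)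
          (le_trans (by positivity) h1)
  · exact intervalIntegrable_const
  · refine Eventually.of_forall fun s hs w hw => ?_
    refine ((hasFDerivAt_kernel_sep h hw.1.1 (hw.1.2 s (hIoc hs))).mul_const (q s)).congr_fderiv ?_
    simp only [hA, hB, smul_add, smul_smul]
    congr 2 <;> ring

theorem contDiffAt_drift (n : ℕ∞ω) {t : ℝ} (ht : t < T) : ContDiffAt ℝ n (drift K T) t := by
  unfold drift
  exact contDiffAt_const.div ((contDiffAt_const.sub contDiffAt_id).sqrt (by simp; linarith))
    (Real.sqrt_pos.2 (by simp; linarith)).ne'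

theorem contDiffAt_shift (n : ℕ∞ω) {t : ℝ} (ht : t < T) : ContDiffAt ℝ n (shift K T) t := by
  unfold shift
  exact contDiffAt_const.mul (contDiffAt_const.sub
    ((contDiffAt_const.sub contDiffAt_id).sqrt (by simp; linarith)))

/-- Layer potentials with continuous density are smooth off their sources, also across the
initial line `t = 0`. -/
theorem contDiffOn_layer_nat (hb : 0 ≤ b) (hq : ContinuousOn q (Icc 0 b)) (n : ℕ) :
    ∀ κ : ℝ × ℝ → ℝ, ContDiffOn ℝ ∞ κ {0}ᶜ →
      ContDiffOn ℝ n (layer K T b κ q) (offSource K T b) := by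
  induction n with
  | zero =>
    intro κ h
    exact contDiffOn_zero.2 fun p hp =>
      (hasFDerivAt_layer hb h hq hp).continuousAt.continuousWithinAt
  | succ n ih =>
    intro κ h
    push_cast
    rw [contDiffOn_succ_iff_hasFDerivWithinAt_of_uniqueDiffOn
      (isOpen_offSource K T b).uniqueDiffOn]
    refine ⟨by simp, _, ?_, fun p hp => (hasFDerivAt_layer hb h hq hp).hasFDerivWithinAt⟩
    have h1 := ih (dx κ) (contDiffOn_fderiv_apply h _)
    have h2 := ih (dt κ) (contDiffOn_fderiv_apply h _)
    have hg : ContDiffOn ℝ n (fun p : ℝ × ℝ => drift K T p.2) (offSource K T b) := fun p hp =>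
      ((contDiffAt_drift n hp.1).comp p contDiffAt_snd).contDiffWithinAt
    exact (h1.smul contDiffOn_const).add (((hg.mul h1).add h2).smul contDiffOn_const)

theorem contDiffOn_layer (hb : 0 ≤ b) (hq : ContinuousOn q (Icc 0 b))
    (h : ContDiffOn ℝ ∞ κ {0}ᶜ) : ContDiffOn ℝ ∞ (layer K T b κ q) (offSource K T b) :=
  contDiffOn_infty.2 fun n => contDiffOn_layer_nat hb hq n κ h

/-- Integration by parts along the boundary: the total derivative of `κ (sep p s)` in `s` is
`-g(s) ∂ₓκ - ∂_τ κ`. -/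
theorem layer_dt (hb : 0 < b) (hbT : b < T) (h : ContDiffOn ℝ ∞ κ {0}ᶜ) {q' : ℝ → ℝ}
    (hq : ContinuousOn q (Icc 0 b)) (hq' : ContinuousOn q' (Icc 0 b))
    (hd : ∀ s ∈ Ioo 0 b, HasDerivAt q (q' s) s) (h0 : q 0 = 0)
    (hp : p ∈ offSource K T b) (hκ : κ (sep K T p b) = 0) :
    layer K T b (dt κ) q p =
      layer K T b κ q' p - layer K T b (dx κ) (fun s => drift K T s * q s) p := by
  have hx : ContinuousOn (dx κ) {0}ᶜ := (contDiffOn_fderiv_apply h _).continuousOn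
  have ht : ContinuousOn (dt κ) {0}ᶜ := (contDiffOn_fderiv_apply h _).continuousOn
  have hg : ContinuousOn (drift K T) (Icc 0 b) := fun s hs =>
    (contDiffAt_drift (T := T) 0 (hs.2.trans_lt hbT)).continuousAt.continuousWithinAt
  have hderiv : ∀ s ∈ Ioo 0 b, HasDerivAt (fun s => κ (sep K T p s))
      (-(drift K T s * dx κ (sep K T p s) + dt κ (sep K T p s))) s := by
    intro s hs
    have h1 : HasDerivAt (fun s => sep K T p s) (-drift K T s, -1) s := by
      refine HasDerivAt.prodMk ?_ ?_
      · exact (hasDerivAt_shift (hs.2.trans hbT)).const_sub _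
      · exact (hasDerivAt_id s).const_sub _
    refine ((hasFDerivAt_kernel h (hp.2 s ⟨hs.1.le, hs.2.le⟩)).comp_hasDerivAt s h1).congr_deriv ?_
    simp
    ring
  have hx' := continuousOn_kernel_sep hx hp
  have ht' := continuousOn_kernel_sep ht hp
  have hk' := continuousOn_kernel_sep h.continuousOn hp
  have hib := intervalIntegral.integral_mul_deriv_eq_deriv_mul_of_hasDerivAt
    (a := 0) (b := b) (u := fun s => κ (sep K T p s)) (v := q) (v' := q')
    (u' := fun s => -(drift K T s * dx κ (sep K T p s) + dt κ (sep K T p s)))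
    (by rwa [uIcc_of_le hb.le]) (by rwa [uIcc_of_le hb.le])
    (by rwa [min_eq_left hb.le, max_eq_right hb.le])
    (by rwa [min_eq_left hb.le, max_eq_right hb.le])
    (((hg.mul hx').add ht').neg.intervalIntegrable_of_Icc hb.le)
    (hq'.intervalIntegrable_of_Icc hb.le)
  rw [hκ, h0, zero_mul, mul_zero, sub_zero, zero_sub, ← intervalIntegral.integral_neg] at hib
  simp only [layer]
  rw [hib, ← intervalIntegral.integral_sub]
  · congr 1; ext s; ring
  · exact ((((hg.mul hx').add ht').neg.mul hq).neg).intervalIntegrable_of_Icc hb.le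
  · exact (hx'.mul (hg.mul hq)).intervalIntegrable_of_Icc hb.le

end Layers

/-! ### Single and double layer potentials up to the boundary -/

section Potentials

/-- The mean drift `(∫ₛᵗ g) / (t - s)` between the times `s` and `t`. -/
def meanDrift (K T t s : ℝ) : ℝ := 2 * K / (Real.sqrt (T - s) + Real.sqrt (T - t))

theorem shift_sub_shift {K T t s : ℝ} (ht : t < T) (hs : s < T) :
    shift K T t - shift K T s = (t - s) * meanDrift K T t s := by
  have h1 : 0 < Real.sqrt (T - t) := Real.sqrt_pos.2 (by linarith)
  have h2 : 0 < Real.sqrt (T - s) := Real.sqrt_pos.2 (by linarith)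
  have e1 := Real.sq_sqrt (show 0 ≤ T - t by linarith)
  have e2 := Real.sq_sqrt (show 0 ≤ T - s by linarith)
  rw [meanDrift, shift, shift, mul_div_assoc', eq_div_iff (by positivity)]
  have : t - s = Real.sqrt (T - s) ^ 2 - Real.sqrt (T - t) ^ 2 := by rw [e1, e2]; ring
  rw [this]; ring

theorem meanDrift_nonneg {K : ℝ} (hK : 0 < K) (T t s : ℝ) : 0 ≤ meanDrift K T t s :=
  div_nonneg (by linarith) (add_nonneg (Real.sqrt_nonneg _) (Real.sqrt_nonneg _))

theorem continuousAt_meanDrift {K T : ℝ} {z : ℝ × ℝ} (hz : z.1 < T) :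
    ContinuousAt (fun z : ℝ × ℝ => meanDrift K T z.1 z.2) z := by
  unfold meanDrift
  refine continuousAt_const.div (by fun_prop) ?_
  have h1 : 0 < Real.sqrt (T - z.1) := Real.sqrt_pos.2 (by linarith)
  positivity

variable {K T : ℝ} {q : ℝ → ℝ} {p : ℝ × ℝ}

theorem sep_eq {s : ℝ} (hp : p.2 < T) (hs : s < T) :
    sep K T p s = (p.1 + (p.2 - s) * meanDrift K T p.2 s, p.2 - s) := by
  rw [← shift_sub_shift hp hs, sep]; congr 1; ring

theorem heatKernel_nonneg (z : ℝ × ℝ) : 0 ≤ heatKernel z :=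
  mul_nonneg (by positivity) (gaussPow_nonneg _ _)

theorem heatKernel_le {x τ : ℝ} (hτ : 0 < τ) : heatKernel (x, τ) ≤ τ ^ (-(1 / 2) : ℝ) := by
  have h1 : gaussPow (1 / 2) (x, τ) ≤ τ ^ (-(1 / 2) : ℝ) := by
    simpa using gaussPow_le (c := 1 / 2) (a := 0) hτ (sq_nonneg x)
  have h2 : (Real.sqrt (4 * Real.pi))⁻¹ ≤ 1 := by
    apply inv_le_one_of_one_le₀
    rw [Real.one_le_sqrt]
    linarith [Real.pi_gt_three]
  calc heatKernel (x, τ) ≤ 1 * gaussPow (1 / 2) (x, τ) :=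
        mul_le_mul_of_nonneg_right h2 (gaussPow_nonneg _ _)
    _ ≤ _ := by rw [one_mul]; exact h1

/-- Single layer potential up to the present time `t = p.2`, with a density `c t s` that may also
depend on `t`. -/
def heatIntegral (K T : ℝ) (c : ℝ → ℝ → ℝ) (p : ℝ × ℝ) : ℝ :=
  ∫ s in (0)..p.2, heatKernel (sep K T p s) * c p.2 s

/-- The triangle of times `0 ≤ s ≤ t < T`. -/
def timeTriangle (T : ℝ) : Set (ℝ × ℝ) := {z | 0 ≤ z.2 ∧ z.2 ≤ z.1 ∧ z.1 < T}

theorem exists_bound_on_timeTriangle {c : ℝ → ℝ → ℝ}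
    (hc : ContinuousOn (fun z : ℝ × ℝ => c z.1 z.2) (timeTriangle T)) {S : ℝ} (hS : S < T) :
    ∃ M, 0 ≤ M ∧ ∀ t s, 0 ≤ s → s ≤ t → t ≤ S → |c t s| ≤ M := by
  have hcomp : IsCompact {z : ℝ × ℝ | 0 ≤ z.2 ∧ z.2 ≤ z.1 ∧ z.1 ≤ S} := by
    refine (isCompact_Icc (a := (0, 0)) (b := (S, S))).of_isClosed_subset ?_ ?_
    · exact (isClosed_le continuous_const continuous_snd).inter
        ((isClosed_le continuous_snd continuous_fst).inter
          (isClosed_le continuous_fst continuous_const))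
    · rintro ⟨t, s⟩ ⟨h1, h2, h3⟩
      exact ⟨⟨h1.trans h2, h1⟩, ⟨h3, h2.trans h3⟩⟩
  obtain ⟨M, hM⟩ := hcomp.exists_bound_of_continuousOn
    (hc.mono fun z hz => ⟨hz.1, hz.2.1, hz.2.2.trans_lt hS⟩)
  exact ⟨|M|, abs_nonneg M, fun t s h1 h2 h3 =>
    (hM (t, s) ⟨h1, h2, h3⟩).trans (le_abs_self M)⟩

theorem integrableOn_rpow_neg_half {S : ℝ} (hS : 0 ≤ S) :
    IntegrableOn (fun τ : ℝ => τ ^ (-(1 / 2) : ℝ)) (Ioc 0 S) := by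
  have := intervalIntegral.intervalIntegrable_rpow' (a := 0) (b := S)
    (show (-1 : ℝ) < -(1 / 2) by norm_num)
  rwa [intervalIntegrable_iff_integrableOn_Ioc_of_le hS] at this

/-- The integrand of `heatIntegral` in the elapsed time `τ = t - s`, extended by zero. -/
def heatIntegrand (K T : ℝ) (c : ℝ → ℝ → ℝ) (p : ℝ × ℝ) : ℝ → ℝ :=
  (Iic p.2).indicator fun τ => heatKernel (sep K T p (p.2 - τ)) * c p.2 (p.2 - τ)

theorem heatIntegral_eq {c : ℝ → ℝ → ℝ} {S : ℝ} (hp : 0 ≤ p.2) (hpS : p.2 ≤ S) :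
    heatIntegral K T c p = ∫ τ in Ioc 0 S, heatIntegrand K T c p τ := by
  have h := intervalIntegral.integral_comp_sub_left (a := 0) (b := p.2)
    (fun s => heatKernel (sep K T p s) * c p.2 s) p.2
  rw [sub_self, sub_zero] at h
  rw [heatIntegral, ← h, intervalIntegral.integral_of_le hp, heatIntegrand,
    setIntegral_indicator measurableSet_Iic, Ioc_inter_Iic, min_eq_right hpS]

theorem abs_heatIntegrand_le {c : ℝ → ℝ → ℝ} {S M τ : ℝ} (hM : 0 ≤ M)
    (hc : ∀ t s, 0 ≤ s → s ≤ t → t ≤ S → |c t s| ≤ M) (hpS : p.2 ≤ S) (hτ : 0 < τ) :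
    ‖heatIntegrand K T c p τ‖ ≤ M * τ ^ (-(1 / 2) : ℝ) := by
  have h0 : 0 ≤ τ ^ (-(1 / 2) : ℝ) := Real.rpow_nonneg hτ.le _
  rw [heatIntegrand, Set.indicator_apply]
  split_ifs with h
  · have h' : τ ≤ p.2 := h
    rw [Real.norm_eq_abs, abs_mul, abs_of_nonneg (heatKernel_nonneg _), mul_comm M]
    refine mul_le_mul ?_ (hc _ _ (by linarith) (by linarith) hpS) (abs_nonneg _) h0
    rw [sep, sub_sub_cancel]
    exact heatKernel_le hτ
  · rw [norm_zero]; positivity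

theorem continuousAt_heatKernel_of_pos {z : ℝ × ℝ} (hz : 0 < z.2) : ContinuousAt heatKernel z :=
  isHeatKernel_heatKernel.smooth.continuousOn.continuousAt
    (isOpen_compl_singleton.mem_nhds fun h => by rw [h] at hz; exact lt_irrefl _ hz)

theorem continuous_sep_sub (K T τ : ℝ) : Continuous fun p : ℝ × ℝ => sep K T p (p.2 - τ) :=
  (continuous_sep K T).comp (continuous_id.prodMk (continuous_snd.sub continuous_const))

/-- Single layer potentials are continuous up to the boundary, by dominated convergence. -/
theorem continuousOn_heatIntegral {c : ℝ → ℝ → ℝ}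
    (hc : ContinuousOn (fun z : ℝ × ℝ => c z.1 z.2) (timeTriangle T)) :
    ContinuousOn (heatIntegral K T c) (region T) := by
  intro p₀ hp₀
  obtain ⟨S, hS1, hS2⟩ := exists_between hp₀.2.2
  have hS0 : 0 ≤ S := hp₀.2.1.trans hS1.le
  obtain ⟨M, hM0, hM⟩ := exists_bound_on_timeTriangle hc hS2
  have hnear : ∀ᶠ p in 𝓝[region T] p₀, p ∈ region T ∧ p.2 < S :=
    (eventually_mem_nhdsWithin).and
      (nhdsWithin_le_nhds (continuous_snd.continuousAt.eventually_lt continuousAt_const hS1))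
  have hev : heatIntegral K T c =ᶠ[𝓝[region T] p₀]
      fun p => ∫ τ in Ioc 0 S, heatIntegrand K T c p τ := by
    filter_upwards [hnear] with p hp using heatIntegral_eq hp.1.2.1 hp.2.le
  refine ContinuousWithinAt.congr_of_eventuallyEq ?_ hev (heatIntegral_eq hp₀.2.1 hS1.le)
  refine continuousWithinAt_of_dominated (bound := fun τ => M * τ ^ (-(1 / 2) : ℝ)) ?_ ?_
    ((integrableOn_rpow_neg_half hS0).const_mul M) ?_
  · filter_upwards [hnear] with p hp
    rw [heatIntegrand, aestronglyMeasurable_indicator_iff measurableSet_Iic,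
      Measure.restrict_restrict measurableSet_Iic]
    refine ContinuousOn.aestronglyMeasurable ?_ (measurableSet_Iic.inter measurableSet_Ioc)
    rintro τ ⟨hτ1, hτ2⟩
    refine ContinuousWithinAt.mul ?_ ?_
    · refine ContinuousAt.continuousWithinAt (ContinuousAt.comp
        (f := fun τ => sep K T p (p.2 - τ)) (continuousAt_heatKernel_of_pos ?_) ?_)
      · simpa [sep] using hτ2.1
      · exact ((continuous_sep K T).comp (continuous_const.prodMk
          (continuous_const.sub continuous_id))).continuousAt
    · have hτ1' : τ ≤ p.2 := hτ1
      refine (hc (p.2, p.2 - τ) ⟨by simpa using hτ1', by simpa using hτ2.1.le,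
        hp.1.2.2⟩).comp (f := fun τ => (p.2, p.2 - τ)) (by fun_prop) ?_
      rintro σ ⟨hσ1, hσ2⟩
      have hσ1' : σ ≤ p.2 := hσ1
      exact ⟨by simpa using hσ1', by simpa using hσ2.1.le, hp.1.2.2⟩
  · filter_upwards [hnear] with p hp
    filter_upwards [self_mem_ae_restrict measurableSet_Ioc] with τ hτ
    exact abs_heatIntegrand_le hM0 hM hp.2.le hτ.1
  · -- the integrand is continuous in `p` except for `τ = t`, a null set
    have hne : ∀ᵐ τ ∂(volume.restrict (Ioc 0 S)), τ ≠ p₀.2 :=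
      ae_restrict_of_ae (Measure.ae_ne volume p₀.2)
    filter_upwards [hne, self_mem_ae_restrict measurableSet_Ioc] with τ hτ hτS
    rcases lt_or_gt_of_ne hτ with h | h
    · have hev' : (fun p => heatIntegrand K T c p τ) =ᶠ[𝓝[region T] p₀]
          fun p => heatKernel (sep K T p (p.2 - τ)) * c p.2 (p.2 - τ) := by
        refine nhdsWithin_le_nhds ?_
        filter_upwards [continuousAt_const.eventually_lt continuous_snd.continuousAt h] with p hp
        exact indicator_of_mem (show τ ∈ Iic p.2 from le_of_lt hp) _
      refine ContinuousWithinAt.congr_of_eventuallyEq ?_ hev'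
        (indicator_of_mem (show τ ∈ Iic p₀.2 from h.le) _)
      refine ContinuousWithinAt.mul ?_ ?_
      · refine ContinuousAt.continuousWithinAt (ContinuousAt.comp
          (f := fun p : ℝ × ℝ => sep K T p (p.2 - τ)) (continuousAt_heatKernel_of_pos ?_) ?_)
        · simpa [sep] using hτS.1
        · exact (continuous_sep_sub K T τ).continuousAt
      · have hmem : (p₀.2, p₀.2 - τ) ∈ timeTriangle T :=
          ⟨by simpa using h.le, by simpa using hτS.1.le, hp₀.2.2⟩
        have htend : Tendsto (fun p : ℝ × ℝ => (p.2, p.2 - τ)) (𝓝[region T] p₀)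
            (𝓝[timeTriangle T] (p₀.2, p₀.2 - τ)) := by
          refine tendsto_nhdsWithin_iff.2 ⟨(Continuous.tendsto (by fun_prop) p₀).mono_left
            nhdsWithin_le_nhds, ?_⟩
          filter_upwards [eventually_mem_nhdsWithin, nhdsWithin_le_nhds
            (continuousAt_const.eventually_lt continuous_snd.continuousAt h)] with p hp1 hp2
          have hp2' : τ < p.2 := hp2
          exact ⟨by simpa using hp2'.le, by simpa using hτS.1.le, hp1.2.2⟩
        exact (hc _ hmem).tendsto.comp htend
    · have hev' : (fun p => heatIntegrand K T c p τ) =ᶠ[𝓝[region T] p₀] fun _ => 0 := by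
        refine nhdsWithin_le_nhds ?_
        filter_upwards [continuous_snd.continuousAt.eventually_lt continuousAt_const h] with p hp
        exact indicator_of_notMem (show τ ∉ Iic p.2 from not_le.2 hp) _
      exact continuousWithinAt_const.congr_of_eventuallyEq hev'
        (indicator_of_notMem (show τ ∉ Iic p₀.2 from not_le.2 h) _)

theorem exists_bound_heatIntegral {c : ℝ → ℝ → ℝ}
    (hc : ContinuousOn (fun z : ℝ × ℝ => c z.1 z.2) (timeTriangle T)) {S : ℝ} (hS0 : 0 ≤ S)
    (hS : S < T) :
    ∃ M, ∀ ρ t, t ∈ Icc 0 S → |heatIntegral K T c (ρ, t)| ≤ M := by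
  obtain ⟨M, hM0, hM⟩ := exists_bound_on_timeTriangle hc hS
  refine ⟨∫ τ in Ioc 0 S, M * τ ^ (-(1 / 2) : ℝ), fun ρ t ht => ?_⟩
  rw [heatIntegral_eq (S := S) ht.1 ht.2, ← Real.norm_eq_abs]
  refine norm_integral_le_of_norm_le ((integrableOn_rpow_neg_half hS0).const_mul M) ?_
  filter_upwards [self_mem_ae_restrict measurableSet_Ioc] with τ hτ
  exact abs_heatIntegrand_le hM0 hM ht.2 hτ.1

/-- The regular factor of the dipole integrand after the singular part of the kernel has been
split off; `τ` is the elapsed time and the density is extended by `q 0` to negative times. -/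
def dipoleWeight (K T : ℝ) (q : ℝ → ℝ) (p : ℝ × ℝ) (τ : ℝ) : ℝ :=
  Real.exp (-(p.1 * meanDrift K T p.2 (max (p.2 - τ) 0) / 2 +
    τ * meanDrift K T p.2 (max (p.2 - τ) 0) ^ 2 / 4)) * q (max (p.2 - τ) 0)

/-- Double layer potential up to the present time `t = p.2`, in a form that is continuous up to the
boundary `ρ = 0`: the singular part is written in the variable `σ = ρ / (2 √τ)`, which turns the
dipole kernel into a Gaussian. For `ρ > 0` it is the integral of the dipole kernel, see
`doubleLayer_eq`. -/
def doubleLayer (K T : ℝ) (q : ℝ → ℝ) (p : ℝ × ℝ) : ℝ :=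
  (Real.sqrt Real.pi)⁻¹ *
      (∫ σ in Ioi (0 : ℝ), Real.exp (-σ ^ 2) * dipoleWeight K T q p (p.1 ^ 2 / (4 * σ ^ 2))) +
    1 / 2 * heatIntegral K T (fun t s => meanDrift K T t s * q s) p

theorem continuousOn_meanDrift_mul (hq : ContinuousOn q (Ico 0 T)) :
    ContinuousOn (fun z : ℝ × ℝ => meanDrift K T z.1 z.2 * q z.2) (timeTriangle T) := by
  refine ContinuousOn.mul (fun z hz => (continuousAt_meanDrift hz.2.2).continuousWithinAt) ?_
  exact hq.comp continuousOn_snd fun z hz => ⟨hz.1, hz.2.1.trans_lt hz.2.2⟩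

theorem continuousOn_dipoleWeight (hq : ContinuousOn q (Ico 0 T)) :
    ContinuousOn (fun z : (ℝ × ℝ) × ℝ => dipoleWeight K T q z.1 z.2) (region T ×ˢ Ici 0) := by
  have hm : ContinuousOn (fun z : (ℝ × ℝ) × ℝ => meanDrift K T z.1.2 (max (z.1.2 - z.2) 0))
      (region T ×ˢ Ici 0) := fun z hz =>
    (ContinuousAt.comp (f := fun z : (ℝ × ℝ) × ℝ => (z.1.2, max (z.1.2 - z.2) 0)) (x := z)
      (continuousAt_meanDrift (K := K) (T := T) hz.1.2.2) (by fun_prop)).continuousWithinAt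
  refine ContinuousOn.mul ?_ ?_
  · refine Real.continuous_exp.comp_continuousOn (ContinuousOn.neg ?_)
    exact (((by fun_prop : ContinuousOn (fun z : (ℝ × ℝ) × ℝ => z.1.1) _).mul hm).div_const 2).add
      ((continuousOn_snd.mul (hm.pow 2)).div_const 4)
  · refine hq.comp (by fun_prop) fun z hz => ⟨le_max_right _ _, max_lt ?_ ?_⟩
    · have h1 : z.1.2 < T := hz.1.2.2
      have h2 : 0 ≤ z.2 := hz.2
      linarith
    · exact hz.1.2.1.trans_lt hz.1.2.2

theorem abs_dipoleWeight_le (hK : 0 < K) {S Q τ : ℝ} (hQ : ∀ s ∈ Icc 0 S, ‖q s‖ ≤ Q)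
    (hp1 : 0 ≤ p.1) (hp2 : p.2 ∈ Icc 0 S) (hτ : 0 ≤ τ) : |dipoleWeight K T q p τ| ≤ Q := by
  have hm := meanDrift_nonneg hK T p.2 (max (p.2 - τ) 0)
  have h1 := hQ (max (p.2 - τ) 0) ⟨le_max_right _ _, max_le (by linarith [hp2.2])
    (hp2.1.trans hp2.2)⟩
  rw [dipoleWeight, abs_mul, Real.abs_exp]
  have h2 : Real.exp (-(p.1 * meanDrift K T p.2 (max (p.2 - τ) 0) / 2 +
      τ * meanDrift K T p.2 (max (p.2 - τ) 0) ^ 2 / 4)) ≤ 1 :=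
    Real.exp_le_one_iff.2 (neg_nonpos.2 (by positivity))
  calc _ ≤ 1 * |q (max (p.2 - τ) 0)| := mul_le_mul_of_nonneg_right h2 (abs_nonneg _)
    _ ≤ Q := by rw [one_mul]; exact h1

theorem integrableOn_exp_neg_sq : IntegrableOn (fun σ : ℝ => Real.exp (-σ ^ 2)) (Ioi 0) := by
  simpa using (integrable_exp_neg_mul_sq (b := 1) one_pos).integrableOn (s := Ioi 0)

theorem continuousOn_doubleLayer (hK : 0 < K) (hq : ContinuousOn q (Ico 0 T)) :
    ContinuousOn (doubleLayer K T q) (region T) := by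
  refine ContinuousOn.add (continuousOn_const.mul ?_) (continuousOn_const.mul
    (continuousOn_heatIntegral (continuousOn_meanDrift_mul hq)))
  intro p₀ hp₀
  obtain ⟨S, hS1, hS2⟩ := exists_between hp₀.2.2
  obtain ⟨Q, hQ⟩ := (isCompact_Icc (a := 0) (b := S)).exists_bound_of_continuousOn
    (hq.mono fun s hs => ⟨hs.1, hs.2.trans_lt hS2⟩)
  have hW := continuousOn_dipoleWeight (K := K) hq
  have hnear : ∀ᶠ p in 𝓝[region T] p₀, p ∈ region T ∧ p.2 < S :=
    (eventually_mem_nhdsWithin).and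
      (nhdsWithin_le_nhds (continuous_snd.continuousAt.eventually_lt continuousAt_const hS1))
  refine continuousWithinAt_of_dominated (bound := fun σ => Real.exp (-σ ^ 2) * Q) ?_ ?_
    (integrableOn_exp_neg_sq.mul_const Q) ?_
  · filter_upwards [hnear] with p hp
    refine ContinuousOn.aestronglyMeasurable (ContinuousOn.mul (by fun_prop) ?_) measurableSet_Ioi
    refine hW.comp (f := fun σ : ℝ => (p, p.1 ^ 2 / (4 * σ ^ 2))) ?_ ?_
    · refine continuousOn_const.prodMk (continuousOn_const.div (by fun_prop) fun σ hσ => ?_)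
      have : 0 < σ := hσ
      positivity
    · intro σ hσ
      exact ⟨hp.1, mem_Ici.2 (by positivity)⟩
  · filter_upwards [hnear] with p hp
    refine Eventually.of_forall fun σ => ?_
    rw [norm_mul, Real.norm_of_nonneg (Real.exp_pos _).le]
    exact mul_le_mul_of_nonneg_left (abs_dipoleWeight_le hK hQ hp.1.1 ⟨hp.1.2.1, hp.2.le⟩
      (by positivity)) (Real.exp_pos _).le
  · refine Eventually.of_forall fun σ => continuousWithinAt_const.mul ?_
    refine (hW (p₀, p₀.1 ^ 2 / (4 * σ ^ 2)) ⟨hp₀, mem_Ici.2 (by positivity)⟩).comp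
      (f := fun p : ℝ × ℝ => (p, p.1 ^ 2 / (4 * σ ^ 2))) ?_ ?_
    · exact Continuous.continuousWithinAt (by fun_prop)
    · intro p hp
      exact ⟨hp, mem_Ici.2 (by positivity)⟩

theorem exists_bound_doubleLayer (hK : 0 < K) (hq : ContinuousOn q (Ico 0 T)) {S : ℝ}
    (hS0 : 0 ≤ S) (hS : S < T) :
    ∃ M, ∀ ρ t, 0 ≤ ρ → t ∈ Icc 0 S → |doubleLayer K T q (ρ, t)| ≤ M := by
  obtain ⟨M, hM⟩ := exists_bound_heatIntegral (K := K) (c := fun t s => meanDrift K T t s * q s)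
    (continuousOn_meanDrift_mul hq) hS0 hS
  obtain ⟨Q, hQ⟩ := (isCompact_Icc (a := 0) (b := S)).exists_bound_of_continuousOn
    (hq.mono fun s hs => ⟨hs.1, hs.2.trans_lt hS⟩)
  refine ⟨(Real.sqrt Real.pi)⁻¹ * (∫ σ in Ioi (0 : ℝ), Real.exp (-σ ^ 2) * Q) + 1 / 2 * M,
    fun ρ t hρ ht => ?_⟩
  refine (abs_add_le _ _).trans (add_le_add ?_ ?_)
  · rw [abs_mul, abs_of_nonneg (by positivity : 0 ≤ (Real.sqrt Real.pi)⁻¹)]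
    refine mul_le_mul_of_nonneg_left ?_ (by positivity)
    rw [← Real.norm_eq_abs]
    refine norm_integral_le_of_norm_le (integrableOn_exp_neg_sq.mul_const Q)
      (Eventually.of_forall fun σ => ?_)
    rw [norm_mul, Real.norm_of_nonneg (Real.exp_pos _).le]
    exact mul_le_mul_of_nonneg_left (abs_dipoleWeight_le hK hQ hρ ht (by positivity))
      (Real.exp_pos _).le
  · rw [abs_mul, abs_of_nonneg (by norm_num : (0 : ℝ) ≤ 1 / 2)]
    exact mul_le_mul_of_nonneg_left (hM ρ t ht) (by norm_num)

/-- The jump relation: on the boundary the double layer potential takes half the density plus a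
weakly singular integral. -/
theorem doubleLayer_boundary {t : ℝ} (ht : 0 ≤ t) :
    doubleLayer K T q (0, t) =
      1 / 2 * (q t + heatIntegral K T (fun t s => meanDrift K T t s * q s) (0, t)) := by
  have h1 : ∀ σ : ℝ, Real.exp (-σ ^ 2) *
      dipoleWeight K T q (0, t) ((0, t).1 ^ 2 / (4 * σ ^ 2)) = Real.exp (-1 * σ ^ 2) * q t := by
    intro σ
    simp [dipoleWeight, ht]
  rw [doubleLayer]
  simp_rw [h1]
  rw [integral_mul_const, integral_gaussian_Ioi, div_one]
  have : 0 < Real.sqrt Real.pi := Real.sqrt_pos.2 Real.pi_pos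
  field_simp

/-- The singular part of the dipole kernel in the variable `σ = ρ / (2 √τ)`. -/
theorem integral_dipole_change_of_variables {ρ : ℝ} (hρ : 0 < ρ) (W : ℝ → ℝ) :
    ∫ τ in Ioi (0 : ℝ), (Real.sqrt (4 * Real.pi))⁻¹ * (ρ / 2 * (τ ^ (-(3 / 2) : ℝ) *
        Real.exp (-(ρ ^ 2 / (4 * τ))))) * W τ =
      (Real.sqrt Real.pi)⁻¹ *
        ∫ σ in Ioi (0 : ℝ), Real.exp (-σ ^ 2) * W (ρ ^ 2 / (4 * σ ^ 2)) := by
  have himg : (fun σ : ℝ => ρ ^ 2 / (4 * σ ^ 2)) '' Ioi 0 = Ioi 0 := by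
    ext τ
    constructor
    · rintro ⟨σ, hσ, rfl⟩
      have : 0 < σ := hσ
      exact mem_Ioi.2 (by positivity)
    · intro hτ
      have hτ' : 0 < τ := hτ
      have hs := Real.sqrt_pos.2 hτ'
      refine ⟨ρ / (2 * Real.sqrt τ), mem_Ioi.2 (by positivity), ?_⟩
      have := Real.sq_sqrt hτ'.le
      field_simp
      nlinarith
  have hinj : InjOn (fun σ : ℝ => ρ ^ 2 / (4 * σ ^ 2)) (Ioi 0) := by
    intro a ha b hb hab
    have ha' : 0 < a := ha
    have hb' : 0 < b := hb
    simp only at hab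
    rw [div_eq_div_iff (by positivity) (by positivity)] at hab
    have : a ^ 2 = b ^ 2 := by
      have := mul_left_cancel₀ (by positivity : ρ ^ 2 ≠ 0) hab
      linarith
    exact (pow_left_inj₀ ha'.le hb'.le two_ne_zero).1 this
  have hderiv : ∀ σ ∈ Ioi (0 : ℝ), HasDerivWithinAt (fun σ : ℝ => ρ ^ 2 / (4 * σ ^ 2))
      (-(ρ ^ 2 / (2 * σ ^ 3))) (Ioi 0) σ := by
    intro σ hσ
    have hσ' : 0 < σ := hσ
    have h1 : HasDerivAt (fun σ : ℝ => 4 * σ ^ 2) (4 * (2 * σ)) σ := by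
      simpa using ((hasDerivAt_id σ).pow 2).const_mul 4
    refine (((hasDerivAt_const σ (ρ ^ 2)).div h1 (by positivity)).congr_deriv
      ?_).hasDerivWithinAt
    field_simp
    ring
  have h := integral_image_eq_integral_abs_deriv_smul measurableSet_Ioi hderiv hinj
    (fun τ => (Real.sqrt (4 * Real.pi))⁻¹ * (ρ / 2 * (τ ^ (-(3 / 2) : ℝ) *
        Real.exp (-(ρ ^ 2 / (4 * τ))))) * W τ)
  rw [himg] at h
  rw [h, ← integral_const_mul]
  refine setIntegral_congr_fun measurableSet_Ioi fun σ hσ => ?_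
  have hσ' : 0 < σ := hσ
  have e1 : (ρ ^ 2 / (4 * σ ^ 2)) ^ (-(3 / 2) : ℝ) = 8 * σ ^ 3 / ρ ^ 3 := by
    rw [show ρ ^ 2 / (4 * σ ^ 2) = (ρ / (2 * σ)) ^ 2 by field_simp; norm_num,
      ← Real.rpow_natCast, ← Real.rpow_mul (by positivity)]
    norm_num
    field_simp
    norm_num
  have e2 : ρ ^ 2 / (4 * (ρ ^ 2 / (4 * σ ^ 2))) = σ ^ 2 := by field_simp
  have e3 : Real.sqrt (4 * Real.pi) = 2 * Real.sqrt Real.pi := by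
    rw [Real.sqrt_mul (by norm_num), show (4 : ℝ) = 2 ^ 2 by norm_num,
      Real.sqrt_sq (by norm_num)]
  simp only [smul_eq_mul]
  rw [e1, e2, e3, abs_neg, abs_of_pos (by positivity)]
  have : 0 < Real.sqrt Real.pi := Real.sqrt_pos.2 Real.pi_pos
  field_simp
  norm_num

/-- The kernels vanish at nonpositive times, so the sources after time `t` contribute nothing and
the upper limit of integration may be fixed. -/
theorem intervalIntegral_eq_layer {κ : ℝ × ℝ → ℝ} {b : ℝ} (hκ : ∀ z : ℝ × ℝ, z.2 ≤ 0 → κ z = 0)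
    (hb : 0 ≤ b) (hp : p.2 ≤ b) :
    ∫ s in (0)..p.2, κ (sep K T p s) * q s = layer K T b κ q p := by
  have hz : ∀ s, p.2 ≤ s → κ (sep K T p s) * q s = 0 := fun s hs => by
    rw [hκ _ (by simp only [sep]; linarith), zero_mul]
  rw [layer, intervalIntegral.integral_of_le hb]
  rcases le_total 0 p.2 with h | h
  · rw [intervalIntegral.integral_of_le h]
    refine (setIntegral_eq_of_subset_of_forall_sdiff_eq_zero measurableSet_Ioc
      (Ioc_subset_Ioc_right hp) fun s hs => hz s ?_).symm
    by_contra! hlt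
    exact hs.2 ⟨hs.1.1, hlt.le⟩
  · rw [intervalIntegral.integral_of_ge h, setIntegral_eq_zero_of_forall_eq_zero,
      setIntegral_eq_zero_of_forall_eq_zero, neg_zero]
    · exact fun s hs => hz s (h.trans hs.1.le)
    · exact fun s hs => hz s hs.1.le

/-- With `τ = t - s` and mean drift `m`, the first coordinate of `sep` is `ρ + τ m`. The part of
the dipole kernel coming from `ρ` is singular and becomes a Gaussian in `σ = ρ / (2 √τ)`; the part
coming from `τ m` is only as singular as the heat kernel. -/
theorem dipoleKernel_eq_add {ρ t s : ℝ} (hs : s ≤ t) (hs0 : 0 ≤ s) (ht : t < T) :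
    dipoleKernel (sep K T (ρ, t) s) * q s =
      (Real.sqrt (4 * Real.pi))⁻¹ * (ρ / 2 * ((t - s) ^ (-(3 / 2) : ℝ) *
        Real.exp (-(ρ ^ 2 / (4 * (t - s)))))) * dipoleWeight K T q (ρ, t) (t - s) +
      1 / 2 * (heatKernel (sep K T (ρ, t) s) * (meanDrift K T t s * q s)) := by
  rcases hs.eq_or_lt with rfl | hlt
  · rw [dipoleKernel_of_nonpos (by simp [sep]), heatKernel_of_nonpos (by simp [sep]), sub_self,
      Real.zero_rpow (by norm_num)]
    simp
  have hτ : 0 < t - s := by linarith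
  have hsep := sep_eq (K := K) (p := (ρ, t)) ht (hlt.trans ht)
  simp only at hsep
  rw [hsep, dipoleWeight]
  simp only [sub_sub_cancel, max_eq_left hs0]
  rw [dipoleKernel, heatKernel, gaussPow_of_pos hτ, gaussPow_of_pos hτ]
  simp only
  set τ := t - s
  set m := meanDrift K T t s
  have e1 : τ ^ (-(1 / 2) : ℝ) = τ ^ (-(3 / 2) : ℝ) * τ := by
    rw [← Real.rpow_add_one hτ.ne']; norm_num
  have e2 : Real.exp (-((ρ + τ * m) ^ 2 / (4 * τ))) =
      Real.exp (-(ρ ^ 2 / (4 * τ))) * Real.exp (-(ρ * m / 2 + τ * m ^ 2 / 4)) := by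
    rw [← Real.exp_add]; congr 1; field_simp; ring
  rw [e1, e2]
  ring

/-- Since `q 0 = 0`, the extension of the density to negative times in `dipoleWeight` contributes
nothing. -/
theorem doubleLayer_eq (hq : ContinuousOn q (Ico 0 T)) (hq0 : q 0 = 0) (hp : p ∈ region T)
    (hp1 : 0 < p.1) :
    doubleLayer K T q p = ∫ s in (0)..p.2, dipoleKernel (sep K T p s) * q s := by
  obtain ⟨ρ, t⟩ := p
  have ht0 : 0 ≤ t := hp.2.1
  have htT : t < T := hp.2.2
  simp only at hp1
  have hoff : (ρ, t) ∈ offSource K T t := mem_offSource_of_pos hp1 htT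
  have hq' : ContinuousOn q (Icc 0 t) := hq.mono fun s hs => ⟨hs.1, hs.2.trans_lt htT⟩
  have hm : ContinuousOn (fun s => meanDrift K T t s * q s) (Icc 0 t) :=
    (continuousOn_meanDrift_mul hq).comp (f := fun s => (t, s)) (by fun_prop)
      fun s hs => ⟨hs.1, hs.2, htT⟩
  have hi1 := intervalIntegrable_layer ht0 isHeatKernel_dipoleKernel.smooth.continuousOn hq' hoff
  have hi2 := (intervalIntegrable_layer ht0 isHeatKernel_heatKernel.smooth.continuousOn hm
    hoff).const_mul (1 / 2)
  set A : ℝ → ℝ := fun τ => (Real.sqrt (4 * Real.pi))⁻¹ * (ρ / 2 * (τ ^ (-(3 / 2) : ℝ) *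
        Real.exp (-(ρ ^ 2 / (4 * τ))))) * dipoleWeight K T q (ρ, t) τ with hA
  have hsing : (Real.sqrt Real.pi)⁻¹ * (∫ σ in Ioi (0 : ℝ), Real.exp (-σ ^ 2) *
      dipoleWeight K T q (ρ, t) (ρ ^ 2 / (4 * σ ^ 2))) = ∫ s in (0)..t, A (t - s) := by
    rw [← integral_dipole_change_of_variables hp1, intervalIntegral.integral_comp_sub_left,
      sub_self, sub_zero, intervalIntegral.integral_of_le ht0]
    refine setIntegral_eq_of_subset_of_forall_sdiff_eq_zero measurableSet_Ioi
      (fun τ hτ => hτ.1) fun τ hτ => ?_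
    have : t ≤ τ := by
      by_contra! hlt
      exact hτ.2 ⟨hτ.1, hlt.le⟩
    simp [dipoleWeight, this, hq0]
  rw [doubleLayer, hsing, heatIntegral, ← intervalIntegral.integral_const_mul]
  simp only
  have hsplit : ∀ s ∈ uIcc 0 t, A (t - s) = dipoleKernel (sep K T (ρ, t) s) * q s -
      1 / 2 * (heatKernel (sep K T (ρ, t) s) * (meanDrift K T t s * q s)) := fun s hs => by
    rw [uIcc_of_le ht0] at hs
    rw [dipoleKernel_eq_add hs.2 hs.1 htT]
    ring
  rw [intervalIntegral.integral_congr hsplit, intervalIntegral.integral_sub hi1 hi2]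
  ring

/-- Single layer potential with density `q`. -/
def singleLayer (K T : ℝ) (q : ℝ → ℝ) (p : ℝ × ℝ) : ℝ := heatIntegral K T (fun _ s => q s) p

theorem continuousOn_density (hq : ContinuousOn q (Ico 0 T)) :
    ContinuousOn (fun z : ℝ × ℝ => q z.2) (timeTriangle T) :=
  hq.comp continuousOn_snd fun _ hz => ⟨hz.1, hz.2.1.trans_lt hz.2.2⟩

theorem continuousOn_singleLayer (hq : ContinuousOn q (Ico 0 T)) :
    ContinuousOn (singleLayer K T q) (region T) :=
  continuousOn_heatIntegral (continuousOn_density hq)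

theorem singleLayer_eq_layer {b : ℝ} (hb : 0 ≤ b) (hp : p.2 ≤ b) :
    singleLayer K T q p = layer K T b heatKernel q p :=
  intervalIntegral_eq_layer (fun _ h => heatKernel_of_nonpos h) hb hp

theorem doubleLayer_eq_layer {b : ℝ} (hq : ContinuousOn q (Ico 0 T)) (hq0 : q 0 = 0)
    (hp : p ∈ region T) (hp1 : 0 < p.1) (hpb : p.2 ≤ b) :
    doubleLayer K T q p = layer K T b dipoleKernel q p := by
  rw [doubleLayer_eq hq hq0 hp hp1]
  exact intervalIntegral_eq_layer (fun _ h => dipoleKernel_of_nonpos h) (hp.2.1.trans hpb) hpb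

end Potentials

/-! ### Volterra equations in holomorphic functions -/

section Volterra

variable {R : ℝ} {H : ℂ → ℝ → ℂ}

/-- A parametric integral of functions holomorphic in the parameter is holomorphic. -/
theorem differentiableOn_intervalIntegral {U : Set ℂ} (hU : IsOpen U) {f : ℂ → ℝ → ℂ}
    (hc : ContinuousOn (fun x : ℂ × ℝ => f x.1 x.2) (U ×ˢ Icc 0 1))
    (hd : ∀ σ ∈ Icc (0 : ℝ) 1, DifferentiableOn ℂ (fun z => f z σ) U) :
    DifferentiableOn ℂ (fun z => ∫ σ in (0 : ℝ)..1, f z σ) U := by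
  intro z₀ hz₀
  obtain ⟨ε, hε, hball⟩ := Metric.isOpen_iff.1 hU z₀ hz₀
  have hsub : Metric.closedBall z₀ (ε / 2) ⊆ U := fun z hz => hball
    (lt_of_le_of_lt (Metric.mem_closedBall.1 hz) (by linarith))
  obtain ⟨M, hM⟩ := ((isCompact_closedBall z₀ (ε / 2)).prod
    (isCompact_Icc (a := (0 : ℝ)) (b := 1))).exists_bound_of_continuousOn
    (hc.mono (prod_mono hsub subset_rfl))
  have hslice : ∀ z ∈ U, ContinuousOn (f z) (Icc 0 1) := fun z hz =>
    hc.comp (f := fun σ : ℝ => (z, σ)) (by fun_prop) fun σ hσ => ⟨hz, hσ⟩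
  have hIoc : Set.uIoc (0 : ℝ) 1 ⊆ Icc 0 1 := by
    rw [uIoc_of_le zero_le_one]; exact Ioc_subset_Icc_self
  have hmeas : ∀ z ∈ U, AEStronglyMeasurable (f z) (volume.restrict (Set.uIoc 0 1)) :=
    fun z hz => ((hslice z hz).mono hIoc).aestronglyMeasurable measurableSet_uIoc
  have hderiv : ∀ σ ∈ Icc (0 : ℝ) 1, ∀ z ∈ U,
      HasDerivAt (fun z => f z σ) (deriv (fun z => f z σ) z) z := fun σ hσ z hz =>
    ((hd σ hσ).differentiableAt (hU.mem_nhds hz)).hasDerivAt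
  refine (intervalIntegral.hasDerivAt_integral_of_dominated_loc_of_deriv_le (𝕜 := ℂ)
    (F' := fun z σ => deriv (fun z => f z σ) z) (s := Metric.ball z₀ (ε / 4))
    (bound := fun _ => M / (ε / 4)) (Metric.ball_mem_nhds _ (by positivity)) ?_ ?_ ?_ ?_ ?_
    ?_).2.differentiableAt.differentiableWithinAt
  · filter_upwards [hU.mem_nhds hz₀] with z hz using hmeas z hz
  · exact (hslice z₀ hz₀).intervalIntegrable_of_Icc zero_le_one
  · -- the derivative is measurable as a limit of difference quotients
    set h : ℕ → ℂ := fun n => ((ε / 2 / (n + 1) : ℝ) : ℂ) with hh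
    have hh0 : Tendsto h atTop (𝓝[≠] 0) := by
      refine tendsto_nhdsWithin_iff.2 ⟨?_, Eventually.of_forall fun n => ?_⟩
      · have : Tendsto (fun n : ℕ => ε / 2 / ((n : ℝ) + 1)) atTop (𝓝 0) :=
          tendsto_const_nhds.div_atTop
            (tendsto_atTop_add_const_right _ _ tendsto_natCast_atTop_atTop)
        exact (Complex.continuous_ofReal.tendsto' 0 0 (by simp)).comp this
      · have : (0 : ℝ) < ε / 2 / (n + 1) := by positivity
        simpa [hh] using Complex.ofReal_ne_zero.2 this.ne'
    have hhU : ∀ n, z₀ + h n ∈ U := fun n => hsub (by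
      rw [Metric.mem_closedBall, dist_self_add_left, hh, Complex.norm_real,
        Real.norm_of_nonneg (by positivity)]
      exact div_le_self (by positivity) (by linarith [n.cast_nonneg (α := ℝ)]))
    refine aestronglyMeasurable_of_tendsto_ae atTop
      (f := fun n σ => (h n)⁻¹ • (f (z₀ + h n) σ - f z₀ σ))
      (fun n => ((hmeas _ (hhU n)).sub (hmeas _ hz₀)).const_smul (h n)⁻¹) ?_
    filter_upwards [self_mem_ae_restrict measurableSet_uIoc] with σ hσ
    exact (hasDerivAt_iff_tendsto_slope_zero.1 (hderiv σ (hIoc hσ) z₀ hz₀)).comp hh0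
  · refine Eventually.of_forall fun σ hσ z hz => ?_
    have hz' : Metric.closedBall z (ε / 4) ⊆ Metric.closedBall z₀ (ε / 2) := by
      refine Metric.closedBall_subset_closedBall' ?_
      linarith [Metric.mem_ball.1 hz]
    refine Complex.norm_deriv_le_of_forall_mem_sphere_norm_le (by positivity) ?_ fun w hw => ?_
    · exact ((hd σ (hIoc hσ)).mono (hz'.trans hsub)).diffContOnCl_ball subset_rfl
    · exact hM (w, σ) ⟨hz' (Metric.sphere_subset_closedBall hw), hIoc hσ⟩
  · exact intervalIntegrable_const
  · refine Eventually.of_forall fun σ hσ z hz => hderiv σ (hIoc hσ) z (hsub ?_)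
    exact Metric.ball_subset_closedBall (Metric.ball_subset_ball (by linarith) hz)

/-- The weakly singular Volterra operator, in the variable `z = √t`. -/
def volterra (H : ℂ → ℝ → ℂ) (a : ℂ → ℂ) (z : ℂ) : ℂ :=
  z * ∫ σ in (0 : ℝ)..1, H z σ * a (z * (Real.sqrt (1 - σ ^ 2) : ℝ))

theorem sqrt_one_sub_sq_le_one (σ : ℝ) : Real.sqrt (1 - σ ^ 2) ≤ 1 := by
  rw [Real.sqrt_le_one]
  linarith [sq_nonneg σ]

theorem norm_mul_sqrt_le (z : ℂ) (σ : ℝ) : ‖z * (Real.sqrt (1 - σ ^ 2) : ℝ)‖ ≤ ‖z‖ := by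
  rw [norm_mul, Complex.norm_real, Real.norm_of_nonneg (Real.sqrt_nonneg _)]
  exact mul_le_of_le_one_right (norm_nonneg _) (sqrt_one_sub_sq_le_one σ)

theorem mul_sqrt_mem_ball {z : ℂ} (hz : z ∈ Metric.ball (0 : ℂ) R) (σ : ℝ) :
    z * (Real.sqrt (1 - σ ^ 2) : ℝ) ∈ Metric.ball (0 : ℂ) R := by
  rw [mem_ball_zero_iff] at *
  exact (norm_mul_sqrt_le z σ).trans_lt hz

theorem continuousOn_volterra_integrand
    (hH : ContinuousOn (fun x : ℂ × ℝ => H x.1 x.2) (Metric.ball 0 R ×ˢ Icc 0 1)) {a : ℂ → ℂ}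
    (ha : ContinuousOn a (Metric.ball 0 R)) :
    ContinuousOn (fun x : ℂ × ℝ => H x.1 x.2 * a (x.1 * (Real.sqrt (1 - x.2 ^ 2) : ℝ)))
      (Metric.ball 0 R ×ˢ Icc 0 1) := by
  refine hH.mul (ha.comp ?_ fun x hx => mul_sqrt_mem_ball hx.1 _)
  refine Continuous.continuousOn (continuous_fst.mul (Complex.continuous_ofReal.comp ?_))
  fun_prop

theorem continuousOn_volterra_integrand_slice
    (hH : ContinuousOn (fun x : ℂ × ℝ => H x.1 x.2) (Metric.ball 0 R ×ˢ Icc 0 1)) {a : ℂ → ℂ}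
    (ha : ContinuousOn a (Metric.ball 0 R)) {z : ℂ} (hz : z ∈ Metric.ball (0 : ℂ) R) :
    ContinuousOn (fun σ : ℝ => H z σ * a (z * (Real.sqrt (1 - σ ^ 2) : ℝ))) (Icc 0 1) :=
  (continuousOn_volterra_integrand hH ha).comp (f := fun σ : ℝ => (z, σ)) (by fun_prop)
    fun _ hσ => ⟨hz, hσ⟩

theorem differentiableOn_volterra
    (hH : ContinuousOn (fun x : ℂ × ℝ => H x.1 x.2) (Metric.ball 0 R ×ˢ Icc 0 1))
    (hHd : ∀ σ ∈ Icc (0 : ℝ) 1, DifferentiableOn ℂ (fun z => H z σ) (Metric.ball 0 R))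
    {a : ℂ → ℂ} (ha : DifferentiableOn ℂ a (Metric.ball 0 R)) :
    DifferentiableOn ℂ (volterra H a) (Metric.ball 0 R) := by
  refine differentiableOn_id.mul (differentiableOn_intervalIntegral Metric.isOpen_ball
    (continuousOn_volterra_integrand hH ha.continuousOn) fun σ hσ => ?_)
  exact (hHd σ hσ).mul (ha.comp (differentiableOn_id.mul (differentiableOn_const _))
    fun z hz => mul_sqrt_mem_ball hz _)

/-- Moments governing the decay of the iterates of the Volterra operator. -/
def sqrtMoment (n : ℕ) : ℝ := ∫ σ in (0 : ℝ)..1, Real.sqrt (1 - σ ^ 2) ^ n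

theorem sqrtMoment_nonneg (n : ℕ) : 0 ≤ sqrtMoment n :=
  intervalIntegral.integral_nonneg zero_le_one fun _ _ => pow_nonneg (Real.sqrt_nonneg _) _

theorem tendsto_sqrtMoment : Tendsto sqrtMoment atTop (𝓝 0) := by
  have h := intervalIntegral.tendsto_integral_filter_of_dominated_convergence (μ := volume)
    (a := 0) (b := 1) (l := atTop) (F := fun (n : ℕ) σ => Real.sqrt (1 - σ ^ 2) ^ n)
    (f := fun _ => (0 : ℝ)) (fun _ => 1)
    (Eventually.of_forall fun n => (Continuous.aestronglyMeasurable (by fun_prop)))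
    (Eventually.of_forall fun n => Eventually.of_forall fun σ _ => ?_)
    intervalIntegrable_const (Eventually.of_forall fun σ hσ => ?_)
  · rw [intervalIntegral.integral_zero] at h
    exact h
  · rw [Real.norm_of_nonneg (pow_nonneg (Real.sqrt_nonneg _) _)]
    exact pow_le_one₀ (Real.sqrt_nonneg _) (sqrt_one_sub_sq_le_one σ)
  · rw [uIoc_of_le zero_le_one] at hσ
    refine tendsto_pow_atTop_nhds_zero_of_lt_one (Real.sqrt_nonneg _) ?_
    rw [Real.sqrt_lt' one_pos]
    nlinarith [hσ.1]

/-- Bounds for the iterates: `volterraCoeff C n` is `Cⁿ` times a product of moments. -/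
def volterraCoeff (C : ℝ) : ℕ → ℝ
  | 0 => 1
  | n + 1 => C * sqrtMoment n * volterraCoeff C n

theorem volterraCoeff_nonneg {C : ℝ} (hC : 0 ≤ C) (n : ℕ) : 0 ≤ volterraCoeff C n := by
  induction n with
  | zero => exact zero_le_one
  | succ n ih => exact mul_nonneg (mul_nonneg hC (sqrtMoment_nonneg n)) ih

theorem summable_volterraCoeff {C : ℝ} (r : ℝ) :
    Summable fun n => volterraCoeff C n * r ^ n := by
  refine summable_of_ratio_norm_eventually_le (r := 1 / 2) (by norm_num) ?_
  have h : Tendsto (fun n => |C * r| * sqrtMoment n) atTop (𝓝 0) := by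
    simpa using tendsto_sqrtMoment.const_mul |C * r|
  filter_upwards [h.eventually_lt_const (by norm_num : (0 : ℝ) < 1 / 2)] with n hn
  rw [volterraCoeff, pow_succ, show C * sqrtMoment n * volterraCoeff C n * (r ^ n * r) =
    (C * r * sqrtMoment n) * (volterraCoeff C n * r ^ n) by ring, norm_mul]
  refine mul_le_mul_of_nonneg_right ?_ (norm_nonneg _)
  rw [Real.norm_eq_abs, abs_mul, abs_of_nonneg (sqrtMoment_nonneg n)]
  exact hn.le

theorem norm_volterra_le {a : ℂ → ℂ} {r C A : ℝ} {n : ℕ}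
    (hH : ∀ z ∈ Metric.closedBall (0 : ℂ) r, ∀ σ ∈ Icc (0 : ℝ) 1, ‖H z σ‖ ≤ C)
    (ha : ∀ z ∈ Metric.closedBall (0 : ℂ) r, ‖a z‖ ≤ A * ‖z‖ ^ n)
    {z : ℂ} (hz : z ∈ Metric.closedBall (0 : ℂ) r) :
    ‖volterra H a z‖ ≤ C * sqrtMoment n * A * ‖z‖ ^ (n + 1) := by
  have h1 : ‖∫ σ in (0 : ℝ)..1, H z σ * a (z * (Real.sqrt (1 - σ ^ 2) : ℝ))‖ ≤
      ∫ σ in (0 : ℝ)..1, C * A * ‖z‖ ^ n * Real.sqrt (1 - σ ^ 2) ^ n := by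
    refine intervalIntegral.norm_integral_le_of_norm_le zero_le_one
      (Eventually.of_forall fun σ hσ => ?_) (Continuous.intervalIntegrable (by fun_prop) _ _)
    have h2 := hH z hz σ ⟨hσ.1.le, hσ.2⟩
    have h3 := ha (z * (Real.sqrt (1 - σ ^ 2) : ℝ)) (mem_closedBall_zero_iff.2
      ((norm_mul_sqrt_le z σ).trans (mem_closedBall_zero_iff.1 hz)))
    rw [norm_mul z, Complex.norm_real, Real.norm_of_nonneg (Real.sqrt_nonneg _), mul_pow] at h3
    rw [norm_mul]
    calc _ ≤ C * (A * (‖z‖ ^ n * Real.sqrt (1 - σ ^ 2) ^ n)) :=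
          mul_le_mul h2 h3 (norm_nonneg _) ((norm_nonneg _).trans h2)
      _ = _ := by ring
  rw [intervalIntegral.integral_const_mul] at h1
  rw [volterra, norm_mul]
  calc _ ≤ ‖z‖ * (C * A * ‖z‖ ^ n * sqrtMoment n) := mul_le_mul_of_nonneg_left h1 (norm_nonneg _)
    _ = _ := by ring

/-- Solvability of Volterra equations in holomorphic functions, by Picard iteration. -/
theorem exists_volterra_solution {F : ℂ → ℂ}
    (hH : ContinuousOn (fun x : ℂ × ℝ => H x.1 x.2) (Metric.ball 0 R ×ˢ Icc 0 1))
    (hHd : ∀ σ ∈ Icc (0 : ℝ) 1, DifferentiableOn ℂ (fun z => H z σ) (Metric.ball 0 R))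
    (hF : DifferentiableOn ℂ F (Metric.ball 0 R)) :
    ∃ χ : ℂ → ℂ, DifferentiableOn ℂ χ (Metric.ball 0 R) ∧
      ∀ z ∈ Metric.ball (0 : ℂ) R, χ z = F z + volterra H χ z := by
  set a : ℕ → ℂ → ℂ := fun n => (volterra H)^[n] F with ha
  have ha_succ : ∀ n, a (n + 1) = volterra H (a n) := fun n =>
    Function.iterate_succ_apply' _ _ _
  have had : ∀ n, DifferentiableOn ℂ (a n) (Metric.ball 0 R) := by
    intro n
    induction n with
    | zero => exact hF
    | succ n ih => rw [ha_succ]; exact differentiableOn_volterra hH hHd ih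
  have hbound : ∀ r < R, ∃ C M : ℝ, 0 ≤ C ∧ 0 ≤ M ∧
      (∀ z ∈ Metric.closedBall (0 : ℂ) r, ∀ σ ∈ Icc (0 : ℝ) 1, ‖H z σ‖ ≤ C) ∧
      ∀ n, ∀ z ∈ Metric.closedBall (0 : ℂ) r, ‖a n z‖ ≤ M * (volterraCoeff C n * r ^ n) := by
    intro r hr
    have hsub : Metric.closedBall (0 : ℂ) r ⊆ Metric.ball 0 R :=
      Metric.closedBall_subset_ball hr
    obtain ⟨C, hC⟩ := ((isCompact_closedBall (0 : ℂ) r).prod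
      (isCompact_Icc (a := (0 : ℝ)) (b := 1))).exists_bound_of_continuousOn
      (hH.mono (prod_mono hsub subset_rfl))
    obtain ⟨M, hM⟩ := (isCompact_closedBall (0 : ℂ) r).exists_bound_of_continuousOn
      (hF.continuousOn.mono hsub)
    have hC' : ∀ z ∈ Metric.closedBall (0 : ℂ) r, ∀ σ ∈ Icc (0 : ℝ) 1, ‖H z σ‖ ≤ |C| :=
      fun z hz σ hσ => (hC (z, σ) ⟨hz, hσ⟩).trans (le_abs_self C)
    have hpow : ∀ n, ∀ z ∈ Metric.closedBall (0 : ℂ) r,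
        ‖a n z‖ ≤ |M| * volterraCoeff |C| n * ‖z‖ ^ n := by
      intro n
      induction n with
      | zero =>
        intro z hz
        simpa [volterraCoeff, ha] using (hM z hz).trans (le_abs_self M)
      | succ n ih =>
        intro z hz
        rw [ha_succ]
        refine (norm_volterra_le hC' ih hz).trans (le_of_eq ?_)
        rw [volterraCoeff]; ring
    refine ⟨|C|, |M|, abs_nonneg C, abs_nonneg M, hC', fun n z hz => (hpow n z hz).trans ?_⟩
    rw [← mul_assoc]
    refine mul_le_mul_of_nonneg_left ?_ (mul_nonneg (abs_nonneg M)
      (volterraCoeff_nonneg (abs_nonneg C) n))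
    exact pow_le_pow_left₀ (norm_nonneg _) (mem_closedBall_zero_iff.1 hz) n
  have hχd : DifferentiableOn ℂ (fun z => ∑' n, a n z) (Metric.ball 0 R) := by
    intro z hz
    obtain ⟨r, hr1, hr2⟩ := exists_between (mem_ball_zero_iff.1 hz)
    obtain ⟨C, M, hC, hM, -, hle⟩ := hbound r hr2
    have := Complex.differentiableOn_tsum_of_summable_norm
      ((summable_volterraCoeff (C := C) r).mul_left M) (F := a) (U := Metric.ball 0 r)
      (fun n => (had n).mono (Metric.ball_subset_ball hr2.le)) Metric.isOpen_ball
      fun n w hw => hle n w (Metric.ball_subset_closedBall hw)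
    exact (this.differentiableAt (Metric.isOpen_ball.mem_nhds
      (mem_ball_zero_iff.2 hr1))).differentiableWithinAt
  refine ⟨fun z => ∑' n, a n z, hχd, fun z hz => ?_⟩
  obtain ⟨r, hr1, hr2⟩ := exists_between (mem_ball_zero_iff.1 hz)
  obtain ⟨C, M, hC, hM, hHC, hle⟩ := hbound r hr2
  have hsum := (summable_volterraCoeff (C := C) r).mul_left M
  have hzr : z ∈ Metric.closedBall (0 : ℂ) r := mem_closedBall_zero_iff.2 hr1.le
  have hsa : ∀ w ∈ Metric.closedBall (0 : ℂ) r, Summable fun n => a n w := fun w hw =>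
    Summable.of_norm_bounded hsum fun n => hle n w hw
  have hmem : ∀ σ : ℝ, z * (Real.sqrt (1 - σ ^ 2) : ℝ) ∈ Metric.closedBall (0 : ℂ) r := fun σ =>
    mem_closedBall_zero_iff.2 ((norm_mul_sqrt_le z σ).trans hr1.le)
  have hIoc : Set.uIoc (0 : ℝ) 1 ⊆ Icc 0 1 := by
    rw [uIoc_of_le zero_le_one]; exact Ioc_subset_Icc_self
  have hint := intervalIntegral.hasSum_integral_of_dominated_convergence (μ := volume)
    (a := 0) (b := 1) (F := fun n σ => H z σ * a n (z * (Real.sqrt (1 - σ ^ 2) : ℝ)))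
    (f := fun σ => H z σ * ∑' n, a n (z * (Real.sqrt (1 - σ ^ 2) : ℝ)))
    (fun n _ => C * (M * (volterraCoeff C n * r ^ n)))
    (fun n => ((continuousOn_volterra_integrand_slice hH (had n).continuousOn hz).mono
      hIoc).aestronglyMeasurable measurableSet_uIoc)
    (fun n => Eventually.of_forall fun σ hσ => by
      rw [norm_mul]
      exact mul_le_mul (hHC z hzr σ (hIoc hσ)) (hle n _ (hmem σ)) (norm_nonneg _) hC)
    (Eventually.of_forall fun σ _ => hsum.mul_left C) intervalIntegrable_const
    (Eventually.of_forall fun σ _ => (hsa _ (hmem σ)).hasSum.mul_left _)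
  have hshift : HasSum (fun n => a (n + 1) z)
      (volterra H (fun z => ∑' n, a n z) z) := by
    simp_rw [ha_succ]
    exact hint.mul_left z
  change ∑' n, a n z = _
  rw [(hsa z hzr).tsum_eq_zero_add, hshift.tsum_eq]
  rfl

end Volterra

/-! ### The density of the double layer potential -/

/-- The principal branch of the complex square root, with positive real part on the slit plane. -/
def csqrt (w : ℂ) : ℂ := Complex.exp (Complex.log w / 2)

theorem csqrt_ofReal {x : ℝ} (hx : 0 < x) : csqrt x = (Real.sqrt x : ℝ) := by
  rw [csqrt, ← Complex.ofReal_log hx.le, Real.sqrt_eq_rpow, Real.rpow_def_of_pos hx]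
  push_cast
  ring_nf

theorem csqrt_re_pos {w : ℂ} (hw : w ∈ Complex.slitPlane) : 0 < (csqrt w).re := by
  rw [csqrt, Complex.exp_re]
  refine mul_pos (Real.exp_pos _) (Real.cos_pos_of_mem_Ioo ?_)
  have h1 := Complex.neg_pi_lt_arg w
  have h2 := lt_of_le_of_ne (Complex.arg_le_pi w) (Complex.mem_slitPlane_iff_arg.1 hw).1
  have e : (Complex.log w / 2).im = Complex.arg w / 2 := by simp [Complex.log_im]
  rw [e]
  constructor <;> linarith

theorem differentiableAt_csqrt {w : ℂ} (hw : w ∈ Complex.slitPlane) :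
    DifferentiableAt ℂ csqrt w :=
  ((Complex.differentiableAt_log hw).div_const 2).cexp

/-- The mean drift between the times `z² (1 - σ²)` and `z²`, for complex `z`. -/
def complexMeanDrift (K T : ℝ) (z : ℂ) (σ : ℝ) : ℂ :=
  2 * K / (csqrt (T - z ^ 2 * (1 - σ ^ 2 : ℝ)) + csqrt (T - z ^ 2))

theorem sub_sq_mul_mem_slitPlane {T c : ℝ} {z : ℂ} (hz : z ∈ Metric.ball (0 : ℂ) (Real.sqrt T))
    (hc : c ∈ Icc (0 : ℝ) 1) : (T : ℂ) - z ^ 2 * c ∈ Complex.slitPlane := by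
  refine Or.inl ?_
  have h1 : ‖z‖ < Real.sqrt T := mem_ball_zero_iff.1 hz
  have h2 : ‖z‖ ^ 2 < T := (Real.lt_sqrt (norm_nonneg z)).1 h1
  have h3 : (z ^ 2 * c).re ≤ ‖z‖ ^ 2 := by
    refine (Complex.re_le_norm _).trans ?_
    rw [norm_mul, norm_pow, Complex.norm_real, Real.norm_of_nonneg hc.1]
    exact mul_le_of_le_one_right (by positivity) hc.2
  rw [Complex.sub_re, Complex.ofReal_re]
  linarith

theorem sub_sq_mem_slitPlane {T : ℝ} {z : ℂ} (hz : z ∈ Metric.ball (0 : ℂ) (Real.sqrt T)) :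
    (T : ℂ) - z ^ 2 ∈ Complex.slitPlane := by
  simpa using sub_sq_mul_mem_slitPlane hz (c := 1) ⟨zero_le_one, le_rfl⟩

theorem one_sub_sq_mem {σ : ℝ} (hσ : σ ∈ Icc (0 : ℝ) 1) : 1 - σ ^ 2 ∈ Icc (0 : ℝ) 1 :=
  ⟨by nlinarith [hσ.1, hσ.2], by nlinarith [hσ.1]⟩

theorem csqrt_add_ne_zero {w w' : ℂ} (hw : w ∈ Complex.slitPlane) (hw' : w' ∈ Complex.slitPlane) :
    csqrt w + csqrt w' ≠ 0 := by
  intro h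
  have := congrArg Complex.re h
  rw [Complex.add_re, Complex.zero_re] at this
  linarith [csqrt_re_pos hw, csqrt_re_pos hw']

theorem continuousOn_complexMeanDrift (K T : ℝ) :
    ContinuousOn (fun x : ℂ × ℝ => complexMeanDrift K T x.1 x.2)
      (Metric.ball 0 (Real.sqrt T) ×ˢ Icc 0 1) := by
  intro x hx
  have h1 := sub_sq_mul_mem_slitPlane hx.1 (one_sub_sq_mem hx.2)
  have h2 := sub_sq_mem_slitPlane hx.1
  refine ContinuousAt.continuousWithinAt (continuousAt_const.div (ContinuousAt.add ?_ ?_)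
    (csqrt_add_ne_zero h1 h2))
  · refine ContinuousAt.comp (g := csqrt)
      (f := fun x : ℂ × ℝ => (T : ℂ) - x.1 ^ 2 * (1 - x.2 ^ 2 : ℝ))
      (differentiableAt_csqrt h1).continuousAt (Continuous.continuousAt ?_)
    exact continuous_const.sub ((continuous_fst.pow 2).mul
      (Complex.continuous_ofReal.comp (by fun_prop)))
  · exact ContinuousAt.comp (g := csqrt) (f := fun x : ℂ × ℝ => (T : ℂ) - x.1 ^ 2)
      (differentiableAt_csqrt h2).continuousAt (by fun_prop)

theorem differentiableOn_complexMeanDrift (K T : ℝ) {σ : ℝ} (hσ : σ ∈ Icc (0 : ℝ) 1) :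
    DifferentiableOn ℂ (fun z => complexMeanDrift K T z σ) (Metric.ball 0 (Real.sqrt T)) := by
  intro z hz
  have h1 := sub_sq_mul_mem_slitPlane hz (one_sub_sq_mem hσ)
  have h2 := sub_sq_mem_slitPlane hz
  refine DifferentiableAt.differentiableWithinAt ((differentiableAt_const _).div
    (DifferentiableAt.add ?_ ?_) (csqrt_add_ne_zero h1 h2))
  · exact DifferentiableAt.comp z (g := csqrt)
      (f := fun z : ℂ => (T : ℂ) - z ^ 2 * (1 - σ ^ 2 : ℝ)) (differentiableAt_csqrt h1)
      (by fun_prop)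
  · exact DifferentiableAt.comp z (g := csqrt) (f := fun z : ℂ => (T : ℂ) - z ^ 2)
      (differentiableAt_csqrt h2) (by fun_prop)

theorem complexMeanDrift_ofReal (K : ℝ) {T r σ : ℝ} (hr : 0 ≤ r) (hrT : r < Real.sqrt T)
    (hσ : σ ∈ Icc (0 : ℝ) 1) :
    complexMeanDrift K T r σ = (meanDrift K T (r ^ 2) (r ^ 2 * (1 - σ ^ 2)) : ℝ) := by
  have h1 : r ^ 2 < T := (Real.lt_sqrt hr).1 hrT
  have h2 := one_sub_sq_mem hσ
  have h3 : r ^ 2 * (1 - σ ^ 2) ≤ r ^ 2 := mul_le_of_le_one_right (sq_nonneg r) h2.2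
  have e1 := csqrt_ofReal (show 0 < T - r ^ 2 * (1 - σ ^ 2) by linarith)
  have e2 := csqrt_ofReal (show 0 < T - r ^ 2 by linarith)
  rw [complexMeanDrift, meanDrift]
  push_cast at e1 e2 ⊢
  rw [e1, e2]

/-- Real weight of the boundary integral equation in the variables `r = √t`, `s = t (1 - σ²)`. -/
def boundaryWeight (K T r σ : ℝ) : ℝ :=
  -(Real.sqrt Real.pi)⁻¹ * (meanDrift K T (r ^ 2) (r ^ 2 * (1 - σ ^ 2)) *
    Real.exp (-(r ^ 2 * σ ^ 2 * meanDrift K T (r ^ 2) (r ^ 2 * (1 - σ ^ 2)) ^ 2 / 4)))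

/-- The boundary integral equation has a smooth solution in the variable `r = √t`. -/
theorem exists_sqrt_density (K T : ℝ) :
    ∃ X : ℝ → ℝ, ContDiffOn ℝ ∞ X (Ioo (-Real.sqrt T) (Real.sqrt T)) ∧
      ∀ r, 0 ≤ r → r < Real.sqrt T → X r = -2 * meanDrift K T (r ^ 2) 0 +
        r * ∫ σ in (0 : ℝ)..1, boundaryWeight K T r σ * (1 - σ ^ 2) *
          X (r * Real.sqrt (1 - σ ^ 2)) := by
  set H : ℂ → ℝ → ℂ := fun z σ => -((Real.sqrt Real.pi)⁻¹ : ℝ) * (complexMeanDrift K T z σ *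
    Complex.exp (-(z ^ 2 * (σ : ℂ) ^ 2 * complexMeanDrift K T z σ ^ 2 / 4))) *
      (1 - σ ^ 2 : ℝ) with hH
  have hm := continuousOn_complexMeanDrift K T
  have hHc : ContinuousOn (fun x : ℂ × ℝ => H x.1 x.2)
      (Metric.ball 0 (Real.sqrt T) ×ˢ Icc 0 1) := by
    refine (continuousOn_const.mul (hm.mul (ContinuousOn.cexp ?_))).mul
      (Complex.continuous_ofReal.comp (by fun_prop)).continuousOn
    refine ContinuousOn.neg (ContinuousOn.div_const (ContinuousOn.mul ?_ (hm.pow 2)) 4)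
    exact Continuous.continuousOn (by fun_prop)
  have hHd : ∀ σ ∈ Icc (0 : ℝ) 1,
      DifferentiableOn ℂ (fun z => H z σ) (Metric.ball 0 (Real.sqrt T)) := by
    intro σ hσ
    have hd := differentiableOn_complexMeanDrift K T hσ
    refine ((differentiableOn_const _).mul (hd.mul (DifferentiableOn.cexp ?_))).mul
      (differentiableOn_const _)
    refine DifferentiableOn.neg (DifferentiableOn.div_const (DifferentiableOn.mul ?_ (hd.pow 2)) 4)
    exact Differentiable.differentiableOn (by fun_prop)
  obtain ⟨χ, hχ, hχe⟩ := exists_volterra_solution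
    (F := fun z => -2 * complexMeanDrift K T z 1) hHc hHd ((differentiableOn_const _).mul
      (differentiableOn_complexMeanDrift K T ⟨zero_le_one, le_rfl⟩))
  have hreal : ∀ r : ℝ, r ∈ Ioo (-Real.sqrt T) (Real.sqrt T) →
      (r : ℂ) ∈ Metric.ball (0 : ℂ) (Real.sqrt T) := fun r hr => by
    rw [mem_ball_zero_iff, Complex.norm_real, Real.norm_eq_abs]
    exact abs_lt.2 hr
  refine ⟨fun r => (χ r).re, ?_, fun r hr hrT => ?_⟩
  · have h1 : ContDiffOn ℝ ∞ χ (Metric.ball 0 (Real.sqrt T)) :=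
      (hχ.contDiffOn Metric.isOpen_ball).restrict_scalars ℝ
    have h2 : ContDiffOn ℝ ∞ (fun r : ℝ => χ r) (Ioo (-Real.sqrt T) (Real.sqrt T)) :=
      h1.comp Complex.ofRealCLM.contDiff.contDiffOn hreal
    exact Complex.reCLM.contDiff.comp_contDiffOn h2
  · have hrb := hreal r ⟨by linarith [(Real.sqrt_nonneg T)], hrT⟩
    have he := congrArg Complex.re (hχe r hrb)
    have hF : complexMeanDrift K T r 1 = (meanDrift K T (r ^ 2) 0 : ℝ) := by
      have := complexMeanDrift_ofReal K hr hrT (σ := 1) ⟨zero_le_one, le_rfl⟩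
      simpa using this
    have hint : IntervalIntegrable
        (fun σ : ℝ => H r σ * χ (r * (Real.sqrt (1 - σ ^ 2) : ℝ))) volume 0 1 := by
      exact (continuousOn_volterra_integrand_slice (R := Real.sqrt T) hHc hχ.continuousOn
        hrb).intervalIntegrable_of_Icc zero_le_one
    simp only
    rw [he, Complex.add_re, hF, volterra, Complex.re_ofReal_mul]
    congr 1
    · simp
    · congr 1
      have h3 := Complex.reCLM.intervalIntegral_comp_comm hint
      simp only [Complex.reCLM_apply] at h3
      rw [← h3]
      refine intervalIntegral.integral_congr fun σ hσ => ?_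
      rw [uIcc_of_le zero_le_one] at hσ
      have e : H r σ = ((boundaryWeight K T r σ * (1 - σ ^ 2) : ℝ) : ℂ) := by
        simp only [hH, complexMeanDrift_ofReal K hr hrT hσ, boundaryWeight]
        push_cast
        ring
      rw [e, Complex.re_ofReal_mul]
      push_cast
      rfl

/-- The boundary values of a single layer potential in the variable `σ = √(1 - s / t)`. -/
theorem heatIntegral_boundary {K T t : ℝ} (c : ℝ → ℝ → ℝ) (ht : 0 < t) (htT : t < T) :
    heatIntegral K T c (0, t) = Real.sqrt t * ∫ σ in (0 : ℝ)..1, (Real.sqrt Real.pi)⁻¹ *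
      Real.exp (-(t * σ ^ 2 * meanDrift K T t (t * (1 - σ ^ 2)) ^ 2 / 4)) *
        c t (t * (1 - σ ^ 2)) := by
  have himg : (fun σ : ℝ => t * (1 - σ ^ 2)) '' Ioo 0 1 = Ioo 0 t := by
    ext s
    constructor
    · rintro ⟨σ, hσ, rfl⟩
      have h1 : 0 < 1 - σ ^ 2 := by nlinarith [hσ.1, hσ.2]
      exact ⟨mul_pos ht h1, by nlinarith [mul_pos ht (pow_pos hσ.1 2)]⟩
    · intro hs
      have h1 : 0 < 1 - s / t := sub_pos.2 ((div_lt_one ht).2 hs.2)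
      refine ⟨Real.sqrt (1 - s / t), ⟨Real.sqrt_pos.2 h1, ?_⟩, ?_⟩
      · rw [Real.sqrt_lt' one_pos]
        linarith [div_pos hs.1 ht]
      · simp only
        rw [Real.sq_sqrt h1.le]
        field_simp
        ring
  have hinj : InjOn (fun σ : ℝ => t * (1 - σ ^ 2)) (Ioo 0 1) := by
    intro a ha b hb hab
    have h1 : 1 - a ^ 2 = 1 - b ^ 2 := mul_left_cancel₀ ht.ne' hab
    exact (pow_left_inj₀ ha.1.le hb.1.le two_ne_zero).1 (by linarith)
  have hderiv : ∀ σ ∈ Ioo (0 : ℝ) 1, HasDerivWithinAt (fun σ : ℝ => t * (1 - σ ^ 2))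
      (-(2 * t * σ)) (Ioo 0 1) σ := by
    intro σ hσ
    have h1 : HasDerivAt (fun σ : ℝ => 1 - σ ^ 2) (-(2 * σ)) σ := by
      simpa using ((hasDerivAt_id σ).pow 2).const_sub 1
    exact ((h1.const_mul t).congr_deriv (by ring)).hasDerivWithinAt
  have h := integral_image_eq_integral_abs_deriv_smul measurableSet_Ioo hderiv hinj
    (fun s => heatKernel (sep K T (0, t) s) * c t s)
  rw [himg] at h
  rw [heatIntegral, intervalIntegral.integral_of_le ht.le, integral_Ioc_eq_integral_Ioo, h,
    intervalIntegral.integral_of_le zero_le_one, integral_Ioc_eq_integral_Ioo,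
    ← integral_const_mul]
  refine setIntegral_congr_fun measurableSet_Ioo fun σ hσ => ?_
  have hσ2 : 0 < σ ^ 2 := pow_pos hσ.1 2
  have hlt : t * (1 - σ ^ 2) < T := by nlinarith [mul_pos ht hσ2]
  have hsep := sep_eq (K := K) (p := (0, t)) htT hlt
  simp only at hsep
  simp only [smul_eq_mul]
  set m := meanDrift K T t (t * (1 - σ ^ 2))
  have e0 : t - t * (1 - σ ^ 2) = t * σ ^ 2 := by ring
  rw [hsep, e0, heatKernel, gaussPow_of_pos (by positivity), abs_neg,
    abs_of_pos (by have := hσ.1; positivity)]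
  have hst : 0 < Real.sqrt t := Real.sqrt_pos.2 ht
  have hss : Real.sqrt t * Real.sqrt t = t := Real.mul_self_sqrt ht.le
  have e1 : (t * σ ^ 2) ^ (-(1 / 2) : ℝ) = (Real.sqrt t * σ)⁻¹ := by
    rw [Real.rpow_neg (by positivity), ← Real.sqrt_eq_rpow, Real.sqrt_mul ht.le,
      Real.sqrt_sq hσ.1.le]
  have e2 : (0 + t * σ ^ 2 * m) ^ 2 / (4 * (t * σ ^ 2)) = t * σ ^ 2 * m ^ 2 / 4 := by
    have := hσ.1
    field_simp
    ring
  have e3 : Real.sqrt (4 * Real.pi) = 2 * Real.sqrt Real.pi := by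
    rw [Real.sqrt_mul (by norm_num), show (4 : ℝ) = 2 ^ 2 by norm_num,
      Real.sqrt_sq (by norm_num)]
  rw [e1, e2, e3]
  have e4 : 2 * t * σ * ((2 * Real.sqrt Real.pi)⁻¹ * (Real.sqrt t * σ)⁻¹) =
      Real.sqrt t * (Real.sqrt Real.pi)⁻¹ := by
    have hp : 0 < Real.sqrt Real.pi := Real.sqrt_pos.2 Real.pi_pos
    have := hσ.1
    field_simp
    nlinarith
  linear_combination (Real.exp (-(t * σ ^ 2 * m ^ 2 / 4)) * c t (t * (1 - σ ^ 2))) * e4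

/-- The density that makes the double layer potential equal to `-shift K T t` on the boundary. It
has the form `φ t = t * X (√t)` with `X` smooth: the factor `t` gives `φ 0 = 0` and a derivative
that is continuous up to `t = 0`. -/
theorem exists_density {K T : ℝ} (hT : 0 < T) :
    ∃ φ φ' : ℝ → ℝ, ContinuousOn φ (Ico 0 T) ∧ ContinuousOn φ' (Ico 0 T) ∧ φ 0 = 0 ∧
      (∀ t ∈ Ioo 0 T, HasDerivAt φ (φ' t) t) ∧ ContDiffOn ℝ ∞ φ (Ioo 0 T) ∧
      ∀ t ∈ Ico 0 T, φ t + heatIntegral K T (fun t s => meanDrift K T t s * φ s) (0, t) =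
        -2 * shift K T t := by
  obtain ⟨X, hX, hXe⟩ := exists_sqrt_density K T
  have hopen : IsOpen (Ioo (-Real.sqrt T) (Real.sqrt T)) := isOpen_Ioo
  have hX' : ContDiffOn ℝ ∞ (deriv X) (Ioo (-Real.sqrt T) (Real.sqrt T)) :=
    hX.deriv_of_isOpen hopen (by simp)
  have hmaps : MapsTo Real.sqrt (Ico 0 T) (Ioo (-Real.sqrt T) (Real.sqrt T)) := fun t ht =>
    ⟨by linarith [Real.sqrt_pos.2 hT, Real.sqrt_nonneg t], Real.sqrt_lt_sqrt ht.1 ht.2⟩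
  have hsc : ContinuousOn Real.sqrt (Ico 0 T) := Real.continuous_sqrt.continuousOn
  refine ⟨fun t => t * X (Real.sqrt t),
    fun t => X (Real.sqrt t) + 1 / 2 * Real.sqrt t * deriv X (Real.sqrt t), ?_, ?_, ?_, ?_, ?_, ?_⟩
  · exact continuousOn_id.mul (hX.continuousOn.comp hsc hmaps)
  · exact (hX.continuousOn.comp hsc hmaps).add ((continuousOn_const.mul hsc).mul
      (hX'.continuousOn.comp hsc hmaps))
  · simp
  · intro t ht
    have hs : 0 < Real.sqrt t := Real.sqrt_pos.2 ht.1
    have h1 : HasDerivAt X (deriv X (Real.sqrt t)) (Real.sqrt t) :=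
      ((hX.contDiffAt (hopen.mem_nhds (hmaps ⟨ht.1.le, ht.2⟩))).differentiableAt
        (by simp)).hasDerivAt
    refine ((hasDerivAt_id t).mul (h1.comp t (Real.hasDerivAt_sqrt ht.1.ne'))).congr_deriv ?_
    have hss : Real.sqrt t * Real.sqrt t = t := Real.mul_self_sqrt ht.1.le
    simp only [id, Function.comp_apply, one_mul]
    congr 1
    field_simp
    linear_combination (-deriv X (Real.sqrt t)) * hss
  · refine contDiffOn_id.mul (hX.comp (fun t ht => ?_) fun t ht => hmaps ⟨ht.1.le, ht.2⟩)
    exact (Real.contDiffAt_sqrt ht.1.ne').contDiffWithinAt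
  · intro t ht
    rcases ht.1.eq_or_lt with rfl | ht0
    · simp [heatIntegral, shift_zero]
    have hss : Real.sqrt t ^ 2 = t := Real.sq_sqrt ht0.le
    have he := hXe (Real.sqrt t) (Real.sqrt_nonneg t) (Real.sqrt_lt_sqrt ht.1 ht.2)
    rw [heatIntegral_boundary _ ht0 ht.2]
    have hsh : shift K T t = t * meanDrift K T t 0 := by
      have := shift_sub_shift (K := K) ht.2 hT
      rwa [shift_zero, sub_zero, sub_zero] at this
    have hI : ∫ σ in (0 : ℝ)..1, (Real.sqrt Real.pi)⁻¹ *
        Real.exp (-(t * σ ^ 2 * meanDrift K T t (t * (1 - σ ^ 2)) ^ 2 / 4)) *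
          (meanDrift K T t (t * (1 - σ ^ 2)) *
            (t * (1 - σ ^ 2) * X (Real.sqrt (t * (1 - σ ^ 2))))) =
        -t * ∫ σ in (0 : ℝ)..1, boundaryWeight K T (Real.sqrt t) σ * (1 - σ ^ 2) *
          X (Real.sqrt t * Real.sqrt (1 - σ ^ 2)) := by
      rw [← intervalIntegral.integral_const_mul]
      refine intervalIntegral.integral_congr fun σ _ => ?_
      simp only [boundaryWeight, hss]
      rw [Real.sqrt_mul ht0.le]
      ring
    simp only
    rw [hI, he, hss, hsh]
    ring

/-! ### Smoothness of the potentials up to the boundary -/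

section BoundaryRegularity

variable {K T b : ℝ} {κ : ℝ × ℝ → ℝ} {q q' : ℝ → ℝ} {p : ℝ × ℝ}

theorem layer_congr {κ' : ℝ × ℝ → ℝ} (hb : 0 ≤ b) (h : ∀ z ≠ 0, κ z = κ' z)
    (hp : p ∈ offSource K T b) : layer K T b κ q p = layer K T b κ' q p :=
  intervalIntegral.integral_congr fun s hs => by
    rw [uIcc_of_le hb] at hs
    simp only [h _ (hp.2 s hs)]

theorem layer_neg : layer K T b (fun z => -κ z) q p = -layer K T b κ q p := by
  simp only [layer, neg_mul, intervalIntegral.integral_neg]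

theorem continuousOn_drift (K T : ℝ) : ContinuousOn (drift K T) (Iio T) := fun _ ht =>
  (contDiffAt_drift 0 ht).continuousAt.continuousWithinAt

theorem continuousOn_drift_mul (hq : ContinuousOn q (Ico 0 T)) :
    ContinuousOn (fun s => drift K T s * q s) (Ico 0 T) :=
  ((continuousOn_drift K T).mono fun _ hs => hs.2).mul hq

theorem layer_dx_heatKernel (hb : 0 ≤ b) (hp : p ∈ offSource K T b) :
    layer K T b (dx heatKernel) q p = -layer K T b dipoleKernel q p := by
  rw [← layer_neg]
  exact layer_congr hb (fun z hz => dx_heatKernel hz) hp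

/-- The time derivative of the heat kernel is moved onto the density. -/
theorem layer_dt_heatKernel (hq : ContinuousOn q (Ico 0 T)) (hq' : ContinuousOn q' (Ico 0 T))
    (hd : ∀ s ∈ Ioo 0 T, HasDerivAt q (q' s) s) (h0 : q 0 = 0) (hp : p ∈ region T)
    (hp1 : 0 < p.1) (hpb : p.2 < b) (hbT : b < T) :
    layer K T b (dt heatKernel) q p =
      singleLayer K T q' p + doubleLayer K T (fun s => drift K T s * q s) p := by
  have hb : 0 < b := hp.2.1.trans_lt hpb
  have hsub : Icc 0 b ⊆ Ico 0 T := fun s hs => ⟨hs.1, hs.2.trans_lt hbT⟩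
  have hoff : p ∈ offSource K T b := mem_offSource_of_pos hp1 hp.2.2
  rw [layer_dt hb hbT isHeatKernel_heatKernel.smooth (hq.mono hsub) (hq'.mono hsub)
    (fun s hs => hd s ⟨hs.1, hs.2.trans hbT⟩) h0 hoff
    (heatKernel_of_nonpos (by simp only [sep]; linarith)), layer_dx_heatKernel hb.le hoff,
    singleLayer_eq_layer hb.le hpb.le,
    doubleLayer_eq_layer (continuousOn_drift_mul hq) (by simp [h0]) hp hp1 hpb.le]
  ring

/-- The first space derivative of the double layer potential, expressed by potentials that are
continuous up to the boundary. -/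
theorem layer_dx_dipoleKernel (hq : ContinuousOn q (Ico 0 T)) (hq' : ContinuousOn q' (Ico 0 T))
    (hd : ∀ s ∈ Ioo 0 T, HasDerivAt q (q' s) s) (h0 : q 0 = 0) (hp : p ∈ region T)
    (hp1 : 0 < p.1) (hpb : p.2 < b) (hbT : b < T) :
    layer K T b (dx dipoleKernel) q p =
      -(singleLayer K T q' p + doubleLayer K T (fun s => drift K T s * q s) p) := by
  rw [← layer_dt_heatKernel hq hq' hd h0 hp hp1 hpb hbT, ← layer_neg]
  exact layer_congr (hp.2.1.trans hpb.le) (fun z hz => dx_dipoleKernel hz)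
    (mem_offSource_of_pos hp1 hp.2.2)

/-- Smooth densities on `(-∞, T)` that vanish up to some positive time. They are closed under
differentiation and under multiplication by the drift. -/
structure IsCutoffDensity (T : ℝ) (q : ℝ → ℝ) : Prop where
  smooth : ContDiffOn ℝ ∞ q (Iio T)
  vanish : ∃ δ > 0, ∀ s ≤ δ, q s = 0

namespace IsCutoffDensity

theorem continuousOn (h : IsCutoffDensity T q) : ContinuousOn q (Ico 0 T) :=
  h.smooth.continuousOn.mono fun _ hs => hs.2

theorem zero (h : IsCutoffDensity T q) : q 0 = 0 := by
  obtain ⟨δ, hδ, hz⟩ := h.vanish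
  exact hz 0 hδ.le

theorem drift_mul (h : IsCutoffDensity T q) (K : ℝ) :
    IsCutoffDensity T (fun s => drift K T s * q s) where
  smooth := ContDiffOn.mul (fun _ ht => (contDiffAt_drift ∞ ht).contDiffWithinAt) h.smooth
  vanish := by
    obtain ⟨δ, hδ, hz⟩ := h.vanish
    exact ⟨δ, hδ, fun s hs => by rw [hz s hs, mul_zero]⟩

theorem deriv (h : IsCutoffDensity T q) : IsCutoffDensity T (deriv q) where
  smooth := h.smooth.deriv_of_isOpen isOpen_Iio (by simp)
  vanish := by
    obtain ⟨δ, hδ, hz⟩ := h.vanish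
    refine ⟨δ / 2, by linarith, fun s hs => ?_⟩
    have : q =ᶠ[𝓝 s] fun _ => 0 := by
      filter_upwards [Iio_mem_nhds (show s < δ by linarith)] with x hx using hz x (le_of_lt hx)
    rw [this.deriv_eq, deriv_const]

theorem hasDerivAt (h : IsCutoffDensity T q) : ∀ s ∈ Ioo 0 T, HasDerivAt q (_root_.deriv q s) s :=
  fun _ hs => ((h.smooth.contDiffAt (Iio_mem_nhds hs.2)).differentiableAt (by simp)).hasDerivAt

end IsCutoffDensity

theorem eventually_mem_interior (hp1 : 0 < p.1) (hp2 : p.2 ∈ Ioo 0 T) (hpb : p.2 < b) :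
    ∀ᶠ w in 𝓝 p, 0 < w.1 ∧ w ∈ region T ∧ w.2 < b := by
  filter_upwards [continuousAt_const.eventually_lt continuous_fst.continuousAt hp1,
    continuousAt_const.eventually_lt continuous_snd.continuousAt hp2.1,
    continuous_snd.continuousAt.eventually_lt continuousAt_const hp2.2,
    continuous_snd.continuousAt.eventually_lt continuousAt_const hpb] with w h1 h2 h3 h4
  exact ⟨h1, ⟨mem_Ici.2 (le_of_lt h1), le_of_lt h2, h3⟩, h4⟩

/-- The derivatives of a single layer potential are combinations of layer potentials. -/
theorem hasFDerivAt_singleLayer (h : IsCutoffDensity T q) (hp1 : 0 < p.1)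
    (hp2 : p.2 ∈ Ioo 0 T) :
    HasFDerivAt (singleLayer K T q)
      ((-doubleLayer K T q p) • ContinuousLinearMap.fst ℝ ℝ ℝ +
        (-(drift K T p.2 * doubleLayer K T q p) + (singleLayer K T (deriv q) p +
          doubleLayer K T (fun s => drift K T s * q s) p)) •
            ContinuousLinearMap.snd ℝ ℝ ℝ) p := by
  obtain ⟨b, hpb, hbT⟩ := exists_between hp2.2
  have hb : 0 ≤ b := hp2.1.le.trans hpb.le
  have hp : p ∈ region T := ⟨mem_Ici.2 hp1.le, hp2.1.le, hp2.2⟩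
  have hoff : p ∈ offSource K T b := mem_offSource_of_pos hp1 hp2.2
  have hq : ContinuousOn q (Icc 0 b) := h.continuousOn.mono fun s hs => ⟨hs.1, hs.2.trans_lt hbT⟩
  have hev : singleLayer K T q =ᶠ[𝓝 p] layer K T b heatKernel q := by
    filter_upwards [eventually_mem_interior hp1 hp2 hpb] with w hw
    exact singleLayer_eq_layer hb hw.2.2.le
  refine ((hasFDerivAt_layer hb isHeatKernel_heatKernel.smooth hq hoff).congr_of_eventuallyEq
    hev).congr_fderiv ?_
  rw [layer_dx_heatKernel hb hoff, layer_dt_heatKernel h.continuousOn h.deriv.continuousOn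
    h.hasDerivAt h.zero hp hp1 hpb hbT, doubleLayer_eq_layer h.continuousOn h.zero hp hp1 hpb.le,
    mul_neg]

/-- The derivatives of a double layer potential are combinations of layer potentials. -/
theorem hasFDerivAt_doubleLayer (h : IsCutoffDensity T q) (hp1 : 0 < p.1)
    (hp2 : p.2 ∈ Ioo 0 T) :
    HasFDerivAt (doubleLayer K T q)
      ((-(singleLayer K T (deriv q) p + doubleLayer K T (fun s => drift K T s * q s) p)) •
          ContinuousLinearMap.fst ℝ ℝ ℝ +
        (drift K T p.2 * (-(singleLayer K T (deriv q) p +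
            doubleLayer K T (fun s => drift K T s * q s) p)) + (doubleLayer K T (deriv q) p +
          (singleLayer K T (deriv fun s => drift K T s * q s) p +
            doubleLayer K T (fun s => drift K T s * (drift K T s * q s)) p))) •
            ContinuousLinearMap.snd ℝ ℝ ℝ) p := by
  obtain ⟨b, hpb, hbT⟩ := exists_between hp2.2
  have hb : 0 < b := hp2.1.trans hpb
  have hp : p ∈ region T := ⟨mem_Ici.2 hp1.le, hp2.1.le, hp2.2⟩
  have hoff : p ∈ offSource K T b := mem_offSource_of_pos hp1 hp2.2
  have hsub : Icc 0 b ⊆ Ico 0 T := fun s hs => ⟨hs.1, hs.2.trans_lt hbT⟩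
  have hq : ContinuousOn q (Icc 0 b) := h.continuousOn.mono hsub
  have hev : doubleLayer K T q =ᶠ[𝓝 p] layer K T b dipoleKernel q := by
    filter_upwards [eventually_mem_interior hp1 hp2 hpb] with w hw
    exact doubleLayer_eq_layer h.continuousOn h.zero hw.2.1 hw.1 hw.2.2.le
  refine ((hasFDerivAt_layer hb.le isHeatKernel_dipoleKernel.smooth hq hoff).congr_of_eventuallyEq
    hev).congr_fderiv ?_
  have h' := h.drift_mul K
  rw [layer_dt hb hbT isHeatKernel_dipoleKernel.smooth hq (h.deriv.continuousOn.mono hsub)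
    (fun s hs => h.hasDerivAt s ⟨hs.1, hs.2.trans hbT⟩) h.zero hoff
    (dipoleKernel_of_nonpos (by simp only [sep]; linarith)),
    layer_dx_dipoleKernel h.continuousOn h.deriv.continuousOn h.hasDerivAt h.zero hp hp1 hpb hbT,
    layer_dx_dipoleKernel h'.continuousOn h'.deriv.continuousOn h'.hasDerivAt h'.zero hp hp1
      hpb hbT,
    doubleLayer_eq_layer h.deriv.continuousOn h.deriv.zero hp hp1 hpb.le, sub_neg_eq_add]

/-- The half plane strip `ρ ≥ 0`, `0 < t < T`. -/
def positiveTimes (T : ℝ) : Set (ℝ × ℝ) := Ici 0 ×ˢ Ioo 0 T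

theorem positiveTimes_subset : positiveTimes T ⊆ region T :=
  prod_mono subset_rfl Ioo_subset_Ico_self

theorem uniqueDiffOn_positiveTimes (T : ℝ) : UniqueDiffOn ℝ (positiveTimes T) :=
  (uniqueDiffOn_Ici 0).prod isOpen_Ioo.uniqueDiffOn

/-- If the interior partial derivatives extend continuously to `ρ = 0`, then the function is
differentiable up to the boundary. -/
theorem hasFDerivWithinAt_positiveTimes {f A B : ℝ × ℝ → ℝ} (hf : ContinuousOn f (positiveTimes T))
    (hA : ContinuousOn A (positiveTimes T)) (hB : ContinuousOn B (positiveTimes T))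
    (hd : ∀ p : ℝ × ℝ, 0 < p.1 → p.2 ∈ Ioo 0 T →
      HasFDerivAt f (A p • ContinuousLinearMap.fst ℝ ℝ ℝ +
        B p • ContinuousLinearMap.snd ℝ ℝ ℝ) p) (hp : p ∈ positiveTimes T) :
    HasFDerivWithinAt f (A p • ContinuousLinearMap.fst ℝ ℝ ℝ +
        B p • ContinuousLinearMap.snd ℝ ℝ ℝ) (positiveTimes T) p := by
  obtain ⟨a, ha0, hat⟩ := exists_between hp.2.1
  obtain ⟨c, htc, hcT⟩ := exists_between hp.2.2
  set s : Set (ℝ × ℝ) := Ioi 0 ×ˢ Ioo a c with hs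
  have hcl : closure s = Ici 0 ×ˢ Icc a c := by
    rw [hs, closure_prod_eq, closure_Ioi, closure_Ioo (hat.trans htc).ne]
  have hsub : closure s ⊆ positiveTimes T := by
    rw [hcl]
    exact prod_mono subset_rfl fun x hx => ⟨ha0.trans_le hx.1, hx.2.trans_lt hcT⟩
  have hs1 : s ⊆ positiveTimes T := subset_closure.trans hsub
  have hfd : ∀ y ∈ s, HasFDerivAt f (A y • ContinuousLinearMap.fst ℝ ℝ ℝ +
      B y • ContinuousLinearMap.snd ℝ ℝ ℝ) y := fun y hy =>
    hd y hy.1 ⟨ha0.trans hy.2.1, hy.2.2.trans hcT⟩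
  have main := hasFDerivWithinAt_closure_of_tendsto_fderiv (f := f) (s := s) (x := p)
    (f' := A p • ContinuousLinearMap.fst ℝ ℝ ℝ + B p • ContinuousLinearMap.snd ℝ ℝ ℝ)
    (fun y hy => (hfd y hy).differentiableAt.differentiableWithinAt)
    ((convex_Ioi 0).prod (convex_Ioo a c)) (isOpen_Ioi.prod isOpen_Ioo)
    (fun y hy => (hf y (hsub hy)).mono hs1) ?_
  · refine main.mono_of_mem_nhdsWithin ?_
    rw [hcl]
    have : ∀ᶠ w in 𝓝[positiveTimes T] p, w ∈ positiveTimes T ∧ w.2 ∈ Ioo a c :=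
      eventually_mem_nhdsWithin.and (nhdsWithin_le_nhds
        (continuous_snd.continuousAt.eventually (Ioo_mem_nhds hat htc)))
    filter_upwards [this] with w hw
    exact ⟨hw.1.1, hw.2.1.le, hw.2.2.le⟩
  · have hcont : ContinuousWithinAt (fun y => A y • ContinuousLinearMap.fst ℝ ℝ ℝ +
        B y • ContinuousLinearMap.snd ℝ ℝ ℝ) s p :=
      (((hA p hp).mono hs1).smul continuousWithinAt_const).add
        (((hB p hp).mono hs1).smul continuousWithinAt_const)
    refine hcont.tendsto.congr' ?_
    filter_upwards [self_mem_nhdsWithin] with y hy using ((hfd y hy).fderiv).symm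

/-- Layer potentials with cut-off smooth densities are smooth up to the boundary: their
derivatives are again combinations of such potentials. -/
theorem contDiffOn_layers_nat (hK : 0 < K) (n : ℕ) : ∀ q : ℝ → ℝ, IsCutoffDensity T q →
    ContDiffOn ℝ n (singleLayer K T q) (positiveTimes T) ∧
      ContDiffOn ℝ n (doubleLayer K T q) (positiveTimes T) := by
  have hcs : ∀ q : ℝ → ℝ, IsCutoffDensity T q →
      ContinuousOn (singleLayer K T q) (positiveTimes T) := fun q h =>
    (continuousOn_singleLayer h.continuousOn).mono positiveTimes_subset
  have hcd : ∀ q : ℝ → ℝ, IsCutoffDensity T q →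
      ContinuousOn (doubleLayer K T q) (positiveTimes T) := fun q h =>
    (continuousOn_doubleLayer hK h.continuousOn).mono positiveTimes_subset
  have hg : ∀ m : ℕ, ContDiffOn ℝ m (fun p : ℝ × ℝ => drift K T p.2) (positiveTimes T) :=
    fun m p hp => ((contDiffAt_drift m hp.2.2).comp p contDiffAt_snd).contDiffWithinAt
  have hgc := (hg 0).continuousOn
  induction n with
  | zero => exact fun q h => ⟨contDiffOn_zero.2 (hcs q h), contDiffOn_zero.2 (hcd q h)⟩
  | succ n ih =>
    intro q h
    have h1 := h.drift_mul K
    have h2 := h1.drift_mul K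
    push_cast
    rw [contDiffOn_succ_iff_hasFDerivWithinAt_of_uniqueDiffOn (uniqueDiffOn_positiveTimes T),
      contDiffOn_succ_iff_hasFDerivWithinAt_of_uniqueDiffOn (uniqueDiffOn_positiveTimes T)]
    refine ⟨⟨by simp, _, ?_, fun p hp => hasFDerivWithinAt_positiveTimes (hcs q h) ?_ ?_
      (fun p hp1 hp2 => hasFDerivAt_singleLayer h hp1 hp2) hp⟩,
      ⟨by simp, _, ?_, fun p hp => hasFDerivWithinAt_positiveTimes (hcd q h) ?_ ?_
      (fun p hp1 hp2 => hasFDerivAt_doubleLayer h hp1 hp2) hp⟩⟩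
    · exact ((ih q h).2.neg.smul contDiffOn_const).add
        (((((hg n).mul (ih q h).2).neg).add ((ih _ h.deriv).1.add (ih _ h1).2)).smul
          contDiffOn_const)
    · exact (hcd q h).neg
    · exact ((hgc.mul (hcd q h)).neg).add ((hcs _ h.deriv).add (hcd _ h1))
    · exact (((ih _ h.deriv).1.add (ih _ h1).2).neg.smul contDiffOn_const).add
        ((((hg n).mul ((ih _ h.deriv).1.add (ih _ h1).2).neg).add
          ((ih _ h.deriv).2.add ((ih _ h1.deriv).1.add (ih _ h2).2))).smul contDiffOn_const)
    · exact ((hcs _ h.deriv).add (hcd _ h1)).neg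
    · exact (hgc.mul ((hcs _ h.deriv).add (hcd _ h1)).neg).add
        ((hcd _ h.deriv).add ((hcs _ h1.deriv).add (hcd _ h2)))

theorem contDiffOn_doubleLayer_cutoff (hK : 0 < K) (h : IsCutoffDensity T q) :
    ContDiffOn ℝ ∞ (doubleLayer K T q) (positiveTimes T) :=
  contDiffOn_infty.2 fun n => (contDiffOn_layers_nat hK n q h).2

/-- Smoothness of the double layer potential at positive times up to the boundary: the density is
split into a smooth cut-off part and a part whose sources lie strictly in the past. -/
theorem contDiffWithinAt_doubleLayer_boundary (hK : 0 < K) (hq : ContinuousOn q (Ico 0 T))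
    (hq0 : q 0 = 0) (hqs : ContDiffOn ℝ ∞ q (Ioo 0 T)) {t₀ : ℝ} (ht₀ : t₀ ∈ Ioo 0 T) :
    ContDiffWithinAt ℝ ∞ (doubleLayer K T q) (positiveTimes T) (0, t₀) := by
  set η : ℝ → ℝ := fun s => Real.smoothTransition ((s - t₀ / 4) / (t₀ / 4)) with hη
  have hηs : ContDiff ℝ ∞ η := by
    refine Real.smoothTransition.contDiff.comp ?_
    exact (contDiff_id.sub contDiff_const).div_const _
  have hη0 : ∀ s ≤ t₀ / 4, η s = 0 := fun s hs =>
    Real.smoothTransition.zero_of_nonpos (div_nonpos_of_nonpos_of_nonneg (by linarith)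
      (by linarith [ht₀.1]))
  have hη1 : ∀ s, t₀ / 2 ≤ s → η s = 1 := fun s hs =>
    Real.smoothTransition.one_of_one_le ((one_le_div (by linarith [ht₀.1])).2 (by linarith))
  have h1 : IsCutoffDensity T (fun s => η s * q s) := by
    refine ⟨fun s hs => ?_, t₀ / 4, by linarith [ht₀.1], fun s hs => by rw [hη0 s hs, zero_mul]⟩
    rcases lt_or_ge s (t₀ / 4) with hlt | hge
    · have : (fun s => η s * q s) =ᶠ[𝓝 s] fun _ => 0 := by
        filter_upwards [Iio_mem_nhds hlt] with x hx
        rw [hη0 x (le_of_lt hx), zero_mul]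
      exact (contDiffAt_const.congr_of_eventuallyEq this).contDiffWithinAt
    · have hs' : s ∈ Ioo 0 T := ⟨by linarith [ht₀.1], hs⟩
      exact (hηs.contDiffAt.mul (hqs.contDiffAt (isOpen_Ioo.mem_nhds hs'))).contDiffWithinAt
  set q₂ : ℝ → ℝ := fun s => (1 - η s) * q s with hq₂
  have hq₂c : ContinuousOn q₂ (Ico 0 T) :=
    (continuousOn_const.sub hηs.continuous.continuousOn).mul hq
  have ht₀2 : 0 ≤ t₀ / 2 := by linarith [ht₀.1]
  have hsubc : Icc 0 (t₀ / 2) ⊆ Ico 0 T := fun s hs =>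
    ⟨hs.1, by linarith [hs.2, ht₀.1, ht₀.2]⟩
  have hlay : ContDiffOn ℝ ∞ (layer K T (t₀ / 2) dipoleKernel q₂) (offSource K T (t₀ / 2)) :=
    contDiffOn_layer ht₀2 (hq₂c.mono hsubc) isHeatKernel_dipoleKernel.smooth
  set N : Set (ℝ × ℝ) := Ici 0 ×ˢ Ioo (t₀ / 2) T with hN
  have hNsub : N ⊆ positiveTimes T :=
    prod_mono subset_rfl fun s hs => ⟨by linarith [hs.1, ht₀.1], hs.2⟩
  have hNoff : N ⊆ offSource K T (t₀ / 2) := fun p hp => mem_offSource_of_lt hp.2.1 hp.2.2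
  have heq : EqOn (doubleLayer K T q)
      (fun p => doubleLayer K T (fun s => η s * q s) p + layer K T (t₀ / 2) dipoleKernel q₂ p)
      N := by
    refine EqOn.of_subset_closure (s := Ioi 0 ×ˢ Ioo (t₀ / 2) T) ?_
      ((continuousOn_doubleLayer hK hq).mono (hNsub.trans positiveTimes_subset))
      (((contDiffOn_doubleLayer_cutoff hK h1).continuousOn.mono hNsub).add
        (hlay.continuousOn.mono hNoff)) (prod_mono Ioi_subset_Ici_self subset_rfl) ?_
    · intro p hp
      obtain ⟨b, hpb, hbT⟩ := exists_between hp.2.2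
      have hpN : p ∈ N := ⟨mem_Ici.2 (le_of_lt hp.1), hp.2⟩
      have hpr : p ∈ region T := positiveTimes_subset (hNsub hpN)
      have hoff : p ∈ offSource K T b := mem_offSource_of_pos hp.1 hp.2.2
      have hb : 0 ≤ b := hpr.2.1.trans hpb.le
      have hbsub : Icc 0 b ⊆ Ico 0 T := fun s hs => ⟨hs.1, hs.2.trans_lt hbT⟩
      have hcd := isHeatKernel_dipoleKernel.smooth.continuousOn
      have e1 : layer K T (t₀ / 2) dipoleKernel q₂ p = layer K T b dipoleKernel q₂ p := by
        rw [layer, layer, intervalIntegral.integral_of_le ht₀2, intervalIntegral.integral_of_le hb]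
        refine (setIntegral_eq_of_subset_of_forall_sdiff_eq_zero measurableSet_Ioc
          (Ioc_subset_Ioc_right (hp.2.1.le.trans hpb.le)) fun s hs => ?_).symm
        have : t₀ / 2 ≤ s := by
          by_contra! hlt
          exact hs.2 ⟨hs.1.1, hlt.le⟩
        rw [hq₂]
        simp [hη1 s this]
      simp only
      rw [doubleLayer_eq_layer hq hq0 hpr hp.1 hpb.le,
        doubleLayer_eq_layer h1.continuousOn h1.zero hpr hp.1 hpb.le, e1]
      simp only [layer]
      rw [← intervalIntegral.integral_add
        (intervalIntegrable_layer hb hcd (h1.continuousOn.mono hbsub) hoff)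
        (intervalIntegrable_layer hb hcd (hq₂c.mono hbsub) hoff)]
      refine intervalIntegral.integral_congr fun s _ => ?_
      simp only [hq₂]
      ring
    · rw [closure_prod_eq, closure_Ioi]
      exact prod_mono subset_rfl subset_closure
  have hmem : ((0 : ℝ), t₀) ∈ N := ⟨mem_Ici.2 le_rfl, by linarith [ht₀.1], ht₀.2⟩
  have hcd : ContDiffWithinAt ℝ ∞ (doubleLayer K T q) N (0, t₀) :=
    ((((contDiffOn_doubleLayer_cutoff hK h1).mono hNsub).add (hlay.mono hNoff)).congr heq) _ hmem
  refine hcd.mono_of_mem_nhdsWithin ?_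
  have : ∀ᶠ w in 𝓝[positiveTimes T] ((0 : ℝ), t₀), w ∈ positiveTimes T ∧ t₀ / 2 < w.2 :=
    eventually_mem_nhdsWithin.and (nhdsWithin_le_nhds
      (continuousAt_const.eventually_lt continuous_snd.continuousAt
        (by simp only; linarith [ht₀.1])))
  filter_upwards [this] with w hw
  exact ⟨hw.1.1, hw.2, hw.1.2.2⟩

/-- Smoothness of the double layer potential for `ρ > 0`, the initial time included: there it agrees
with a layer potential that is smooth on both sides of `t = 0`. -/
theorem contDiffWithinAt_doubleLayer_interior (hq : ContinuousOn q (Ico 0 T)) (hq0 : q 0 = 0)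
    (hp : p ∈ region T) (hp1 : 0 < p.1) :
    ContDiffWithinAt ℝ ∞ (doubleLayer K T q) (region T) p := by
  obtain ⟨b, hpb, hbT⟩ := exists_between hp.2.2
  have hb : 0 ≤ b := hp.2.1.trans hpb.le
  have hoff : p ∈ offSource K T b := mem_offSource_of_pos hp1 hp.2.2
  have h1 : ContDiffAt ℝ ∞ (layer K T b dipoleKernel q) p :=
    (contDiffOn_layer hb (hq.mono fun s hs => ⟨hs.1, hs.2.trans_lt hbT⟩)
      isHeatKernel_dipoleKernel.smooth).contDiffAt ((isOpen_offSource K T b).mem_nhds hoff)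
  refine h1.contDiffWithinAt.congr_of_eventuallyEq ?_
    (doubleLayer_eq_layer hq hq0 hp hp1 hpb.le)
  filter_upwards [eventually_mem_nhdsWithin, nhdsWithin_le_nhds
    (continuousAt_const.eventually_lt continuous_fst.continuousAt hp1), nhdsWithin_le_nhds
    (continuous_snd.continuousAt.eventually_lt continuousAt_const hpb)] with w h1 h2 h3
  exact doubleLayer_eq_layer hq hq0 h1 h2 (le_of_lt h3)

end BoundaryRegularity

/-! ### From the potential to the solution -/

section Solution

namespace IsLinearDataSolution

variable {K T : ℝ} {u p q r : ℝ → ℝ → ℝ}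

theorem hasDerivWithinAt_space (h : IsLinearDataSolution K T u p q r) {ρ t : ℝ} (hρ : 0 ≤ ρ)
    (ht : t ∈ Ico 0 T) : HasDerivWithinAt (fun x => u x t) (p ρ t) (Ici 0) ρ := by
  rcases hρ.eq_or_lt with rfl | hρ
  · have hp : Tendsto (fun x => p x t) (𝓝[>] 0) (𝓝 (p 0 t)) := by
      have h1 : ContinuousOn (fun x => p x t) (Ici 0) :=
        h.continuousOn_p.comp (f := fun x : ℝ => (x, t)) (by fun_prop) fun _ hx => ⟨hx, ht⟩
      exact ((h1 0 self_mem_Ici).mono Ioi_subset_Ici_self).tendsto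
    refine hasDerivWithinAt_Ici_of_tendsto_deriv (s := Ioi 0)
      (fun x hx => (h.deriv_u x hx t ht).differentiableAt.differentiableWithinAt)
      ((h.continuousOn_slice ht 0 self_mem_Ici).mono Ioi_subset_Ici_self)
      self_mem_nhdsWithin (hp.congr' ?_)
    filter_upwards [self_mem_nhdsWithin] with x hx using (h.deriv_u x hx t ht).deriv.symm
  · exact (h.deriv_u ρ hρ t ht).hasDerivWithinAt

theorem dSpace_eq (h : IsLinearDataSolution K T u p q r) {ρ t : ℝ} (hρ : 0 ≤ ρ)
    (ht : t ∈ Ico 0 T) : dSpace u ρ t = p ρ t :=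
  (h.hasDerivWithinAt_space hρ ht).derivWithin (uniqueDiffOn_Ici 0 ρ hρ)

theorem dSpace_dSpace_eq (h : IsLinearDataSolution K T u p q r) {ρ t : ℝ} (hρ : 0 ≤ ρ)
    (ht : t ∈ Ico 0 T) :
    dSpace (dSpace u) ρ t = derivWithin (fun x => p x t) (Ici 0) ρ :=
  derivWithin_congr (fun _ hx => h.dSpace_eq hx ht) (h.dSpace_eq hρ ht)

theorem positiveTimes_subset_regionOffCorner : positiveTimes T ⊆ regionOffCorner T := fun _ hz =>
  ⟨positiveTimes_subset hz, fun h0 => hz.2.1.ne' (congrArg Prod.snd h0)⟩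

/-- Letting `ρ → 0` in the equation: the time derivative tends to that of the boundary value. -/
theorem tendsto_second_deriv (h : IsLinearDataSolution K T u p q r)
    (hs : ContDiffOn ℝ ∞ (fun z : ℝ × ℝ => u z.1 z.2) (regionOffCorner T)) {t : ℝ}
    (ht : t ∈ Ioo 0 T) :
    Tendsto (fun x => q x t) (𝓝[>] 0) (𝓝 (-(drift K T t * p 0 t))) := by
  set U : ℝ × ℝ → ℝ := fun z => u z.1 z.2 with hU
  have hs' := hs.mono (positiveTimes_subset_regionOffCorner (T := T))
  have htI : t ∈ Ico 0 T := ⟨ht.1.le, ht.2⟩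
  have hmem : ∀ x, 0 ≤ x → (x, t) ∈ positiveTimes T := fun x hx => ⟨hx, ht⟩
  have htime : ∀ x, 0 ≤ x → HasDerivAt (fun s => u x s)
      (fderivWithin ℝ U (positiveTimes T) (x, t) (0, 1)) t := by
    intro x hx
    have h1 := (hs'.differentiableOn (by simp) _ (hmem x hx)).hasFDerivWithinAt
    have h2 : HasDerivWithinAt (fun s : ℝ => (x, s)) (0, 1) (Ioo 0 T) t :=
      ((hasDerivAt_const t x).prodMk (hasDerivAt_id t)).hasDerivWithinAt
    exact (h1.comp_hasDerivWithinAt t h2 fun s hs => ⟨hx, hs⟩).hasDerivAt (Ioo_mem_nhds ht.1 ht.2)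
  have hcont : ContinuousOn (fun x => fderivWithin ℝ U (positiveTimes T) (x, t) (0, 1))
      (Ici 0) := by
    have h1 := hs'.continuousOn_fderivWithin (uniqueDiffOn_positiveTimes T) (by simp)
    exact (h1.comp (f := fun x : ℝ => (x, t)) (by fun_prop) fun x hx => hmem x hx).clm_apply
      continuousOn_const
  have hzero : fderivWithin ℝ U (positiveTimes T) (0, t) (0, 1) = 0 := by
    refine (htime 0 le_rfl).unique ((hasDerivAt_const t (0 : ℝ)).congr_of_eventuallyEq ?_)
    filter_upwards [Ioo_mem_nhds ht.1 ht.2] with s hs using h.boundary s ⟨hs.1.le, hs.2⟩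
  have hp : ContinuousOn (fun x => p x t) (Ici 0) :=
    h.continuousOn_p.comp (f := fun x : ℝ => (x, t)) (by fun_prop) fun _ hx => ⟨hx, htI⟩
  have hlim := (((hcont.sub (hp.const_mul (drift K T t))) 0 self_mem_Ici).mono
    Ioi_subset_Ici_self).tendsto
  simp only [Pi.sub_apply, hzero, zero_sub] at hlim
  refine hlim.congr' ?_
  filter_upwards [self_mem_nhdsWithin] with x hx
  have hx0 : 0 < x := hx
  rw [Pi.sub_apply, (htime x hx0.le).unique (h.time_u x hx t ht)]
  ring

/-- At `ρ = 0` the second space derivative is the limit of the interior one, by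
`tendsto_second_deriv`. -/
theorem isSmoothSolution (h : IsLinearDataSolution K T u p q r)
    (hs : ContDiffOn ℝ ∞ (fun z : ℝ × ℝ => u z.1 z.2) (regionOffCorner T))
    (h0 : ∀ ρ ∈ Ioi (0 : ℝ), HasDerivWithinAt (fun s => u ρ s)
      (q ρ 0 + drift K T 0 * p ρ 0) (Ici 0) 0) :
    IsSmoothSolution T (drift K T) (fun ρ => ρ) u where
  continuousOn := h.continuousOn
  continuousOn_dSpace := h.continuousOn_p.congr fun z hz => h.dSpace_eq hz.1 hz.2
  smooth := hs
  boundary := h.boundary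
  initial := h.initial
  equation ρ t hz := by
    have hρ : 0 ≤ ρ := hz.1.1
    have ht : t ∈ Ico 0 T := hz.1.2
    rw [h.dSpace_dSpace_eq hρ ht, h.dSpace_eq hρ ht]
    rcases hρ.eq_or_lt with rfl | hρ0
    · have ht0 : 0 < t := ht.1.lt_of_ne fun h0 => hz.2 (by rw [← h0]; rfl)
      have hp : ContinuousOn (fun x => p x t) (Ici 0) :=
        h.continuousOn_p.comp (f := fun x : ℝ => (x, t)) (by fun_prop) fun _ hx => ⟨hx, ht⟩
      have h1 : HasDerivWithinAt (fun x => p x t) (-(drift K T t * p 0 t)) (Ici 0) 0 := by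
        refine hasDerivWithinAt_Ici_of_tendsto_deriv (s := Ioi 0)
          (fun x hx => (h.deriv_p x hx t ht).differentiableAt.differentiableWithinAt)
          ((hp 0 self_mem_Ici).mono Ioi_subset_Ici_self) self_mem_nhdsWithin
          ((h.tendsto_second_deriv hs ⟨ht0, ht.2⟩).congr' ?_)
        filter_upwards [self_mem_nhdsWithin] with x hx using (h.deriv_p x hx t ht).deriv.symm
      have h2 : dTime u 0 t = 0 := by
        have : HasDerivAt (fun s => u 0 s) 0 t := by
          refine (hasDerivAt_const t (0 : ℝ)).congr_of_eventuallyEq ?_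
          filter_upwards [Ioo_mem_nhds ht0 ht.2] with s hs using h.boundary s ⟨hs.1.le, hs.2⟩
        exact this.hasDerivWithinAt.derivWithin (uniqueDiffOn_Ici 0 t ht.1)
      rw [h1.derivWithin (uniqueDiffOn_Ici 0 0 self_mem_Ici), h2]
      ring
    · have h2 : dTime u ρ t = q ρ t + drift K T t * p ρ t := by
        refine HasDerivWithinAt.derivWithin ?_ (uniqueDiffOn_Ici 0 t ht.1)
        rcases ht.1.eq_or_lt with rfl | ht0
        · exact h0 ρ hρ0
        · exact (h.time_u ρ hρ0 t ⟨ht0, ht.2⟩).hasDerivWithinAt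
      rw [(h.deriv_p ρ hρ0 t ht).hasDerivWithinAt.derivWithin (uniqueDiffOn_Ici 0 ρ hρ), h2]
      ring

/-- For `ρ ≥ 1` the slope satisfies `0 ≤ ρ u_ρ ≤ u ≤ 2 C ρ`. -/
theorem exists_abs_dSpace_le (h : IsLinearDataSolution K T u p q r) (hK : 0 < K) (hT : 0 < T) :
    ∃ ρ₁ C₁ : ℝ, 1 < ρ₁ ∧ 0 < C₁ ∧
      ∀ ρ t : ℝ, ρ₁ ≤ ρ → 0 ≤ t → t < T → |dSpace u ρ t| ≤ C₁ := by
  obtain ⟨C, α, hC, -, hα, hle⟩ := h.exists_le_rpow_add hK hT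
  refine ⟨2, 2 * C, one_lt_two, by linarith, fun ρ t hρ ht htT => ?_⟩
  have hρ0 : 0 < ρ := by linarith
  rw [h.dSpace_eq hρ0.le ⟨ht, htT⟩, abs_of_nonneg (h.deriv_nonneg hK hρ0 ⟨ht, htT⟩)]
  have h1 := h.mul_deriv_le hK hρ0.le ⟨ht, htT⟩
  have h2 := hle ρ t hρ0.le ⟨ht, htT⟩
  have h3 : ρ ^ α ≤ ρ := Real.rpow_le_self_of_one_le (by linarith) hα.le
  have h4 : ρ * p ρ t ≤ ρ * (2 * C) := by
    nlinarith [mul_le_mul_of_nonneg_left h3 (by linarith : 0 ≤ C)]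
  exact le_of_mul_le_mul_left h4 hρ0

end IsLinearDataSolution

theorem doubleLayer_initial {K T : ℝ} {q : ℝ → ℝ} (hT : 0 < T) (hq : ContinuousOn q (Ico 0 T))
    (hq0 : q 0 = 0) {ρ : ℝ} (hρ : 0 ≤ ρ) : doubleLayer K T q (ρ, 0) = 0 := by
  rcases hρ.eq_or_lt with rfl | hρ
  · simp [doubleLayer_boundary, hq0, heatIntegral]
  · rw [doubleLayer_eq hq hq0 ⟨mem_Ici.2 hρ.le, le_rfl, hT⟩ hρ]
    simp

/-- A density `φ` on the boundary, with derivative `φ'` up to time `0`, whose double layer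
potential cancels the boundary value `shift K T t` of the explicit solution `ρ + shift K T t`. -/
structure IsBoundaryDensity (K T : ℝ) (φ φ' : ℝ → ℝ) : Prop where
  continuousOn : ContinuousOn φ (Ico 0 T)
  continuousOn_deriv : ContinuousOn φ' (Ico 0 T)
  zero : φ 0 = 0
  hasDerivAt : ∀ t ∈ Ioo 0 T, HasDerivAt φ (φ' t) t
  smooth : ContDiffOn ℝ ∞ φ (Ioo 0 T)
  boundary : ∀ t ∈ Ico 0 T,
    φ t + heatIntegral K T (fun t s => meanDrift K T t s * φ s) (0, t) = -2 * shift K T t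

/-- The explicit solution `ρ + shift K T t` corrected by the double layer potential of `φ`. -/
def potentialSolution (K T : ℝ) (φ : ℝ → ℝ) (ρ t : ℝ) : ℝ :=
  ρ + shift K T t + doubleLayer K T φ (ρ, t)

/-- The space derivative of `potentialSolution`, in a form that makes sense up to `ρ = 0`. -/
def potentialSlope (K T : ℝ) (φ φ' : ℝ → ℝ) (ρ t : ℝ) : ℝ :=
  1 - (singleLayer K T φ' (ρ, t) + doubleLayer K T (fun s => drift K T s * φ s) (ρ, t))

/-- The space derivatives of the double layer potential of order `2`, `3`, … are layer potentials
of derivatives of the dipole kernel `κ`; the density is integrated up to the midpoint of `[t, T]`,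
the integrand being zero after time `t`. -/
def midLayer (K T : ℝ) (κ : ℝ × ℝ → ℝ) (φ : ℝ → ℝ) (ρ t : ℝ) : ℝ :=
  layer K T ((t + T) / 2) κ φ (ρ, t)

theorem IsHeatKernel.hasFDerivAt_layer {K T b : ℝ} {κ : ℝ × ℝ → ℝ} {φ : ℝ → ℝ} {z : ℝ × ℝ}
    (h : IsHeatKernel κ) (hb : 0 ≤ b) (hφ : ContinuousOn φ (Icc 0 b))
    (hz : z ∈ offSource K T b) :
    HasFDerivAt (layer K T b κ φ)
      (layer K T b (HalfLine.dx κ) φ z • ContinuousLinearMap.fst ℝ ℝ ℝ +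
        (drift K T z.2 * layer K T b (HalfLine.dx κ) φ z +
          layer K T b (HalfLine.dx (HalfLine.dx κ)) φ z) • ContinuousLinearMap.snd ℝ ℝ ℝ) z := by
  rw [← layer_congr hb h.heat hz]
  exact HalfLine.hasFDerivAt_layer hb h.smooth hφ hz

theorem IsHeatKernel.hasDerivAt_layer_space {K T b : ℝ} {κ : ℝ × ℝ → ℝ} {φ : ℝ → ℝ} {ρ t : ℝ}
    (h : IsHeatKernel κ) (hb : 0 ≤ b) (hφ : ContinuousOn φ (Icc 0 b))
    (hz : (ρ, t) ∈ offSource K T b) :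
    HasDerivAt (fun x => layer K T b κ φ (x, t)) (layer K T b (HalfLine.dx κ) φ (ρ, t)) ρ := by
  refine ((h.hasFDerivAt_layer hb hφ hz).comp_hasDerivAt (f := fun x => (x, t)) ρ
    ((hasDerivAt_id ρ).prodMk (hasDerivAt_const ρ t))).congr_deriv ?_
  simp

theorem IsHeatKernel.hasDerivAt_layer_time {K T b : ℝ} {κ : ℝ × ℝ → ℝ} {φ : ℝ → ℝ} {ρ t : ℝ}
    (h : IsHeatKernel κ) (hb : 0 ≤ b) (hφ : ContinuousOn φ (Icc 0 b))
    (hz : (ρ, t) ∈ offSource K T b) :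
    HasDerivAt (fun s => layer K T b κ φ (ρ, s))
      (drift K T t * layer K T b (HalfLine.dx κ) φ (ρ, t) +
        layer K T b (HalfLine.dx (HalfLine.dx κ)) φ (ρ, t)) t := by
  refine ((h.hasFDerivAt_layer hb hφ hz).comp_hasDerivAt (f := fun s => (ρ, s)) t
    ((hasDerivAt_const t ρ).prodMk (hasDerivAt_id t))).congr_deriv ?_
  simp

namespace IsBoundaryDensity

variable {K T : ℝ} {φ φ' : ℝ → ℝ}

theorem solution_eq (h : IsBoundaryDensity K T φ φ') {b ρ t : ℝ} (hρ : 0 < ρ) (ht : 0 ≤ t)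
    (htb : t < b) (hbT : b < T) :
    potentialSolution K T φ ρ t = ρ + shift K T t + layer K T b dipoleKernel φ (ρ, t) := by
  rw [potentialSolution, doubleLayer_eq_layer h.continuousOn h.zero
    ⟨mem_Ici.2 hρ.le, ht, htb.trans hbT⟩ hρ htb.le]

theorem slope_eq (h : IsBoundaryDensity K T φ φ') {b ρ t : ℝ} (hρ : 0 < ρ) (ht : 0 ≤ t)
    (htb : t < b) (hbT : b < T) :
    potentialSlope K T φ φ' ρ t = 1 + layer K T b (dx dipoleKernel) φ (ρ, t) := by
  rw [potentialSlope, layer_dx_dipoleKernel h.continuousOn h.continuousOn_deriv h.hasDerivAt h.zero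
    ⟨mem_Ici.2 hρ.le, ht, htb.trans hbT⟩ hρ htb hbT, sub_eq_add_neg]

theorem boundary_value (h : IsBoundaryDensity K T φ φ') {t : ℝ} (ht : t ∈ Ico 0 T) :
    potentialSolution K T φ 0 t = 0 := by
  rw [potentialSolution, doubleLayer_boundary ht.1, h.boundary t ht]
  ring

theorem hasDerivAt_solution_time (h : IsBoundaryDensity K T φ φ') {b ρ t : ℝ} (hρ : 0 < ρ)
    (ht : 0 ≤ t) (htb : t < b) (hbT : b < T) :
    HasDerivAt (fun s => ρ + shift K T s + layer K T b dipoleKernel φ (ρ, s))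
      (layer K T b (dx (dx dipoleKernel)) φ (ρ, t) +
        drift K T t * potentialSlope K T φ φ' ρ t) t := by
  have hφ : ContinuousOn φ (Icc 0 b) := h.continuousOn.mono fun s hs => ⟨hs.1, hs.2.trans_lt hbT⟩
  refine (((hasDerivAt_shift (htb.trans hbT)).const_add ρ).add
    (isHeatKernel_dipoleKernel.hasDerivAt_layer_time (ht.trans htb.le) hφ
      (mem_offSource_of_pos hρ (htb.trans hbT)))).congr_deriv ?_
  rw [h.slope_eq hρ ht htb hbT]
  ring

theorem isLinearDataSolution (h : IsBoundaryDensity K T φ φ') (hK : 0 < K) (hT : 0 < T) :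
    IsLinearDataSolution K T (potentialSolution K T φ) (potentialSlope K T φ φ')
      (midLayer K T (dx (dx dipoleKernel)) φ) (midLayer K T (dx (dx (dx dipoleKernel))) φ) := by
  have hg := continuousOn_drift_mul (K := K) h.continuousOn
  have hdx := isHeatKernel_dipoleKernel.dx
  -- facts about the midpoint of `[t, T]`
  have hmid : ∀ t ∈ Ico 0 T, 0 ≤ (t + T) / 2 ∧ t < (t + T) / 2 ∧ (t + T) / 2 < T ∧
      ContinuousOn φ (Icc 0 ((t + T) / 2)) := fun t ht => by
    have h1 := ht.1
    have h2 := ht.2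
    exact ⟨by linarith, by linarith, by linarith,
      h.continuousOn.mono fun s hs => ⟨hs.1, by linarith [hs.2]⟩⟩
  refine ⟨?_, ?_, fun t ht => h.boundary_value ht, ?_, ?_, ?_, ?_, ?_, ?_, ?_, ?_⟩
  · exact (continuous_fst.add ((continuous_shift K T).comp continuous_snd)).continuousOn.add
      (continuousOn_doubleLayer hK h.continuousOn)
  · exact continuousOn_const.sub ((continuousOn_singleLayer h.continuousOn_deriv).add
      (continuousOn_doubleLayer hK hg))
  · intro ρ hρ
    rw [potentialSolution, doubleLayer_initial hT h.continuousOn h.zero hρ, shift_zero]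
    ring
  · intro ρ hρ
    rw [potentialSlope, doubleLayer_initial hT hg (by simp [h.zero]) hρ]
    simp [singleLayer, heatIntegral]
  · intro S hS
    obtain ⟨M₁, h1⟩ := exists_bound_heatIntegral (K := K) (c := fun _ s => φ' s)
      (continuousOn_density h.continuousOn_deriv) hS.1 hS.2
    obtain ⟨M₂, h2⟩ := exists_bound_doubleLayer hK hg hS.1 hS.2
    refine ⟨1 + (M₁ + M₂), fun ρ hρ t ht => ?_⟩
    refine (abs_sub _ _).trans (add_le_add abs_one.le ((abs_add_le _ _).trans
      (add_le_add (h1 ρ t ht) (h2 ρ t hρ ht))))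
  · intro ρ hρ t ht
    obtain ⟨hb, htb, hbT, hφ⟩ := hmid t ht
    rw [h.slope_eq hρ ht.1 htb hbT]
    refine (((hasDerivAt_id ρ).add_const (shift K T t)).add
      (isHeatKernel_dipoleKernel.hasDerivAt_layer_space hb hφ
        (mem_offSource_of_pos hρ ht.2))).congr_of_eventuallyEq ?_
    filter_upwards [Ioi_mem_nhds hρ] with x hx using h.solution_eq hx ht.1 htb hbT
  · intro ρ hρ t ht
    obtain ⟨hb, htb, hbT, hφ⟩ := hmid t ht
    refine ((hdx.hasDerivAt_layer_space hb hφ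
      (mem_offSource_of_pos hρ ht.2)).const_add 1).congr_of_eventuallyEq ?_
    filter_upwards [Ioi_mem_nhds hρ] with x hx using h.slope_eq hx ht.1 htb hbT
  · intro ρ hρ t ht
    obtain ⟨hb, htb, hbT, hφ⟩ := hmid t ht
    exact hdx.dx.hasDerivAt_layer_space hb hφ (mem_offSource_of_pos hρ ht.2)
  · intro ρ hρ t ht
    obtain ⟨hb, htb, hbT, hφ⟩ := hmid t ⟨ht.1.le, ht.2⟩
    refine (h.hasDerivAt_solution_time hρ ht.1.le htb hbT).congr_of_eventuallyEq ?_
    filter_upwards [Ioo_mem_nhds ht.1 htb] with s hs using h.solution_eq hρ hs.1.le hs.2 hbT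
  · intro ρ hρ t ht
    obtain ⟨hb, htb, hbT, hφ⟩ := hmid t ⟨ht.1.le, ht.2⟩
    refine (((hdx.hasDerivAt_layer_time hb hφ
      (mem_offSource_of_pos hρ ht.2)).const_add 1).congr_of_eventuallyEq ?_).congr_deriv
      (add_comm _ _)
    filter_upwards [Ioo_mem_nhds ht.1 htb] with s hs using h.slope_eq hρ hs.1.le hs.2 hbT

/-- At time `0` only the one-sided time derivative is available, from a function that is
differentiable on both sides and agrees with the solution for `t ≥ 0`. -/
theorem hasDerivWithinAt_initial (h : IsBoundaryDensity K T φ φ') (hT : 0 < T) {ρ : ℝ}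
    (hρ : 0 < ρ) :
    HasDerivWithinAt (fun s => potentialSolution K T φ ρ s)
      (midLayer K T (dx (dx dipoleKernel)) φ ρ 0 +
        drift K T 0 * potentialSlope K T φ φ' ρ 0) (Ici 0) 0 := by
  have hb : 0 < (0 + T) / 2 := by linarith
  have hbT : (0 + T) / 2 < T := by linarith
  refine (h.hasDerivAt_solution_time hρ le_rfl hb hbT).hasDerivWithinAt.congr_of_eventuallyEq ?_
    (h.solution_eq hρ le_rfl hb hbT)
  filter_upwards [self_mem_nhdsWithin, nhdsWithin_le_nhds (Iio_mem_nhds hb)] with s hs hsb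
  exact h.solution_eq hρ hs hsb hbT

theorem contDiffOn_solution (h : IsBoundaryDensity K T φ φ') (hK : 0 < K) :
    ContDiffOn ℝ ∞ (fun z : ℝ × ℝ => potentialSolution K T φ z.1 z.2) (regionOffCorner T) := by
  refine ContDiffOn.add (fun z hz => ?_) fun z hz => ?_
  · exact (contDiffAt_fst.add
      ((contDiffAt_shift ∞ hz.1.2.2).comp z contDiffAt_snd)).contDiffWithinAt
  · have hz1 : 0 ≤ z.1 := hz.1.1
    refine ContDiffWithinAt.mono ?_ (sdiff_subset : regionOffCorner T ⊆ region T)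
    rcases hz1.eq_or_lt with h0 | hpos
    · have ht : z.2 ∈ Ioo 0 T := ⟨hz.1.2.1.lt_of_ne fun h1 => hz.2
        (Prod.ext h0.symm h1.symm), hz.1.2.2⟩
      have hz' : z = (0, z.2) := Prod.ext h0.symm rfl
      rw [hz']
      refine (contDiffWithinAt_doubleLayer_boundary hK h.continuousOn h.zero h.smooth
        ht).mono_of_mem_nhdsWithin ?_
      filter_upwards [self_mem_nhdsWithin, nhdsWithin_le_nhds
        (continuousAt_const.eventually_lt continuous_snd.continuousAt
          (show (0 : ℝ) < ((0 : ℝ), z.2).2 from ht.1))] with w hw hw2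
      exact ⟨hw.1, hw2, hw.2.2⟩
    · exact contDiffWithinAt_doubleLayer_interior h.continuousOn h.zero hz.1 hpos

end IsBoundaryDensity

end Solution

end HalfLine

theorem lemma2p1 (K T : ℝ) (hK : 0 < K) (hT : 0 < T) :
    ∃ u : ℝ → ℝ → ℝ,
      HalfLine.IsSmoothSolution T (HalfLine.drift K T) (fun ρ => ρ) u ∧
      (∃ C₀ α : ℝ, 1 ≤ C₀ ∧ 0 < α ∧ α < 1 ∧
        ∀ ρ t : ℝ, 0 ≤ ρ → 0 ≤ t → t < T →
          0 ≤ u ρ t ∧ u ρ t ≤ C₀ * (ρ ^ α + ρ)) ∧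
      (∃ ρ₁ C₁ : ℝ, 1 < ρ₁ ∧ 0 < C₁ ∧
        ∀ ρ t : ℝ, ρ₁ ≤ ρ → 0 ≤ t → t < T → |HalfLine.dSpace u ρ t| ≤ C₁) ∧
      (∀ ε : ℝ, 0 < ε → ∃ ρ₀ : ℝ, 1 < ρ₀ ∧
        ∀ ρ t : ℝ, ρ₀ ≤ ρ → 0 ≤ t → t < T → (1 - ε) * ρ ≤ u ρ t) := by
  obtain ⟨φ, φ', h1, h2, h3, h4, h5, h6⟩ := HalfLine.exists_density (K := K) hT
  have hφ : HalfLine.IsBoundaryDensity K T φ φ' := ⟨h1, h2, h3, h4, h5, h6⟩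
  have h := hφ.isLinearDataSolution hK hT
  refine ⟨HalfLine.potentialSolution K T φ, h.isSmoothSolution (hφ.contDiffOn_solution hK)
    fun ρ hρ => hφ.hasDerivWithinAt_initial hT hρ, ?_, h.exists_abs_dSpace_le hK hT, ?_⟩
  · obtain ⟨C, α, hC, hα, hα1, hle⟩ := h.exists_le_rpow_add hK hT
    exact ⟨C, α, hC, hα, hα1, fun ρ t hρ ht htT =>
      ⟨hρ.trans (h.le_apply hK hρ ⟨ht, htT⟩), hle ρ t hρ ⟨ht, htT⟩⟩⟩
  · intro ε hε
    refine ⟨2, one_lt_two, fun ρ t hρ ht htT => ?_⟩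
    have h1 := h.le_apply hK (by linarith : 0 ≤ ρ) ⟨ht, htT⟩
    have h2 := mul_pos hε (by linarith : 0 < ρ)
    linarith

end
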